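/- **Setup.** States are $\Phi=\alpha\oplus\beta\oplus\gamma\in\mathbb R^3\oplus\mathbb R^3\oplus\mathbb R$. For $\mathbf h>0$ the system $(\mathfrak a,\mathfrak b,c,\mathfrak d)[\Phi,\mathbf h,Z]=0$ for a field $\Phi=\Phi(\tau)$ reads, for all cyclic permutations $(i,j,k)$ of $(1,2,3)$, $$-\mathbf h\tfrac{d}{d\tau}\alpha_i-\beta_i^2+(\beta_j-\beta_k)^2+\tfrac23\gamma^2=0,\qquad -\mathbf h\tfrac{d}{d\tau}\beta_i+\beta_i\alpha_i=0,\qquad \mathbf h\tfrac{d}{d\tau}\gamma-\tfrac16\gamma(\alpha_1+\alpha_2+\alpha_3)=0,$$ together with the constraint $c=-4\gamma^2+\sum_{(i,j,k)}(\alpha_j\alpha_k-\beta_i^2+2\beta_j\beta_k)=0$. For $\beta_1,\beta_2,\beta_3\ne0$ put $A_i=\sqrt{\alpha_i^2+\beta_i^2}$, $\varphi_i=-\operatorname{arcsinh}(\alpha_i/|\beta_i|)$, $\xi_i[\Phi,\mathbf h]=\mathbf h\log|\tfrac12\beta_i|$, $\alpha_{i,j}=\alpha_i+\alpha_j$, $\xi_{i,j}=\xi_i+\xi_j$,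 $\rho=\gamma|\beta_1\beta_2\beta_3|^{-1/6}$. For $\sigma_*\in\{-1,1\}^3$ let $\mathcal D(\sigma_*)$ be the set of states with $(\operatorname{sgn}\beta_i)_i=\sigma_*$, and $\mathcal E(\sigma_*;\tau_0,\tau_1)$ the set of continuous maps $[\tau_0,\tau_1]\to\mathcal D(\sigma_*)$. For a permutation $\pi=(a,b,c)$ of $(1,2,3)$ let $d_{\mathcal D,(\pi,\mathbf h)}(\Phi,\Psi)$ be the maximum of the absolute differences between $\Phi$ and $\Psi$ of the seven quantities $A_a,\ \mathbf h\varphi_a/A_a,\ \alpha_{b,a},\ \xi_{b,a},\ \alpha_{c,a},\ \xi_{c,a},\ \rho^2$, and $d_{\mathcal E,(\pi,\mathbf h)}(\Phi,\Psi)=\sup_\tau d_{\mathcal D,(\pi,\mathbf h)}(\Phi(\tau),\Psi(\tau))$. Let $\mathcal H(\pi,\sigma_*)$ be the set of $\Phi\in\mathcal D(\sigma_*)$ with $|\beta_a|=|\beta_b|$, $c=0$, $0<\alpha_b<-\alpha_a$ and $(\alpha_b+|\alpha_a|)\log|\beta_a/\alpha_a|<\alpha_b\log2$. Parameters are $\mathbf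 f=(\mathbf h,w,q,z)$. * *State vector* $\Phi_*(\pi,\mathbf f,\sigma_*)\in\mathcal D(\sigma_*)$, for $\mathbf f\in(0,\infty)^2\times\mathbb R\times(0,\infty)$: $\alpha_a=-1$, $\alpha_b=\frac w{1+w}$, $\xi_a=\xi_b=-\frac{1+w}{1+2w}(1+\mathbf h\log2)$, $\xi_c=-(1+w)q-\frac{w(1+w)}{1+2w}-\frac{1+3w+w^2}{1+2w}\mathbf h\log2$, $\rho=\sqrt z$, and $\alpha_c=-w-4(1+w)\gamma^2-(1+w)(\beta_1^2+\beta_2^2+\beta_3^2-2\beta_2\beta_3-2\beta_3\beta_1-2\beta_1\beta_2)$ (i.e. the constraint holds). * *Reference field* $\Phi_0(\pi,\mathbf f,\sigma_*):\mathbb R\to\mathcal D(\sigma_*)$, for $\mathbf f\in(0,\infty)^4$: $A_a=1$, $\mathbf h\varphi_a/A_a=\tau$, $\alpha_{b,a}=-(1+w)^{-1}$, $\alpha_{c,a}=-(1+w)$, $\xi_{b,a}=-1-\mathbf h\log2-(1+w)^{-1}\tau$, $\xi_{c,a}=-(1+w)q-\mathbf h\log2-(1+w)\tau$, $\rho=\sqrt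 z$. * $\tau_-(\mathbf f)=-(1-\frac1{2+w})\min(1,q)$, $\tau_{1+}(\mathbf f)=(1+\mathbf h\log2)\frac{1+w}{1+2w}$; $\tau_{1-}(\mathbf f)=-\frac{1+w}{3+w}q-\frac1{3+w}\mathbf h\log2$ if $q\le1$ and $-\frac{1+w}{3+2w}(1+\mathbf h\log2)$ if $q>1$; $\tau_*(\mathbf f)=\frac q{1+w}$ if $q\le1$ and $1$ if $q>1$. * *Approximate transfer maps* $\mathcal P_L(\pi,\mathbf f)=(a',b',c')$, $\lambda_L$, $\mathcal Q_L(\mathbf f)=(\mathbf h_L,w_L,q_L,z_L)$ with $\mathbf h_L=\mathbf h(2+w)/\mathrm{den}_L$, $q_L=\mathrm{num1}_L/\mathrm{den}_L$, $z_L=z/\lambda_L$. If $q\le1$: $(a',b',c')=(c,a,b)$, $w_L=\frac1{1+w}$, $\lambda_L=2+w$, $\mathrm{num1}_L=(1+w)(1-q)-\mathbf h\log2+\mathbf hw\log(2+w)$, $\mathrm{den}_L=(1+w)(q-\mathbf h\log2)+\mathbf h(3+w)\log(2+w)$. If $q>1$: $(a',b',c')=(b,a,c)$, $w_L=1+w$,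 $\lambda_L=\frac{2+w}{1+w}$, $\mathrm{num1}_L=(1+w)(q-1-\mathbf h\log2)-\mathbf hw\log\frac{2+w}{1+w}$, $\mathrm{den}_L=(1+w)-\mathbf h\log2+\mathbf h(3+2w)\log\frac{2+w}{1+w}$. * $\mathbf K(\mathbf f)=2^{40}\,\mathbf h^{-2}\max\{w^{-2},w^3\}\max\{q^{-2},q\}\exp\!\left(-\tfrac1{\mathbf h}2^{-7}\tau_*(\mathbf f)\right)\max\{1,z\}^2$, and $\mathcal F$ is the (open) set of $\mathbf f\in(0,\infty)^4$ with $q\ne1$, $\mathbf K(\mathbf f)<1$ and $\mathbf h<2^{-7}\tau_*(\mathbf f)$. **Proposition 3.3.** Let $\pi=(a,b,c)$ be a permutation of $(1,2,3)$ and $\sigma_*\in\{-1,+1\}^3$. There are unique maps $$\Pi:\mathcal F\to(0,\infty)^2\times\mathbb R\times(0,\infty),\qquad \Lambda:\mathcal F\to[1,\infty),\qquad \tau_{2-}:\mathcal F\to(-\infty,0)$$ such that for all $\mathbf f=(\mathbf h,w,q,z)\in\mathcal F$: 1. $\|\Pi(\mathbf f)-\mathcal Q_L(\mathbf f)\|_{\mathbb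 R^4}\le\mathbf K(\mathbf f)$ (Euclidean norm); 2. $|\Lambda(\mathbf f)-\lambda_L(\mathbf f)|\le\mathbf K(\mathbf f)$; 3. $\tau_-(\mathbf f)<\tau_{2-}(\mathbf f)<\frac12\tau_{1-}(\mathbf f)$ and $|\tau_{2-}(\mathbf f)-\tau_{1-}(\mathbf f)|\le\mathbf K(\mathbf f)$; 4. $\Pi$, $\Lambda$ and $\tau_{2-}$ are continuous; 5. with $\tau_{2-}=\tau_{2-}(\mathbf f)$, $\tau_{2+}=\tau_{1+}(\mathbf f)$, $\pi'=(a',b',c')=\mathcal P_L(\pi,\mathbf f)$, $\lambda=\Lambda(\mathbf f)$, $\mathbf f'=\Pi(\mathbf f)$ we have $\frac12\le\tau_{2+}-\tau_{2-}\le3$, and there is a smooth field $\Phi\in\mathcal E(\sigma_*;\tau_{2-},\tau_{2+})$ such that * $(\mathfrak a,\mathfrak b,c,\mathfrak d)[\Phi,\mathbf h,Z]=0$ on $[\tau_{2-},\tau_{2+}]$; * $\Phi(\tau_{2+})=\Phi_*(\pi,\mathbf f,\sigma_*)$ and $\Phi(\tau_{2-})=\lambda\Phi_*(\pi',\mathbf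 f',\sigma_*)$; in particular $\Phi(\tau_{2+})\in\mathcal H(\pi,\sigma_*)$ and $\Phi(\tau_{2-})\in\mathcal H(\pi',\sigma_*)$; * $|\beta_a[\Phi](\tau)|\ge|\beta_{a'}[\Phi](\tau)|$ for all $\tau\in[\tau_{2-},\frac12\tau_{1-}(\mathbf f)]$, with equality if and only if $\tau=\tau_{2-}$; * $d_{\mathcal E,(\pi,\mathbf h)}(\Phi,\Phi_0)\le\mathbf K(\mathbf f)$, where $\Phi_0=\Phi_0(\pi,\mathbf f,\sigma_*)|_{[\tau_{2-},\tau_{2+}]}$; * $\sup_{\tau\in[\tau_{2-},\tau_{2+}]}\max\{\alpha_{b,c}[\Phi],\alpha_{c,a}[\Phi],\alpha_{a,b}[\Phi]\}(\tau)\le-2^{-2}\min\{w^2,w^{-1}\}$. -/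

import Mathlib

open scoped ContDiff

namespace BianchiFluid

noncomputable section

/-! ### States and the ODE system -/

/-- State vectors `Φ = α ⊕ β ⊕ γ ∈ ℝ³ ⊕ ℝ³ ⊕ ℝ`.  The indices `1, 2, 3` are the elements
`0, 1, 2` of `Fin 3`; `(i, i + 1, i + 2)` runs over the cyclic permutations. -/
abbrev State : Type := (Fin 3 → ℝ) × (Fin 3 → ℝ) × ℝ

/-- The component `α_i[Φ]`. -/
def al (Φ : State) (i : Fin 3) : ℝ := Φ.1 i

/-- The component `β_i[Φ]`. -/
def be (Φ : State) (i : Fin 3) : ℝ := Φ.2.1 i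

/-- The component `γ[Φ]`. -/
def ga (Φ : State) : ℝ := Φ.2.2

/-- `𝔞_i[Φ, h, (n, m)](τ)`, for a field `Φ` on the set `s` of times (one-sided derivatives at the
end points if `s` is a compact interval). -/
def eqA (s : Set ℝ) (Φ : ℝ → State) (h : ℝ) (n : Fin 3 → ℝ) (m : ℝ) (i : Fin 3) (τ : ℝ) : ℝ :=
  -h * derivWithin (fun t => al (Φ t) i) s τ - (n i * be (Φ τ) i) ^ 2
    + (n (i + 1) * be (Φ τ) (i + 1) - n (i + 2) * be (Φ τ) (i + 2)) ^ 2
    + 2 / 3 * (m * ga (Φ τ)) ^ 2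

/-- `𝔟_i[Φ, h](τ)`. -/
def eqB (s : Set ℝ) (Φ : ℝ → State) (h : ℝ) (i : Fin 3) (τ : ℝ) : ℝ :=
  -h * derivWithin (fun t => be (Φ t) i) s τ + be (Φ τ) i * al (Φ τ) i

/-- The constraint `c[Φ, (n, m)]`, a function of the state alone. -/
def eqC (Φ : State) (n : Fin 3 → ℝ) (m : ℝ) : ℝ :=
  -4 * (m * ga Φ) ^ 2 + ∑ i : Fin 3, (al Φ (i + 1) * al Φ (i + 2) - (n i * be Φ i) ^ 2
    + 2 * n (i + 1) * n (i + 2) * be Φ (i + 1) * be Φ (i + 2))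

/-- `𝔡[Φ, h](τ)`. -/
def eqD (s : Set ℝ) (Φ : ℝ → State) (h : ℝ) (τ : ℝ) : ℝ :=
  h * derivWithin (fun t => ga (Φ t)) s τ - 1 / 6 * ga (Φ τ) * ∑ i : Fin 3, al (Φ τ) i

/-- `(𝔞, 𝔟, c, 𝔡)[Φ, h, Z] = 0` on `s`, where `Z = (1, 1, 1, 1)`. -/
def IsSolutionOn (s : Set ℝ) (Φ : ℝ → State) (h : ℝ) : Prop :=
  ∀ τ ∈ s, (∀ i, eqA s Φ h (fun _ => 1) 1 i τ = 0) ∧ (∀ i, eqB s Φ h i τ = 0) ∧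
    eqC (Φ τ) (fun _ => 1) 1 = 0 ∧ eqD s Φ h τ = 0

/-! ### Auxiliary quantities -/

/-- `A_i[Φ] = √(α_i² + β_i²)`. -/
def amp (Φ : State) (i : Fin 3) : ℝ := √(|al Φ i| ^ 2 + |be Φ i| ^ 2)

/-- `φ_i[Φ] = - arcsinh (α_i / |β_i|)`. -/
def phi (Φ : State) (i : Fin 3) : ℝ := -Real.arsinh (al Φ i / |be Φ i|)

/-- `ξ_i[Φ, h] = h log |β_i / 2|`. -/
def xi (Φ : State) (h : ℝ) (i : Fin 3) : ℝ := h * Real.log |1 / 2 * be Φ i|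

/-- `ρ[Φ] = γ |β₁ β₂ β₃| ^ (-1/6)`. -/
def rho (Φ : State) : ℝ := ga Φ * |be Φ 0 * be Φ 1 * be Φ 2| ^ (-1 / 6 : ℝ)

/-- `α_{i,j}[Φ] = α_i + α_j`. -/
def alPair (Φ : State) (i j : Fin 3) : ℝ := al Φ i + al Φ j

/-- `ξ_{i,j}[Φ, h] = ξ_i + ξ_j`. -/
def xiPair (Φ : State) (h : ℝ) (i j : Fin 3) : ℝ := xi Φ h i + xi Φ h j

/-- `𝓓(σ)`: the states with `sgn β_i = σ_i` for all `i`. -/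
def signSet (σ : Fin 3 → ℤˣ) : Set State :=
  {Φ | ∀ i, Real.sign (be Φ i) = ((σ i : ℤ) : ℝ)}

/-- `𝓔(σ; τ₀, τ₁)`: the continuous maps `[τ₀, τ₁] → 𝓓(σ)` (values outside the interval are
irrelevant). -/
def fieldSet (σ : Fin 3 → ℤˣ) (τ₀ τ₁ : ℝ) : Set (ℝ → State) :=
  {Φ | ContinuousOn Φ (Set.Icc τ₀ τ₁) ∧ ∀ τ ∈ Set.Icc τ₀ τ₁, Φ τ ∈ signSet σ}

/-- The distance `d_{𝓓(σ),(π,h)}`, where `π = (a, b, c) = (π 0, π 1, π 2)`. -/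
def distD (π : Equiv.Perm (Fin 3)) (h : ℝ) (Φ Ψ : State) : ℝ :=
  max |amp Φ (π 0) - amp Ψ (π 0)| <|
  max |h * (phi Φ (π 0) / amp Φ (π 0)) - h * (phi Ψ (π 0) / amp Ψ (π 0))| <|
  max |alPair Φ (π 1) (π 0) - alPair Ψ (π 1) (π 0)| <|
  max |xiPair Φ h (π 1) (π 0) - xiPair Ψ h (π 1) (π 0)| <|
  max |alPair Φ (π 2) (π 0) - alPair Ψ (π 2) (π 0)| <|
  max |xiPair Φ h (π 2) (π 0) - xiPair Ψ h (π 2) (π 0)|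
    |rho Φ ^ 2 - rho Ψ ^ 2|

/-- The distance `d_{𝓔,(π,h)}(Φ, Ψ) = sup_{τ ∈ [τ₀, τ₁]} d_{𝓓,(π,h)}(Φ(τ), Ψ(τ))`. -/
def distE (π : Equiv.Perm (Fin 3)) (h τ₀ τ₁ : ℝ) (Φ Ψ : ℝ → State) : ENNReal :=
  ⨆ τ ∈ Set.Icc τ₀ τ₁, ENNReal.ofReal (distD π h (Φ τ) (Ψ τ))

/-- `β` with signs `σ` and prescribed values `x_i` of `ξ_i = h log |β_i / 2|`. -/
def betaOf (h : ℝ) (σ : Fin 3 → ℤˣ) (x : Fin 3 → ℝ) (i : Fin 3) : ℝ :=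
  ((σ i : ℤ) : ℝ) * (2 * Real.exp (x i / h))

/-- The number `γ` for which the state with the given `β` has `ρ = √z`. -/
def gammaOf (β : Fin 3 → ℝ) (z : ℝ) : ℝ := √z * |β 0 * β 1 * β 2| ^ (1 / 6 : ℝ)

/-! ### Parameters -/

/-- Parameter vectors `f = (h, w, q, z)`, in `ℝ⁴` with its Euclidean norm. -/
abbrev Param : Type := EuclideanSpace ℝ (Fin 4)

/-- The parameter `h`. -/
def hp (f : Param) : ℝ := f 0

/-- The parameter `w`. -/
def wp (f : Param) : ℝ := f 1

/-- The parameter `q`. -/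
def qp (f : Param) : ℝ := f 2

/-- The parameter `z`. -/
def zp (f : Param) : ℝ := f 3

/-- `(0,∞)² × ℝ × (0,∞)`. -/
def targetSet : Set Param := {f | 0 < hp f ∧ 0 < wp f ∧ 0 < zp f}

/-- The reference field `Φ₀(π, f, σ)`: `A_a = 1`, `h φ_a / A_a = τ` (that is, `θ_a = 0`),
`α_{b,a} = -1/(1+w)`, `α_{c,a} = -(1+w)`, `ξ_{b,a} = -1 - h log 2 - τ/(1+w)`,
`ξ_{c,a} = -(1+w) q - h log 2 - (1+w) τ`, `ρ = √z`. A vector `![x_a, x_b, x_c]` composed with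
`π.symm` is the triple whose entries at `a = π 0`, `b = π 1`, `c = π 2` are `x_a, x_b, x_c`. -/
def refField (π : Equiv.Perm (Fin 3)) (f : Param) (σ : Fin 3 → ℤˣ) (τ : ℝ) : State :=
  let h := hp f
  let w := wp f
  let q := qp f
  let αa : ℝ := -Real.tanh (τ / h)
  let ξa : ℝ := -h * Real.log (2 * Real.cosh (τ / h))
  let ξb : ℝ := -1 - h * Real.log 2 - (1 + w)⁻¹ * τ - ξa
  let ξc : ℝ := -(1 + w) * q - h * Real.log 2 - (1 + w) * τ - ξa
  let β : Fin 3 → ℝ := betaOf h σ (![ξa, ξb, ξc] ∘ π.symm)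
  (![αa, -(1 + w)⁻¹ - αa, -(1 + w) - αa] ∘ π.symm, β, gammaOf β (zp f))

/-- The state vector `Φ_*(π, f, σ)`: `α_a = -1`, `α_b = w/(1+w)`, `ξ_a = ξ_b` and `ξ_c` as given
below, `ρ = √z`, and `α_c` such that the constraint holds. -/
def stateVec (π : Equiv.Perm (Fin 3)) (f : Param) (σ : Fin 3 → ℤˣ) : State :=
  let h := hp f
  let w := wp f
  let q := qp f
  let ξa : ℝ := -((1 + w) / (1 + 2 * w)) * (1 + h * Real.log 2)
  let ξc : ℝ := -(1 + w) * q - w * (1 + w) / (1 + 2 * w)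
    - (1 + 3 * w + w ^ 2) / (1 + 2 * w) * (h * Real.log 2)
  let β : Fin 3 → ℝ := betaOf h σ (![ξa, ξa, ξc] ∘ π.symm)
  let γ : ℝ := gammaOf β (zp f)
  let μ : ℝ := (1 + w) * (β 0 ^ 2 + β 1 ^ 2 + β 2 ^ 2
    - 2 * β 1 * β 2 - 2 * β 2 * β 0 - 2 * β 0 * β 1)
  (![-1, w / (1 + w), -w - 4 * (1 + w) * γ ^ 2 - μ] ∘ π.symm, β, γ)

/-- The section `𝓗(π, σ)`. -/
def sectionSet (π : Equiv.Perm (Fin 3)) (σ : Fin 3 → ℤˣ) : Set State :=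
  {Φ | Φ ∈ signSet σ ∧ |be Φ (π 0)| = |be Φ (π 1)| ∧ eqC Φ (fun _ => 1) 1 = 0 ∧
    0 < al Φ (π 1) ∧ al Φ (π 1) < -al Φ (π 0) ∧
    (al Φ (π 1) + |al Φ (π 0)|) * Real.log |be Φ (π 0) / al Φ (π 0)|
      < al Φ (π 1) * Real.log 2}

/-- `τ₋(f)`. -/
def tauMinus (f : Param) : ℝ := -(1 - 1 / (2 + wp f)) * min 1 (qp f)

/-- `τ_{1-}(f)`. -/
def tauOneMinus (f : Param) : ℝ :=
  if qp f ≤ 1 then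
    -((1 + wp f) / (3 + wp f)) * qp f - 1 / (3 + wp f) * (hp f * Real.log 2)
  else
    -((1 + wp f) / (3 + 2 * wp f)) - (1 + wp f) / (3 + 2 * wp f) * (hp f * Real.log 2)

/-- `τ_{1+}(f)`. -/
def tauOnePlus (f : Param) : ℝ :=
  (1 + hp f * Real.log 2) * ((1 + wp f) / (1 + 2 * wp f))

/-- `𝓟_L(π, f) = (a', b', c')`, which is `(c, a, b)` if `q ≤ 1` and `(b, a, c)` if `q > 1`. -/
def permL (π : Equiv.Perm (Fin 3)) (f : Param) : Equiv.Perm (Fin 3) :=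
  if qp f ≤ 1 then π * (finRotate 3)⁻¹ else π * Equiv.swap 0 1

/-- `λ_L(f)`. -/
def lambdaL (f : Param) : ℝ :=
  if qp f ≤ 1 then 2 + wp f else (2 + wp f) / (1 + wp f)

/-- `den_L(f)`. -/
def denL (f : Param) : ℝ :=
  if qp f ≤ 1 then
    (1 + wp f) * (qp f - hp f * Real.log 2) + hp f * (3 + wp f) * Real.log (2 + wp f)
  else
    (1 + wp f) - hp f * Real.log 2
      + hp f * (3 + 2 * wp f) * Real.log ((2 + wp f) / (1 + wp f))

/-- `num1_L(f)`. -/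
def numOneL (f : Param) : ℝ :=
  if qp f ≤ 1 then
    (1 + wp f) * (1 - qp f) - hp f * Real.log 2 + hp f * wp f * Real.log (2 + wp f)
  else
    (1 + wp f) * (qp f - 1 - hp f * Real.log 2)
      - hp f * wp f * Real.log ((2 + wp f) / (1 + wp f))

/-- `num2_L(f)`. -/
def numTwoL (f : Param) : ℝ := hp f * (2 + wp f)

/-- `𝓠_L(f) = (h_L, w_L, q_L, z_L)`. -/
def mapQL (f : Param) : Param :=
  !₂[numTwoL f / denL f,
     if qp f ≤ 1 then 1 / (1 + wp f) else 1 + wp f,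
     numOneL f / denL f,
     if qp f ≤ 1 then 1 / (2 + wp f) * zp f else (1 + wp f) / (2 + wp f) * zp f]

/-- `τ_*(f)`. -/
def tauStar (f : Param) : ℝ := if qp f ≤ 1 then qp f / (1 + wp f) else 1

/-- The error bound `K(f)`. -/
def errK (f : Param) : ℝ :=
  2 ^ 40 * (1 / hp f) ^ 2 * max ((1 / wp f) ^ 2) (wp f ^ 3) * max ((1 / qp f) ^ 2) (qp f)
    * Real.exp (-(1 / hp f) * (1 / 2 ^ 7) * tauStar f) * max 1 (zp f) ^ 2

/-- The parameter set `𝓕`. -/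
def paramSet : Set Param :=
  {f | 0 < hp f ∧ 0 < wp f ∧ 0 < qp f ∧ 0 < zp f ∧
    qp f ≠ 1 ∧ errK f < 1 ∧ hp f < 1 / 2 ^ 7 * tauStar f}

end

end BianchiFluid

open BianchiFluid

namespace BianchiFluid

open Set

/-! Up to exponentially small terms only the pair (α_a, β_a) interacts, and only with itself. It
performs a free bounce with A_a constant and hφ_a equal to time, while α_{b,a} and α_{c,a} are
constant and ξ_{b,a} and ξ_{c,a} are affine; ρ is conserved exactly. In the coordinates (log A_a,
hφ_a, α_{b,a}, ξ_{b,a}, α_{c,a}, ξ_{c,a}) the full system is this free motion plus forces in which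
every term contains β_b, β_c or γ².

Let ε = exp(-τ_* / (2^7 h)) be the exponential factor of K. On an interval reaching slightly beyond
τ_{1-}, states near the reference field have |β_b|, |β_c| ≤ ε^31, hence forces of size at most ε^18.
Picard–Lindelöf in the ball of radius ε^14 around the reference field then gives an exact solution
through Φ_* (`exists_dev`, `exists_isDeviation`), from which the distance bound and the bound on the
sums α_{i,j} are read off.

Before the bounce ξ_a is close to τ, and ξ_{a'} is close to -P - h log 2 - (1 + κ)τ for constants κ,
P depending on the case. Their difference grows at a rate close to 2 + κ, so it has a single zero,
within O(ε^14) of τ_{1-} (`exists_crossing`). A state with |β_{a'}| = |β_{b'}| on the constraint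
surface is a multiple of some Φ_*(π', f') with f' explicit in the state (`eq_smul_stateVec`), and
substituting the approximate values yields 𝓠_L and λ_L up to a power of ε (`paramOf_near`). The
cases q ≤ 1 and q > 1 are treated together through `IsTransfer`.

Uniqueness: a solution is determined by its value Φ_* at the right end, the clause on equality of
|β_a| and |β_{a'}| fixes the left end, and (λ, f') can be recovered from the state there.
Continuity: in the time (τ - τ_{1+}) / h the vector field does not depend on the parameters, so
Grönwall applies, and the crossing time is located by strict inequalities between |β_a| and
|β_{a'}|, which persist under small changes of f. -/

/-! ### The evolution equations as an autonomous ODE -/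

/-- The polynomial vector field of the evolution equations, in the time `τ / h`. -/
noncomputable def vectorField (Φ : State) : State :=
  (fun i => -(Φ.2.1 i) ^ 2 + (Φ.2.1 (i + 1) - Φ.2.1 (i + 2)) ^ 2 + 2 / 3 * Φ.2.2 ^ 2,
    fun i => Φ.2.1 i * Φ.1 i, 1 / 6 * Φ.2.2 * ∑ i, Φ.1 i)

/-- `Φ` solves the evolution equations on `[a, b]` (not necessarily the constraint). -/
def IsTraj (h a b : ℝ) (Φ : ℝ → State) : Prop :=
  ∀ t ∈ Icc a b, HasDerivWithinAt Φ (h⁻¹ • vectorField (Φ t)) (Icc a b) t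

theorem contDiff_vectorField {n : WithTop ℕ∞} : ContDiff ℝ n vectorField := by
  unfold vectorField
  fun_prop

theorem IsTraj.continuousOn {h a b : ℝ} {Φ : ℝ → State} (H : IsTraj h a b Φ) :
    ContinuousOn Φ (Icc a b) := fun t ht => (H t ht).continuousWithinAt

theorem IsTraj.mono {h a b a' b' : ℝ} {Φ : ℝ → State} (H : IsTraj h a b Φ)
    (ha : a ≤ a') (hb : b' ≤ b) : IsTraj h a' b' Φ := fun t ht =>
  (H t ⟨ha.trans ht.1, ht.2.trans hb⟩).mono (Icc_subset_Icc ha hb)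

/-- Bootstrapping: the right-hand side is a smooth function of the state, so each derivative of the
solution gives one more. -/
theorem IsTraj.contDiffOn {h a b : ℝ} {Φ : ℝ → State} (H : IsTraj h a b Φ) :
    ContDiffOn ℝ ∞ Φ (Icc a b) :=
  ODE.contDiffOn_enat_Icc_of_hasDerivWithinAt (n := ⊤) (u := univ)
    (f := fun _ Φ => h⁻¹ • vectorField Φ)
    (ContDiff.contDiffOn (ContDiff.const_smul h⁻¹ (contDiff_vectorField.comp contDiff_snd)))
    H (fun _ _ => mem_univ _)

theorem IsTraj.hasDerivWithinAt_al {h a b : ℝ} {Φ : ℝ → State} (H : IsTraj h a b Φ) {t : ℝ}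
    (ht : t ∈ Icc a b) (i : Fin 3) :
    HasDerivWithinAt (fun t => al (Φ t) i) (h⁻¹ * (-(be (Φ t) i) ^ 2
      + (be (Φ t) (i + 1) - be (Φ t) (i + 2)) ^ 2 + 2 / 3 * ga (Φ t) ^ 2)) (Icc a b) t :=
  (hasDerivWithinAt_pi.1 (HasFDerivWithinAt.hasDerivWithinAt
    (H t ht).hasFDerivWithinAt.fst) i).congr_deriv (by simp [vectorField, be, ga])

theorem IsTraj.hasDerivWithinAt_be {h a b : ℝ} {Φ : ℝ → State} (H : IsTraj h a b Φ) {t : ℝ}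
    (ht : t ∈ Icc a b) (i : Fin 3) :
    HasDerivWithinAt (fun t => be (Φ t) i) (h⁻¹ * (be (Φ t) i * al (Φ t) i)) (Icc a b) t :=
  (hasDerivWithinAt_pi.1 (HasFDerivWithinAt.hasDerivWithinAt
    (H t ht).hasFDerivWithinAt.snd.fst) i).congr_deriv (by simp [vectorField, be, al])

theorem IsTraj.hasDerivWithinAt_ga {h a b : ℝ} {Φ : ℝ → State} (H : IsTraj h a b Φ) {t : ℝ}
    (ht : t ∈ Icc a b) :
    HasDerivWithinAt (fun t => ga (Φ t)) (h⁻¹ * (1 / 6 * ga (Φ t) * ∑ i, al (Φ t) i))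
      (Icc a b) t :=
  (HasFDerivWithinAt.hasDerivWithinAt (H t ht).hasFDerivWithinAt.snd.snd).congr_deriv
    (by simp [vectorField, al, ga])

theorem IsTraj.of_components {h a b : ℝ} {Φ : ℝ → State}
    (h1 : ∀ t ∈ Icc a b, ∀ i, HasDerivWithinAt (fun t => al (Φ t) i) (h⁻¹ * (-(be (Φ t) i) ^ 2
      + (be (Φ t) (i + 1) - be (Φ t) (i + 2)) ^ 2 + 2 / 3 * ga (Φ t) ^ 2)) (Icc a b) t)
    (h2 : ∀ t ∈ Icc a b, ∀ i,
      HasDerivWithinAt (fun t => be (Φ t) i) (h⁻¹ * (be (Φ t) i * al (Φ t) i)) (Icc a b) t)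
    (h3 : ∀ t ∈ Icc a b, HasDerivWithinAt (fun t => ga (Φ t))
      (h⁻¹ * (1 / 6 * ga (Φ t) * ∑ i, al (Φ t) i)) (Icc a b) t) : IsTraj h a b Φ := by
  intro t ht
  exact (hasDerivWithinAt_pi.2 (h1 t ht)).prodMk
    ((hasDerivWithinAt_pi.2 (h2 t ht)).prodMk (h3 t ht))

/-- The constraint is preserved by the evolution equations. -/
theorem IsTraj.eqC_eq {h a b : ℝ} {Φ : ℝ → State} (H : IsTraj h a b Φ)
    {t t' : ℝ} (ht : t ∈ Icc a b) (ht' : t' ∈ Icc a b) :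
    eqC (Φ t) (fun _ => 1) 1 = eqC (Φ t') (fun _ => 1) 1 := by
  rcases eq_or_lt_of_le (ht.1.trans ht.2) with hab | hab
  · subst hab
    have h1 := ht.1.antisymm ht.2
    have h2 := ht'.1.antisymm ht'.2
    rw [← h1, ← h2]
  -- The derivative of the constraint vanishes identically along the evolution, not only where the
  -- constraint is zero.
  have key : ∀ s ∈ Icc a b,
      HasDerivWithinAt (fun t => eqC (Φ t) (fun _ => 1) 1) 0 (Icc a b) s := by
    intro s hs
    have A := H.hasDerivWithinAt_al hs
    have B := H.hasDerivWithinAt_be hs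
    have G := H.hasDerivWithinAt_ga hs
    simp only [eqC, Fin.sum_univ_three] at *
    have A0 := A 0
    have A1 := A 1
    have A2 := A 2
    have B0 := B 0
    have B1 := B 1
    have B2 := B 2
    have e1 : (1 : Fin 3) + 1 = 2 := rfl
    have e2 : (1 : Fin 3) + 2 = 0 := rfl
    have e3 : (2 : Fin 3) + 1 = 0 := rfl
    have e4 : (2 : Fin 3) + 2 = 1 := rfl
    simp only [zero_add, e1, e2, e3, e4] at *
    have := ((((G.pow 2).const_mul (-4)).add
      ((((A1.mul A2).sub (B0.pow 2)).add ((B1.mul B2).const_mul 2)).add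
      (((A2.mul A0).sub (B1.pow 2)).add ((B2.mul B0).const_mul 2)))).add
      (((A0.mul A1).sub (B2.pow 2)).add ((B0.mul B1).const_mul 2)))
    refine (this.congr_deriv ?_).congr_of_mem ?_ hs
    · norm_num
      ring
    · intro x _
      simp only [Pi.add_apply, Pi.mul_apply, Pi.pow_apply, Pi.sub_apply]
      ring
  have hc := constant_of_derivWithin_zero (f := fun t => eqC (Φ t) (fun _ => 1) 1) (a := a) (b := b)
    (fun s hs => (key s hs).differentiableWithinAt)
    (fun s hs => (key s ⟨hs.1, hs.2.le⟩).derivWithin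
      (uniqueDiffOn_Icc hab s ⟨hs.1, hs.2.le⟩))
  rw [hc t ht, hc t' ht']

/-- The constraint propagates, so it is needed at one time only. A nondegenerate interval makes the
one-sided derivatives unique. -/
theorem IsTraj.isSolutionOn {h a b : ℝ} (hh : h ≠ 0) (hab : a < b) {Φ : ℝ → State}
    (H : IsTraj h a b Φ) (hc : eqC (Φ b) (fun _ => 1) 1 = 0) :
    IsSolutionOn (Icc a b) Φ h := by
  intro t ht
  have hu := uniqueDiffOn_Icc hab t ht
  refine ⟨fun i => ?_, fun i => ?_, ?_, ?_⟩
  · rw [eqA, (H.hasDerivWithinAt_al ht i).derivWithin hu]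
    field_simp
    ring
  · rw [eqB, (H.hasDerivWithinAt_be ht i).derivWithin hu]
    field_simp
    ring
  · rw [H.eqC_eq ht ⟨hab.le, le_rfl⟩, hc]
  · rw [eqD, (H.hasDerivWithinAt_ga ht).derivWithin hu]
    field_simp
    ring

/-- Smoothness matters here: `derivWithin` is zero by default where a function is not
differentiable, so the equations alone do not give a trajectory. -/
theorem IsSolutionOn.isTraj {h a b : ℝ} (hh : h ≠ 0) {Φ : ℝ → State}
    (H : IsSolutionOn (Icc a b) Φ h) (hd : ContDiffOn ℝ ∞ Φ (Icc a b)) : IsTraj h a b Φ := by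
  have hD : DifferentiableOn ℝ Φ (Icc a b) := hd.differentiableOn (by simp)
  refine .of_components (fun t ht i => ?_) (fun t ht i => ?_) (fun t ht => ?_)
  · have h1 : HasDerivWithinAt (fun t => al (Φ t) i) _ (Icc a b) t :=
      (differentiableWithinAt_pi.1 (hD t ht).fst i).hasDerivWithinAt
    refine h1.congr_deriv ?_
    have := (H t ht).1 i
    simp only [eqA] at this
    change derivWithin (fun t => al (Φ t) i) _ _ = _
    field_simp
    linarith
  · have h1 : HasDerivWithinAt (fun t => be (Φ t) i) _ (Icc a b) t :=
      (differentiableWithinAt_pi.1 (hD t ht).snd.fst i).hasDerivWithinAt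
    refine h1.congr_deriv ?_
    have := (H t ht).2.1 i
    simp only [eqB] at this
    change derivWithin (fun t => be (Φ t) i) _ _ = _
    field_simp
    linarith
  · have h1 : HasDerivWithinAt (fun t => ga (Φ t)) _ (Icc a b) t :=
      ((hD t ht).snd.snd).hasDerivWithinAt
    refine h1.congr_deriv ?_
    have := (H t ht).2.2.2
    simp only [eqD] at this
    change derivWithin (fun t => ga (Φ t)) _ _ = _
    field_simp
    linarith

theorem exists_lipschitzOnWith_vectorField (R : ℝ) :
    ∃ K, LipschitzOnWith K vectorField (Metric.closedBall 0 R) :=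
  LocallyLipschitzOn.exists_lipschitzOnWith_of_compact (isCompact_closedBall 0 R)
    (contDiff_vectorField.contDiffOn.locallyLipschitzOn (convex_closedBall 0 R))

/-- Continuous dependence on the data at the right end point, for trajectories in unit time
scale (`h = 1`) that stay in a fixed ball. -/
theorem dist_le_of_isTraj {R : ℝ} {K : NNReal}
    (hK : LipschitzOnWith K vectorField (Metric.closedBall 0 R)) {S : ℝ} {Φ Ψ : ℝ → State}
    (H1 : IsTraj 1 (-S) 0 Φ) (H2 : IsTraj 1 (-S) 0 Ψ)
    (hR1 : ∀ t ∈ Icc (-S) 0, ‖Φ t‖ ≤ R) (hR2 : ∀ t ∈ Icc (-S) 0, ‖Ψ t‖ ≤ R)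
    {t : ℝ} (ht : t ∈ Icc (-S) 0) :
    dist (Φ t) (Ψ t) ≤ dist (Φ 0) (Ψ 0) * Real.exp (K * S) := by
  -- The Grönwall estimate runs forward from the left end point, so time is reversed to start from
  -- the data at 0.
  have hneg : ∀ s ∈ Icc 0 S, -s ∈ Icc (-S) 0 := fun s hs => ⟨by linarith [hs.2], by linarith [hs.1]⟩
  have aux : ∀ {Φ : ℝ → State}, IsTraj 1 (-S) 0 Φ → ContinuousOn (fun s => Φ (-s)) (Icc 0 S) ∧
      ∀ s ∈ Ico 0 S, HasDerivWithinAt (fun s => Φ (-s)) (-vectorField (Φ (-s))) (Ici s) s := by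
    intro Φ H
    refine ⟨H.continuousOn.comp continuousOn_neg hneg, fun s hs => ?_⟩
    have h1 := H (-s) (hneg s ⟨hs.1, hs.2.le⟩)
    have h2 : HasDerivWithinAt (fun s => Φ (-s)) ((-1 : ℝ) • ((1 : ℝ)⁻¹ • vectorField (Φ (-s))))
        (Icc 0 S) s :=
      HasDerivWithinAt.scomp (h := fun s : ℝ => -s) s h1 (hasDerivAt_neg s).hasDerivWithinAt hneg
    simp only [inv_one, one_smul, neg_smul] at h2
    refine (h2.mono (Icc_subset_Icc_left hs.1)).mono_of_mem_nhdsWithin ?_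
    exact Icc_mem_nhdsGE hs.2
  have ht' : -t ∈ Icc 0 S := ⟨by linarith [ht.2], by linarith [ht.1]⟩
  have := dist_le_of_trajectories_ODE_of_mem (v := fun _ Φ => -vectorField Φ) (K := K)
    (s := fun _ => Metric.closedBall 0 R) (a := 0) (b := S) (δ := dist (Φ 0) (Ψ 0))
    (fun _ _ => hK.neg) (aux H1).1 (aux H1).2
    (fun s hs => by simpa using hR1 _ (hneg s ⟨hs.1, hs.2.le⟩)) (aux H2).1 (aux H2).2
    (fun s hs => by simpa using hR2 _ (hneg s ⟨hs.1, hs.2.le⟩)) (by simp) (-t) ht'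
  simp only [neg_neg, sub_zero] at this
  refine this.trans ?_
  gcongr
  exact ht'.2

/-- Passing from the time `τ` to `s = (τ - b) / h`. -/
theorem IsTraj.rescale {h a b : ℝ} (hh : 0 < h) {Φ : ℝ → State} (H : IsTraj h a b Φ) :
    IsTraj 1 (-((b - a) / h)) 0 (fun s => Φ (b + h * s)) := by
  intro s hs
  have hmem : ∀ s ∈ Icc (-((b - a) / h)) 0, b + h * s ∈ Icc a b := by
    intro s hs
    constructor
    · have := mul_le_mul_of_nonneg_left hs.1 hh.le
      have e : h * (-((b - a) / h)) = a - b := by field_simp; ring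
      linarith
    · nlinarith [hs.2]
  have h1 := H _ (hmem s hs)
  have h3 : HasDerivAt (fun s : ℝ => b + h * s) h s := by
    simpa using ((hasDerivAt_id s).const_mul h).const_add b
  have h2 := HasDerivWithinAt.scomp (h := fun s : ℝ => b + h * s) s h1 h3.hasDerivWithinAt hmem
  rw [smul_smul, mul_inv_cancel₀ hh.ne', one_smul] at h2
  rw [inv_one, one_smul]
  exact h2

/-- Both trajectories have compact image, hence lie in one ball on which the vector field is
Lipschitz; Grönwall with equal data does the rest. -/
theorem IsTraj.eqOn {h a b : ℝ} (hh : 0 < h) {Φ Ψ : ℝ → State}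
    (H1 : IsTraj h a b Φ) (H2 : IsTraj h a b Ψ) (hb : Φ b = Ψ b) : EqOn Φ Ψ (Icc a b) := by
  intro t ht
  obtain ⟨R1, hR1⟩ := (isCompact_Icc.image_of_continuousOn H1.continuousOn).isBounded.exists_norm_le
  obtain ⟨R2, hR2⟩ := (isCompact_Icc.image_of_continuousOn H2.continuousOn).isBounded.exists_norm_le
  obtain ⟨K, hK⟩ := exists_lipschitzOnWith_vectorField (max R1 R2)
  have hmem : ∀ s ∈ Icc (-((b - a) / h)) 0, b + h * s ∈ Icc a b := by
    intro s hs
    constructor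
    · have := mul_le_mul_of_nonneg_left hs.1 hh.le
      have e : h * (-((b - a) / h)) = a - b := by field_simp; ring
      linarith
    · nlinarith [hs.2]
  have ht' : (t - b) / h ∈ Icc (-((b - a) / h)) 0 := by
    constructor
    · rw [← neg_div, div_le_div_iff_of_pos_right hh]; linarith [ht.1]
    · exact div_nonpos_of_nonpos_of_nonneg (by linarith [ht.2]) hh.le
  have := dist_le_of_isTraj hK (H1.rescale hh) (H2.rescale hh)
    (fun s hs => (hR1 _ ⟨_, hmem s hs, rfl⟩).trans (le_max_left _ _))
    (fun s hs => (hR2 _ ⟨_, hmem s hs, rfl⟩).trans (le_max_right _ _)) ht'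
  have e : b + h * ((t - b) / h) = t := by field_simp; ring
  simp only [e, mul_zero, add_zero, hb, dist_self, zero_mul] at this
  exact dist_le_zero.1 this

/-! ### Elementary facts: tanh, permutations, β and γ in terms of ξ and z -/

theorem hasDerivAt_tanh (x : ℝ) : HasDerivAt Real.tanh (1 - Real.tanh x ^ 2) x := by
  have hc := (Real.cosh_pos x).ne'
  have h1 := (Real.hasDerivAt_sinh x).div (Real.hasDerivAt_cosh x) hc
  have e : Real.tanh = Real.sinh / Real.cosh := by
    ext y; rw [Pi.div_apply, Real.tanh_eq_sinh_div_cosh]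
  rw [e]
  refine h1.congr_deriv ?_
  rw [Pi.div_apply]
  field_simp

theorem contDiff_tanh {n : WithTop ℕ∞} : ContDiff ℝ n Real.tanh := by
  have e : Real.tanh = fun x => Real.sinh x / Real.cosh x := by
    ext y; rw [Real.tanh_eq_sinh_div_cosh]
  rw [e]
  exact Real.contDiff_sinh.div Real.contDiff_cosh fun x => (Real.cosh_pos x).ne'

/-- The equations refer to the indices i + 1 and i + 2, but symmetrically. To relabel them by π it
is enough that these are the two other indices, in either order. -/
theorem perm_succ (π : Equiv.Perm (Fin 3)) :
    ((π 0 + 1 = π 1 ∧ π 0 + 2 = π 2) ∨ (π 0 + 1 = π 2 ∧ π 0 + 2 = π 1)) ∧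
    ((π 1 + 1 = π 0 ∧ π 1 + 2 = π 2) ∨ (π 1 + 1 = π 2 ∧ π 1 + 2 = π 0)) ∧
    ((π 2 + 1 = π 0 ∧ π 2 + 2 = π 1) ∨ (π 2 + 1 = π 1 ∧ π 2 + 2 = π 0)) := by
  revert π; decide

theorem forall_perm (π : Equiv.Perm (Fin 3)) {p : Fin 3 → Prop} (h0 : p (π 0)) (h1 : p (π 1))
    (h2 : p (π 2)) (i : Fin 3) : p i := by
  obtain ⟨j, rfl⟩ := π.surjective i
  fin_cases j
  exacts [h0, h1, h2]

theorem abs_unit_cast (s : ℤˣ) : |((s : ℤ) : ℝ)| = 1 := by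
  rcases Int.units_eq_one_or s with rfl | rfl <;> simp

theorem abs_betaOf (h : ℝ) (σ : Fin 3 → ℤˣ) (x : Fin 3 → ℝ) (i : Fin 3) :
    |betaOf h σ x i| = 2 * Real.exp (x i / h) := by
  rw [betaOf, abs_mul, abs_unit_cast, one_mul, abs_of_pos (by positivity)]

theorem betaOf_ne_zero (h : ℝ) (σ : Fin 3 → ℤˣ) (x : Fin 3 → ℝ) (i : Fin 3) :
    betaOf h σ x i ≠ 0 := by
  rw [← abs_pos, abs_betaOf]; positivity

theorem sign_betaOf (h : ℝ) (σ : Fin 3 → ℤˣ) (x : Fin 3 → ℝ) (i : Fin 3) :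
    Real.sign (betaOf h σ x i) = ((σ i : ℤ) : ℝ) := by
  have hp : (0 : ℝ) < 2 * Real.exp (x i / h) := by positivity
  rw [betaOf]
  rcases Int.units_eq_one_or (σ i) with hs | hs
  · rw [hs]; simp [Real.sign_of_pos hp]
  · rw [hs]
    rw [Real.sign_of_neg]
    · simp
    · simp; positivity

theorem gammaOf_betaOf (h z : ℝ) (σ : Fin 3 → ℤˣ) (x : Fin 3 → ℝ) :
    gammaOf (betaOf h σ x) z = √z * (√2 * Real.exp ((x 0 + x 1 + x 2) / h / 6)) := by
  rw [gammaOf, abs_mul, abs_mul, abs_betaOf, abs_betaOf, abs_betaOf]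
  congr 1
  have e : 2 * Real.exp (x 0 / h) * (2 * Real.exp (x 1 / h)) * (2 * Real.exp (x 2 / h))
      = (2 : ℝ) ^ (3 : ℝ) * Real.exp ((x 0 + x 1 + x 2) / h) := by
    rw [add_div, add_div, Real.exp_add, Real.exp_add]; norm_num; ring
  rw [e, Real.mul_rpow (by positivity) (by positivity), ← Real.rpow_mul (by norm_num),
    Real.sqrt_eq_rpow, ← Real.exp_mul]
  norm_num
  ring_nf

theorem rho_sq_of_ga {Φ : State} {z : ℝ} (hz : 0 ≤ z) (hb : ∀ i, be Φ i ≠ 0)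
    (hg : ga Φ = gammaOf Φ.2.1 z) : rho Φ ^ 2 = z := by
  have hp : 0 < |be Φ 0 * be Φ 1 * be Φ 2| :=
    abs_pos.2 (mul_ne_zero (mul_ne_zero (hb 0) (hb 1)) (hb 2))
  have : rho Φ = √z := by
    rw [rho, hg, gammaOf]
    change √z * |be Φ 0 * be Φ 1 * be Φ 2| ^ _ * _ = _
    rw [mul_assoc, ← Real.rpow_add hp]
    norm_num
  rw [this, Real.sq_sqrt hz]

/-! ### Coordinates adapted to the bounce of one pair `(α_a, β_a)` -/

/-- `ξ_a` in terms of `y = (log A_a, h φ_a, α_{b,a}, ξ_{b,a}, α_{c,a}, ξ_{c,a})`. -/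
noncomputable def xiA (h : ℝ) (y : Fin 6 → ℝ) : ℝ :=
  h * (y 0 - Real.log (2 * Real.cosh (y 1 / h)))

/-- `α_a` in terms of the bounce coordinates. -/
noncomputable def alA (h : ℝ) (y : Fin 6 → ℝ) : ℝ := -(Real.exp (y 0) * Real.tanh (y 1 / h))

/-- `(ξ_a, ξ_b, ξ_c)` in terms of the bounce coordinates. -/
noncomputable def xiVec (h : ℝ) (y : Fin 6 → ℝ) : Fin 3 → ℝ :=
  ![xiA h y, y 3 - xiA h y, y 5 - xiA h y]

/-- `(α_a, α_b, α_c)` in terms of the bounce coordinates. -/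
noncomputable def alVec (h : ℝ) (y : Fin 6 → ℝ) : Fin 3 → ℝ :=
  ![alA h y, y 2 - alA h y, y 4 - alA h y]

/-- The state with given bounce coordinates, signs `σ`, and `ρ = √z`. -/
noncomputable def stateOf (π : Equiv.Perm (Fin 3)) (σ : Fin 3 → ℤˣ) (h z : ℝ) (y : Fin 6 → ℝ) :
    State :=
  (alVec h y ∘ π.symm, betaOf h σ (xiVec h y ∘ π.symm),
    gammaOf (betaOf h σ (xiVec h y ∘ π.symm)) z)

/-- `β_{π j}` in terms of the bounce coordinates, with `s = σ ∘ π`. -/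
noncomputable def bet (s : Fin 3 → ℤˣ) (h : ℝ) (y : Fin 6 → ℝ) (j : Fin 3) : ℝ :=
  ((s j : ℤ) : ℝ) * (2 * Real.exp (xiVec h y j / h))

/-- `γ²` in terms of the bounce coordinates. -/
noncomputable def gaSq (h z : ℝ) (y : Fin 6 → ℝ) : ℝ :=
  2 * z * Real.exp ((y 3 + y 5 - xiA h y) / h / 3)

/-- The perturbation of the free bounce. -/
noncomputable def forceE (s : Fin 3 → ℤˣ) (h z : ℝ) (y : Fin 6 → ℝ) : ℝ :=
  (bet s h y 1 - bet s h y 2) ^ 2 + 2 / 3 * gaSq h z y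

/-- `h dα_{b,a}/dτ`. -/
noncomputable def forceU (s : Fin 3 → ℤˣ) (h z : ℝ) (y : Fin 6 → ℝ) : ℝ :=
  2 * bet s h y 2 * (bet s h y 2 - bet s h y 1 - bet s h y 0) + 4 / 3 * gaSq h z y

/-- `h dα_{c,a}/dτ`. -/
noncomputable def forceV (s : Fin 3 → ℤˣ) (h z : ℝ) (y : Fin 6 → ℝ) : ℝ :=
  2 * bet s h y 1 * (bet s h y 1 - bet s h y 2 - bet s h y 0) + 4 / 3 * gaSq h z y

/-- The evolution equations in bounce coordinates. -/
noncomputable def yField (s : Fin 3 → ℤˣ) (h z : ℝ) (y : Fin 6 → ℝ) : Fin 6 → ℝ :=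
  ![-(Real.tanh (y 1 / h) * forceE s h z y * Real.exp (-y 0)) / h,
    Real.exp (y 0) - forceE s h z y * Real.exp (-y 0),
    forceU s h z y / h, y 2, forceV s h z y / h, y 4]

section
variable (π : Equiv.Perm (Fin 3)) (σ : Fin 3 → ℤˣ) (h z : ℝ) (y : Fin 6 → ℝ)

theorem al_stateOf (j : Fin 3) : al (stateOf π σ h z y) (π j) = alVec h y j := by
  simp [al, stateOf]

theorem be_stateOf (j : Fin 3) :
    be (stateOf π σ h z y) (π j) = bet (σ ∘ π) h y j := by
  simp [be, stateOf, betaOf, bet]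

theorem abs_bet (s : Fin 3 → ℤˣ) (j : Fin 3) :
    |bet s h y j| = 2 * Real.exp (xiVec h y j / h) := by
  rw [bet, abs_mul, abs_unit_cast, one_mul, abs_of_pos (by positivity)]

theorem abs_be_stateOf (j : Fin 3) :
    |be (stateOf π σ h z y) (π j)| = 2 * Real.exp (xiVec h y j / h) := by
  rw [be_stateOf, abs_bet]

theorem be_stateOf_ne_zero (i : Fin 3) : be (stateOf π σ h z y) i ≠ 0 :=
  betaOf_ne_zero _ _ _ _

theorem stateOf_mem_signSet : stateOf π σ h z y ∈ signSet σ := fun i => sign_betaOf _ _ _ i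

theorem ga_stateOf : ga (stateOf π σ h z y)
    = √z * (√2 * Real.exp ((y 3 + y 5 - xiA h y) / h / 6)) := by
  rw [stateOf, ga, gammaOf_betaOf]
  have : (xiVec h y ∘ π.symm) 0 + (xiVec h y ∘ π.symm) 1 + (xiVec h y ∘ π.symm) 2
      = y 3 + y 5 - xiA h y := by
    have h1 : ∑ i, (xiVec h y ∘ π.symm) i = ∑ j, xiVec h y j := Equiv.sum_comp π.symm _
    rw [Fin.sum_univ_three, Fin.sum_univ_three] at h1
    rw [h1]
    simp [xiVec]
    ring
  rw [this]

theorem ga_stateOf_sq (hz : 0 ≤ z) : ga (stateOf π σ h z y) ^ 2 = gaSq h z y := by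
  rw [ga_stateOf, gaSq, mul_pow, mul_pow, Real.sq_sqrt hz, Real.sq_sqrt (by norm_num),
    ← Real.exp_nat_mul]
  push_cast
  ring_nf

theorem rho_stateOf_sq (hz : 0 ≤ z) : rho (stateOf π σ h z y) ^ 2 = z :=
  rho_sq_of_ga hz (be_stateOf_ne_zero π σ h z y) rfl

theorem sum_al_stateOf : ∑ i, al (stateOf π σ h z y) i = y 2 + y 4 - alA h y := by
  rw [← Equiv.sum_comp π, Fin.sum_univ_three, al_stateOf, al_stateOf, al_stateOf]
  simp [alVec]; ring

variable {h}

/-- In polar form |β_a| = A_a / cosh φ_a and α_a = -A_a tanh φ_a; `xiA` is h times the logarithm of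
half the former. -/
theorem exp_xiA_div (hh : h ≠ 0) :
    2 * Real.exp (xiA h y / h) = Real.exp (y 0) / Real.cosh (y 1 / h) := by
  have hc := Real.cosh_pos (y 1 / h)
  rw [xiA, mul_div_cancel_left₀ _ hh, Real.exp_sub, Real.exp_log (by positivity)]
  field_simp

theorem amp_stateOf (hh : h ≠ 0) : amp (stateOf π σ h z y) (π 0) = Real.exp (y 0) := by
  have hc := Real.cosh_pos (y 1 / h)
  rw [amp, abs_be_stateOf, al_stateOf, sq_abs]
  simp only [alVec, xiVec, Matrix.cons_val_zero]
  rw [exp_xiA_div y hh, alA, Real.tanh_eq_sinh_div_cosh]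
  have e : (-(Real.exp (y 0) * (Real.sinh (y 1 / h) / Real.cosh (y 1 / h)))) ^ 2
      + (Real.exp (y 0) / Real.cosh (y 1 / h)) ^ 2 = Real.exp (y 0) ^ 2 := by
    have := Real.cosh_sq (y 1 / h)
    field_simp
    rw [this]
  rw [e, Real.sqrt_sq (by positivity)]

theorem phi_stateOf (hh : h ≠ 0) : phi (stateOf π σ h z y) (π 0) = y 1 / h := by
  have hc := Real.cosh_pos (y 1 / h)
  rw [phi, abs_be_stateOf, al_stateOf]
  simp only [alVec, xiVec, Matrix.cons_val_zero]
  rw [exp_xiA_div y hh, alA, Real.tanh_eq_sinh_div_cosh]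
  have e : -(Real.exp (y 0) * (Real.sinh (y 1 / h) / Real.cosh (y 1 / h)))
      / (Real.exp (y 0) / Real.cosh (y 1 / h)) = Real.sinh (-(y 1 / h)) := by
    have := Real.exp_pos (y 0)
    rw [Real.sinh_neg]
    field_simp
  rw [e, Real.arsinh_sinh, neg_neg]

theorem xi_stateOf (hh : h ≠ 0) (j : Fin 3) :
    xi (stateOf π σ h z y) h (π j) = xiVec h y j := by
  rw [xi, abs_mul, abs_be_stateOf, abs_of_pos (by norm_num : (0 : ℝ) < 1 / 2), ← mul_assoc]
  norm_num
  field_simp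

end

/-- The force enters the equations of log A_a and hφ_a in such proportions that it cancels from the
derivative of ξ_a, leaving α_a exactly; in the derivative of α_a it survives with coefficient cosh⁻²
+ tanh² = 1. -/
theorem hasDerivWithinAt_xiVec_alVec {s : Fin 3 → ℤˣ} {h z : ℝ} (hh : h ≠ 0)
    {y : ℝ → Fin 6 → ℝ} {S : Set ℝ} {t : ℝ}
    (H : HasDerivWithinAt y (yField s h z (y t)) S t) :
    (∀ j, HasDerivWithinAt (fun t => xiVec h (y t) j) (alVec h (y t) j) S t) ∧
    HasDerivWithinAt (fun t => alA h (y t))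
      ((forceE s h z (y t) - bet s h (y t) 0 ^ 2) / h) S t := by
  have D := hasDerivWithinAt_pi.1 H
  have D0 := D 0
  have D1 := D 1
  have D3 := D 3
  have D5 := D 5
  simp only [yField, Matrix.cons_val] at D0 D1 D3 D5
  have hc := Real.cosh_pos (y t 1 / h)
  have C1 := (D1.div_const h).cosh.const_mul 2
  have L1 := C1.log (by positivity)
  have X := (D0.sub L1).const_mul h
  have X' : HasDerivWithinAt (fun t => xiA h (y t)) (alA h (y t)) S t := by
    refine X.congr_deriv ?_
    rw [alA, Real.tanh_eq_sinh_div_cosh, Real.exp_neg]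
    have := Real.exp_pos (y t 0)
    field_simp
    ring
  refine ⟨fun j => ?_, ?_⟩
  · fin_cases j
    · exact X'
    · exact D3.sub X'
    · exact D5.sub X'
  · have T : HasDerivWithinAt (fun t => Real.tanh (y t 1 / h)) _ S t :=
      HasDerivAt.comp_hasDerivWithinAt (h₂ := Real.tanh) (h := fun t => y t 1 / h) t
        (hasDerivAt_tanh (y t 1 / h)) (D1.div_const h)
    refine (D0.exp.mul T).neg.congr_deriv ?_
    have hb : bet s h (y t) 0 ^ 2 = (Real.exp (y t 0) / Real.cosh (y t 1 / h)) ^ 2 := by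
      rw [← sq_abs, abs_bet, ← exp_xiA_div _ hh]; rfl
    have hs := Real.cosh_sq (y t 1 / h)
    have hs2 : 1 - Real.tanh (y t 1 / h) ^ 2 = 1 / Real.cosh (y t 1 / h) ^ 2 := by
      rw [Real.tanh_eq_sinh_div_cosh]; field_simp; linarith
    have hs3 : Real.tanh (y t 1 / h) ^ 2 = 1 - 1 / Real.cosh (y t 1 / h) ^ 2 := by
      rw [← hs2]; ring
    rw [hb, hs2, Real.exp_neg]
    have := Real.exp_pos (y t 0)
    generalize Real.exp (y t 0) = A at *
    generalize forceE s h z (y t) = e at *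
    generalize Real.cosh (y t 1 / h) = c at *
    generalize Real.tanh (y t 1 / h) = θ at *
    have e1 : -(A * (-(θ * e * A⁻¹) / h) * θ + A * (1 / c ^ 2 * ((A - e * A⁻¹) / h)))
      = (e * θ ^ 2 + e / c ^ 2 - A ^ 2 / c ^ 2) / h := by
      field_simp
      ring
    rw [e1, hs3]
    field_simp
    ring

/-- The equation for γ needs no coordinate of its own: it says that ρ is constant, and `stateOf`
defines γ from β and the fixed value ρ = √z. -/
theorem isTraj_stateOf {π : Equiv.Perm (Fin 3)} {σ : Fin 3 → ℤˣ} {h z : ℝ} (hh : h ≠ 0)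
    (hz : 0 ≤ z) {y : ℝ → Fin 6 → ℝ} {a b : ℝ}
    (H : ∀ t ∈ Icc a b, HasDerivWithinAt y (yField (σ ∘ π) h z (y t)) (Icc a b) t) :
    IsTraj h a b (fun t => stateOf π σ h z (y t)) := by
  refine .of_components (fun t ht => ?_) (fun t ht => ?_) (fun t ht => ?_)
  · have D := hasDerivWithinAt_pi.1 (H t ht)
    have D2 := D 2
    have D4 := D 4
    simp only [yField, Matrix.cons_val] at D2 D4
    have A := (hasDerivWithinAt_xiVec_alVec hh (H t ht)).2
    have hg := ga_stateOf_sq π σ h z (y t) hz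
    obtain ⟨p0, p1, p2⟩ := perm_succ π
    refine forall_perm π ?_ ?_ ?_
    · simp only [al_stateOf]
      refine A.congr_deriv ?_
      rcases p0 with ⟨e1, e2⟩ | ⟨e1, e2⟩ <;>
      · rw [e1, e2, hg, be_stateOf, be_stateOf, be_stateOf, forceE]
        ring
    · simp only [al_stateOf]
      refine (D2.sub A).congr_deriv ?_
      rcases p1 with ⟨e1, e2⟩ | ⟨e1, e2⟩ <;>
      · rw [e1, e2, hg, be_stateOf, be_stateOf, be_stateOf, forceE, forceU]
        ring
    · simp only [al_stateOf]
      refine (D4.sub A).congr_deriv ?_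
      rcases p2 with ⟨e1, e2⟩ | ⟨e1, e2⟩ <;>
      · rw [e1, e2, hg, be_stateOf, be_stateOf, be_stateOf, forceE, forceV]
        ring
  · have X := (hasDerivWithinAt_xiVec_alVec hh (H t ht)).1
    have key : ∀ j, HasDerivWithinAt (fun t => be (stateOf π σ h z (y t)) (π j))
        (h⁻¹ * (be (stateOf π σ h z (y t)) (π j) * al (stateOf π σ h z (y t)) (π j)))
        (Icc a b) t := by
      intro j
      simp only [al_stateOf, be_stateOf]
      refine ((((X j).div_const h).exp.const_mul 2).const_mul _).congr_deriv ?_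
      rw [bet]
      ring
    exact forall_perm π (key 0) (key 1) (key 2)
  · have X := (hasDerivWithinAt_xiVec_alVec hh (H t ht)).1
    have D := hasDerivWithinAt_pi.1 (H t ht)
    have D3 := D 3
    have D5 := D 5
    simp only [yField, Matrix.cons_val] at D3 D5
    have X0 : HasDerivWithinAt (fun t => xiA h (y t)) (alA h (y t)) (Icc a b) t := X 0
    simp only [ga_stateOf, sum_al_stateOf]
    refine ((((((D3.add D5).sub X0).div_const h).div_const 6).exp.const_mul _).const_mul
      _).congr_deriv ?_
    simp only [Pi.add_apply, Pi.sub_apply]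
    ring

/-! ### Existence of solutions in a prescribed ball; the deviation from the free bounce -/

open Metric

/-- Picard–Lindelöf with data at the right end point, together with the information that the
solution stays in the ball on which the vector field is bounded. -/
theorem exists_solution_mem_closedBall {E : Type*} [NormedAddCommGroup E] [NormedSpace ℝ E]
    [FiniteDimensional ℝ E] {f : ℝ → E → E} (hf : ContDiff ℝ 1 (Function.uncurry f))
    {a b R r L : ℝ} (hab : a ≤ b) (hR : 0 ≤ R) (hr : 0 ≤ r) (hL0 : 0 ≤ L)
    (hb : ∀ t ∈ Icc a b, ∀ x, ‖x‖ ≤ R → ‖f t x‖ ≤ L) (hL : L * (b - a) ≤ R - r)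
    {x : E} (hx : ‖x‖ ≤ r) :
    ∃ α : ℝ → E, α b = x ∧ ∀ t ∈ Icc a b,
      HasDerivWithinAt α (f t (α t)) (Icc a b) t ∧ ‖α t‖ ≤ R := by
  have : ProperSpace E := FiniteDimensional.proper ℝ E
  have : CompleteSpace E := FiniteDimensional.complete ℝ E
  lift R to NNReal using hR
  lift r to NNReal using hr
  lift L to NNReal using hL0
  obtain ⟨K, hK⟩ := LocallyLipschitzOn.exists_lipschitzOnWith_of_compact
    (isCompact_Icc.prod (isCompact_closedBall (0 : E) R))
    (hf.contDiffOn.locallyLipschitzOn ((convex_Icc a b).prod (convex_closedBall (0 : E) R)))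
  have PL : IsPicardLindelof f (⟨b, hab, le_rfl⟩ : Icc a b) (0 : E) R r L K := by
    refine ⟨fun t ht => ?_, fun x _ => ?_, fun t ht x hx => hb t ht x (by simpa using hx), ?_⟩
    · intro x hx y hy
      have := hK (x := (t, x)) (y := (t, y)) ⟨ht, hx⟩ ⟨ht, hy⟩
      simpa [Prod.edist_eq, Function.uncurry] using this
    · have : Continuous (Function.uncurry f) := hf.continuous
      exact (this.comp (by fun_prop : Continuous fun t : ℝ => (t, x))).continuousOn
    · simpa [max_eq_right (sub_nonneg.2 hab)] using hL
  have hx' : x ∈ closedBall (0 : E) r := by simpa using hx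
  -- The Picard fixed point is taken directly in the space of curves, because membership in that
  -- space carries the bound by R.
  obtain ⟨α, hα⟩ := ODE.FunSpace.exists_isFixedPt_next PL hx'
  have hmem : ∀ t, α.compProj t ∈ closedBall (0 : E) R :=
    fun t => α.compProj_mem_closedBall PL.mul_max_le
  have heq : ∀ t ∈ Icc a b, α.compProj t = ODE.picard f b x α.compProj t := by
    intro t ht
    rw [ODE.FunSpace.compProj_of_mem ht]
    exact (ODE.FunSpace.isFixedPt_next_iff PL hx').1 hα ⟨t, ht⟩
  refine ⟨α.compProj, ?_, fun t ht => ⟨?_, by simpa using hmem t⟩⟩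
  · rw [heq b ⟨hab, le_rfl⟩, ODE.picard_apply₀]
  · exact (ODE.hasDerivWithinAt_picard_Icc (u := closedBall 0 R) ⟨hab, le_rfl⟩
      hf.continuous.continuousOn α.continuous_compProj.continuousOn (fun t _ => hmem t) x
      ht).congr_of_mem heq ht

theorem contDiff_xiA {h : ℝ} {n : WithTop ℕ∞} : ContDiff ℝ n (xiA h) := by
  have : ∀ y : Fin 6 → ℝ, 2 * Real.cosh (y 1 / h) ≠ 0 := fun y => by
    have := Real.cosh_pos (y 1 / h); positivity
  unfold xiA
  refine contDiff_const.mul (ContDiff.sub (by fun_prop) (ContDiff.log ?_ this))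
  exact contDiff_const.mul (Real.contDiff_cosh.comp (by fun_prop))

theorem contDiff_bet {s : Fin 3 → ℤˣ} {h : ℝ} {n : WithTop ℕ∞} (j : Fin 3) :
    ContDiff ℝ n (fun y => bet s h y j) := by
  have hx : ContDiff ℝ n (xiA h) := contDiff_xiA
  have : ContDiff ℝ n (fun y => xiVec h y j) := by
    fin_cases j <;> simp [xiVec] <;> fun_prop
  unfold bet
  fun_prop

theorem contDiff_yField {s : Fin 3 → ℤˣ} {h z : ℝ} {n : WithTop ℕ∞} :
    ContDiff ℝ n (yField s h z) := by
  have hx : ContDiff ℝ n (xiA h) := contDiff_xiA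
  have b0 : ContDiff ℝ n (fun y => bet s h y 0) := contDiff_bet 0
  have b1 : ContDiff ℝ n (fun y => bet s h y 1) := contDiff_bet 1
  have b2 : ContDiff ℝ n (fun y => bet s h y 2) := contDiff_bet 2
  have hg : ContDiff ℝ n (gaSq h z) := by unfold gaSq; fun_prop
  have he : ContDiff ℝ n (forceE s h z) := by unfold forceE; fun_prop
  have hu : ContDiff ℝ n (forceU s h z) := by unfold forceU; fun_prop
  have hv : ContDiff ℝ n (forceV s h z) := by unfold forceV; fun_prop
  have ht : ContDiff ℝ n (fun y : Fin 6 → ℝ => Real.tanh (y 1 / h)) :=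
    contDiff_tanh.comp (by fun_prop)
  refine contDiff_pi.2 fun j => ?_
  fin_cases j <;> simp [yField] <;> fun_prop

/-- Bounce coordinates of the reference field at time `t`, with (weighted) deviation `d`. -/
noncomputable def yDev (h κb Pb κc Pc t : ℝ) (d : Fin 6 → ℝ) : Fin 6 → ℝ :=
  -- The entries 0, 2, 4 drive the entries 1, 3, 5 without any small factor. The weight 1/16 keeps
  -- this coupling below one sixth of the radius of the ball.
  ![d 0 / 16, t + d 1, -κb + d 2 / 16, -Pb - h * Real.log 2 - κb * t + d 3,
    -κc + d 4 / 16, -Pc - h * Real.log 2 - κc * t + d 5]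

/-- The equation for the weighted deviation. -/
noncomputable def devField (s : Fin 3 → ℤˣ) (h z κb Pb κc Pc t : ℝ) (d : Fin 6 → ℝ) :
    Fin 6 → ℝ :=
  ![16 * yField s h z (yDev h κb Pb κc Pc t d) 0, yField s h z (yDev h κb Pb κc Pc t d) 1 - 1,
    16 * yField s h z (yDev h κb Pb κc Pc t d) 2, d 2 / 16,
    16 * yField s h z (yDev h κb Pb κc Pc t d) 4, d 4 / 16]

theorem contDiff_devField {s : Fin 3 → ℤˣ} {h z κb Pb κc Pc : ℝ} {n : WithTop ℕ∞} :
    ContDiff ℝ n (Function.uncurry (devField s h z κb Pb κc Pc)) := by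
  have h1 : ContDiff ℝ n (fun p : ℝ × (Fin 6 → ℝ) => yDev h κb Pb κc Pc p.1 p.2) := by
    refine contDiff_pi.2 fun j => ?_
    fin_cases j <;> simp [yDev] <;> fun_prop
  have h2 : ContDiff ℝ n (fun p : ℝ × (Fin 6 → ℝ) =>
      yField s h z (yDev h κb Pb κc Pc p.1 p.2)) := contDiff_yField.comp h1
  have h3 := contDiff_pi.1 h2
  refine contDiff_pi.2 fun j => ?_
  fin_cases j
  · exact contDiff_const.mul (h3 0)
  · exact (h3 1).sub contDiff_const
  · exact contDiff_const.mul (h3 2)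
  · change ContDiff ℝ n (fun p : ℝ × (Fin 6 → ℝ) => p.2 2 / 16)
    fun_prop
  · exact contDiff_const.mul (h3 4)
  · change ContDiff ℝ n (fun p : ℝ × (Fin 6 → ℝ) => p.2 4 / 16)
    fun_prop

theorem hasDerivWithinAt_yDev {s : Fin 3 → ℤˣ} {h z κb Pb κc Pc : ℝ} {d : ℝ → Fin 6 → ℝ}
    {S : Set ℝ} {t : ℝ} (H : HasDerivWithinAt d (devField s h z κb Pb κc Pc t (d t)) S t) :
    HasDerivWithinAt (fun t => yDev h κb Pb κc Pc t (d t))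
      (yField s h z (yDev h κb Pb κc Pc t (d t))) S t := by
  have D := hasDerivWithinAt_pi.1 H
  have I : HasDerivWithinAt (fun t : ℝ => t) 1 S t := hasDerivWithinAt_id t S
  refine hasDerivWithinAt_pi.2 fun j => ?_
  fin_cases j
  · refine ((D 0).div_const 16).congr_deriv ?_
    simp [devField]
  · refine (I.add (D 1)).congr_deriv ?_
    simp [devField]
  · refine (((D 2).div_const 16).const_add (-κb)).congr_deriv ?_
    simp [devField]
  · refine (((I.const_mul κb).const_sub (-Pb - h * Real.log 2)).add (D 3)).congr_deriv ?_
    simp [devField, yField, yDev]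
  · refine (((D 4).div_const 16).const_add (-κc)).congr_deriv ?_
    simp [devField]
  · refine (((I.const_mul κc).const_sub (-Pc - h * Real.log 2)).add (D 5)).congr_deriv ?_
    simp [devField, yField, yDev]

/-! ### Exponential smallness of the forces -/

/-- Smallness of the error parameter `ε` relative to the parameters of the equations. -/
structure IsSmall (ε h z : ℝ) : Prop where
  pos : 0 < ε
  le : ε ≤ 1 / 2 ^ 40
  h_pos : 0 < h
  h_le : h ≤ 1 / 2 ^ 7
  le_h : 2 ^ 40 * ε ≤ h ^ 2
  z_pos : 0 < z
  z_le : z ^ 2 * ε ≤ 1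

namespace IsSmall
variable {ε h z : ℝ} (S : IsSmall ε h z)
include S

theorem le_one : ε ≤ 1 := S.le.trans (by norm_num)

theorem pow_le {m n : ℕ} (hmn : m ≤ n) : ε ^ n ≤ ε ^ m :=
  pow_le_pow_of_le_one S.pos.le S.le_one hmn

theorem pow_succ_le (n : ℕ) : ε ^ (n + 1) ≤ 1 / 2 ^ 40 * ε ^ n := by
  rw [pow_succ, mul_comm]
  exact mul_le_mul_of_nonneg_right S.le (pow_nonneg S.pos.le n)

theorem le_h' : 2 ^ 40 * ε ≤ h := S.le_h.trans (by nlinarith [S.h_pos, S.h_le])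

theorem z_mul_le : z * ε ≤ 1 / 2 ^ 20 := by
  have h1 : (z * ε) ^ 2 ≤ (1 / 2 ^ 20) ^ 2 := by
    calc (z * ε) ^ 2 = (z ^ 2 * ε) * ε := by ring
      _ ≤ 1 * ε := mul_le_mul_of_nonneg_right S.z_le S.pos.le
      _ ≤ _ := by linarith [S.le]
  exact le_of_pow_le_pow_left₀ two_ne_zero (by positivity) h1

/-- Since 2^40 ε ≤ h, an error of order ε in a numerator over h changes an exponential by at most a
factor 2. -/
theorem exp_div_le {x : ℝ} (hx : x ≤ 2 ^ 30 * ε) : Real.exp (x / h) ≤ 2 := by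
  have h1 : x / h ≤ 1 / 2 := by
    rw [div_le_iff₀ S.h_pos]
    linarith [S.le_h', S.pos]
  have h2 : Real.exp (1 / 2) ≤ 2 := by
    have h3 := Real.add_one_le_exp (-(1 / 2) : ℝ)
    rw [Real.exp_neg] at h3
    have h4 := Real.exp_pos (1 / 2)
    have h5 : (1 / 2 : ℝ) ≤ (Real.exp (1 / 2))⁻¹ := by linarith
    rw [le_inv_comm₀ (by norm_num) h4] at h5
    linarith
  exact (Real.exp_le_exp.2 h1).trans h2

end IsSmall

theorem log_two_mul_cosh_le (x : ℝ) : Real.log (2 * Real.cosh x) ≤ |x| + Real.log 2 := by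
  have h1 : 2 * Real.cosh x ≤ 2 * Real.exp |x| := by
    rw [← Real.cosh_abs, Real.cosh_eq]
    have : Real.exp (-|x|) ≤ Real.exp |x| := Real.exp_le_exp.2 (by linarith [abs_nonneg x])
    linarith
  calc _ ≤ Real.log (2 * Real.exp |x|) :=
        Real.log_le_log (by have := Real.cosh_pos x; positivity) h1
    _ = _ := by rw [Real.log_mul (by norm_num) (Real.exp_pos _).ne', Real.log_exp]; ring

theorem le_xiA {h : ℝ} (hh : 0 < h) (y : Fin 6 → ℝ) :
    h * y 0 - |y 1| - h * Real.log 2 ≤ xiA h y := by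
  have h1 := log_two_mul_cosh_le (y 1 / h)
  rw [xiA, mul_sub]
  have h2 := mul_le_mul_of_nonneg_left h1 hh.le
  rw [mul_add, abs_div, abs_of_pos hh, mul_div_cancel₀ _ hh.ne'] at h2
  linarith

theorem abs_exp_sub_one_le {x δ : ℝ} (hx : |x| ≤ δ) (hδ : δ ≤ 1 / 2) :
    |Real.exp x - 1| ≤ 2 * δ := by
  have := Real.abs_exp_sub_one_le (x := x) (by linarith)
  linarith

section
variable {s : Fin 3 → ℤˣ} {ε h z κb Pb κc Pc t : ℝ} {d : Fin 6 → ℝ}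

theorem abs_le_of_norm_le (hd : ‖d‖ ≤ ε ^ 14) (j : Fin 6) : |d j| ≤ ε ^ 14 :=
  (norm_le_pi_norm d j).trans hd

theorem abs_bet_zero_le (S : IsSmall ε h z) (hd : ‖d‖ ≤ ε ^ 14) :
    |bet s h (yDev h κb Pb κc Pc t d) 0| ≤ 2 := by
  rw [abs_bet]
  change 2 * Real.exp (xiA _ _ / h) ≤ 2
  rw [exp_xiA_div _ S.h_pos.ne']
  have h0 : yDev h κb Pb κc Pc t d 0 = d 0 / 16 := rfl
  rw [h0]
  have hd0 := abs_le_of_norm_le hd 0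
  have h1 : ε ^ 14 ≤ 1 / 2 := (S.pow_le (m := 1) (by norm_num)).trans (by linarith [S.le])
  have h2 := abs_exp_sub_one_le (x := d 0 / 16) (δ := 1 / 2)
    (by rw [abs_div]; norm_num; linarith) le_rfl
  have h3 := (abs_le.1 h2).2
  exact (div_le_self (Real.exp_pos _).le (Real.one_le_cosh _)).trans (by linarith)

theorem neg_xiA_le (S : IsSmall ε h z) (hd : ‖d‖ ≤ ε ^ 14) :
    -xiA h (yDev h κb Pb κc Pc t d) ≤ |t| + h * Real.log 2 + 2 * ε ^ 14 := by
  have h1 := le_xiA S.h_pos (yDev h κb Pb κc Pc t d)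
  have h0 : yDev h κb Pb κc Pc t d 0 = d 0 / 16 := rfl
  have h2 : yDev h κb Pb κc Pc t d 1 = t + d 1 := rfl
  rw [h0, h2] at h1
  have h3 := abs_add_le t (d 1)
  have h4 := abs_le_of_norm_le hd 1
  have h5 := (abs_le.1 (abs_le_of_norm_le hd 0)).1
  have h6 : -(ε ^ 14) ≤ h * (d 0 / 16) := by
    have : h ≤ 1 := S.h_le.trans (by norm_num)
    nlinarith [S.h_pos, pow_pos S.pos 14]
  linarith

/-- Here ξ_b = ξ_{b,a} - ξ_a, and -ξ_a exceeds |t| by at most h log 2 plus a multiple of ε^14. The h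
log 2 cancels the one in ξ_{b,a}, and one power of ε absorbs the numerical constants. -/
theorem abs_bet_one_le (S : IsSmall ε h z) (hd : ‖d‖ ≤ ε ^ 14)
    (Hb : Real.exp ((-Pb - κb * t + |t|) / h) ≤ ε ^ 32) :
    |bet s h (yDev h κb Pb κc Pc t d) 1| ≤ ε ^ 31 := by
  have h1 := neg_xiA_le (κb := κb) (Pb := Pb) (κc := κc) (Pc := Pc) (t := t) S hd
  have h2 := (abs_le.1 (abs_le_of_norm_le hd 3)).2
  rw [abs_bet]
  change 2 * Real.exp ((-Pb - h * Real.log 2 - κb * t + d 3 - xiA _ _) / h) ≤ _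
  have h3 : (-Pb - h * Real.log 2 - κb * t + d 3 - xiA h (yDev h κb Pb κc Pc t d)) / h
      ≤ (-Pb - κb * t + |t|) / h + (3 * ε ^ 14) / h := by
    rw [← add_div, div_le_div_iff_of_pos_right S.h_pos]
    linarith
  have h4 : Real.exp (3 * ε ^ 14 / h) ≤ 2 := S.exp_div_le (by
    have := S.pow_le (m := 1) (n := 14) (by norm_num)
    rw [pow_one] at this
    linarith [S.pos])
  calc _ ≤ 2 * (Real.exp ((-Pb - κb * t + |t|) / h) * Real.exp (3 * ε ^ 14 / h)) := by
        rw [← Real.exp_add]; gcongr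
    _ ≤ 2 * (ε ^ 32 * 2) := by gcongr
    _ ≤ ε ^ 31 := by linarith [S.pow_succ_le 31, pow_pos S.pos 31]

theorem abs_bet_two_le (S : IsSmall ε h z) (hd : ‖d‖ ≤ ε ^ 14)
    (Hc : Real.exp ((-Pc - κc * t + |t|) / h) ≤ ε ^ 32) :
    |bet s h (yDev h κb Pb κc Pc t d) 2| ≤ ε ^ 31 := by
  have h1 := neg_xiA_le (κb := κb) (Pb := Pb) (κc := κc) (Pc := Pc) (t := t) S hd
  have h2 := (abs_le.1 (abs_le_of_norm_le hd 5)).2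
  rw [abs_bet]
  change 2 * Real.exp ((-Pc - h * Real.log 2 - κc * t + d 5 - xiA _ _) / h) ≤ _
  have h3 : (-Pc - h * Real.log 2 - κc * t + d 5 - xiA h (yDev h κb Pb κc Pc t d)) / h
      ≤ (-Pc - κc * t + |t|) / h + (3 * ε ^ 14) / h := by
    rw [← add_div, div_le_div_iff_of_pos_right S.h_pos]
    linarith
  have h4 : Real.exp (3 * ε ^ 14 / h) ≤ 2 := S.exp_div_le (by
    have := S.pow_le (m := 1) (n := 14) (by norm_num)
    rw [pow_one] at this
    linarith [S.pos])
  calc _ ≤ 2 * (Real.exp ((-Pc - κc * t + |t|) / h) * Real.exp (3 * ε ^ 14 / h)) := by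
        rw [← Real.exp_add]; gcongr
    _ ≤ 2 * (ε ^ 32 * 2) := by gcongr
    _ ≤ ε ^ 31 := by linarith [S.pow_succ_le 31, pow_pos S.pos 31]

theorem gaSq_nonneg (hz : 0 ≤ z) (y : Fin 6 → ℝ) : 0 ≤ gaSq h z y := by
  unfold gaSq; positivity

/-- γ² is z times the cube root of |β_a β_b β_c|. Two factors ε^31 give more than ε^20 after the
cube root, and one further power of ε pays for z. -/
theorem gaSq_le_of_abs_bet_le (S : IsSmall ε h z) {y : Fin 6 → ℝ} (h0 : |bet s h y 0| ≤ 2)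
    (h1 : |bet s h y 1| ≤ ε ^ 31) (h2 : |bet s h y 2| ≤ ε ^ 31) : gaSq h z y ≤ ε ^ 19 := by
  have e : (Real.exp ((y 3 + y 5 - xiA h y) / h / 3)) ^ 3
      = |bet s h y 0| * |bet s h y 1| * |bet s h y 2| / 8 := by
    rw [abs_bet, abs_bet, abs_bet, ← Real.exp_nat_mul]
    have : ((3 : ℕ) : ℝ) * ((y 3 + y 5 - xiA h y) / h / 3)
        = xiVec h y 0 / h + xiVec h y 1 / h + xiVec h y 2 / h := by
      simp [xiVec]; ring
    rw [this, Real.exp_add, Real.exp_add]; ring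
  have h3 : (Real.exp ((y 3 + y 5 - xiA h y) / h / 3)) ^ 3 ≤ (ε ^ 20) ^ 3 := by
    rw [e]
    have : |bet s h y 0| * |bet s h y 1| * |bet s h y 2| ≤ 2 * ε ^ 31 * ε ^ 31 := by
      have := pow_pos S.pos 31
      gcongr
    have h5 : ε ^ 62 ≤ ε ^ 60 := S.pow_le (by norm_num)
    calc _ ≤ 2 * ε ^ 31 * ε ^ 31 / 8 := by linarith
      _ = ε ^ 62 / 4 := by ring
      _ ≤ ε ^ 60 := by linarith [pow_pos S.pos 60]
      _ = _ := by ring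
  have h4 := le_of_pow_le_pow_left₀ (by norm_num) (by have := S.pos; positivity) h3
  have hz := S.z_pos
  calc gaSq h z y ≤ 2 * z * ε ^ 20 := by unfold gaSq; gcongr
    _ = 2 * (z * ε) * ε ^ 19 := by ring
    _ ≤ 1 * ε ^ 19 := by
      have := S.z_mul_le
      have := pow_pos S.pos 19
      gcongr
      linarith
    _ = _ := one_mul _

/-- No force contains β_a² alone. This is the reason for using the sums α_{b,a} and α_{c,a}, in
whose derivatives β_a² cancels. -/
theorem force_le_of_abs_bet_le (S : IsSmall ε h z) {y : Fin 6 → ℝ} (h0 : |bet s h y 0| ≤ 2)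
    (h1 : |bet s h y 1| ≤ ε ^ 31) (h2 : |bet s h y 2| ≤ ε ^ 31) :
    |forceE s h z y| ≤ ε ^ 18 ∧ |forceU s h z y| ≤ ε ^ 18 ∧ |forceV s h z y| ≤ ε ^ 18 := by
  have g1 := gaSq_le_of_abs_bet_le S h0 h1 h2
  have g0 := gaSq_nonneg (h := h) S.z_pos.le y
  have p1 := S.pow_succ_le 18
  have p2 : ε ^ 31 ≤ ε ^ 19 := S.pow_le (by norm_num)
  have p3 := pow_pos S.pos 18
  have p4 : ε ^ 31 ≤ 1 := pow_le_one₀ S.pos.le S.le_one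
  have p5 := pow_pos S.pos 31
  have b12 : |bet s h y 1 - bet s h y 2| ≤ 2 * ε ^ 31 := (abs_sub _ _).trans (by linarith)
  have bU : |bet s h y 2 - bet s h y 1 - bet s h y 0| ≤ 4 :=
    (abs_sub _ _).trans (by linarith [abs_sub (bet s h y 2) (bet s h y 1)])
  have bV : |bet s h y 1 - bet s h y 2 - bet s h y 0| ≤ 4 :=
    (abs_sub _ _).trans (by linarith)
  refine ⟨?_, ?_, ?_⟩
  · rw [forceE, abs_of_nonneg (by positivity), ← sq_abs]
    have : |bet s h y 1 - bet s h y 2| ^ 2 ≤ (2 * ε ^ 31) ^ 2 := by gcongr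
    nlinarith
  · have : |2 * bet s h y 2 * (bet s h y 2 - bet s h y 1 - bet s h y 0)| ≤ 2 * ε ^ 31 * 4 := by
      rw [abs_mul, abs_mul, abs_two]; gcongr
    refine (abs_add_le _ _).trans ?_
    rw [abs_of_nonneg (by positivity : 0 ≤ 4 / 3 * gaSq h z y)]
    linarith
  · have : |2 * bet s h y 1 * (bet s h y 1 - bet s h y 2 - bet s h y 0)| ≤ 2 * ε ^ 31 * 4 := by
      rw [abs_mul, abs_mul, abs_two]; gcongr
    refine (abs_add_le _ _).trans ?_
    rw [abs_of_nonneg (by positivity : 0 ≤ 4 / 3 * gaSq h z y)]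
    linarith

/-- A speed of one sixth of the radius, over a time of at most 3, lets the deviation move by half
the radius. -/
theorem norm_devField_le (S : IsSmall ε h z) (hd : ‖d‖ ≤ ε ^ 14)
    (Hb : Real.exp ((-Pb - κb * t + |t|) / h) ≤ ε ^ 32)
    (Hc : Real.exp ((-Pc - κc * t + |t|) / h) ≤ ε ^ 32) :
    ‖devField s h z κb Pb κc Pc t d‖ ≤ ε ^ 14 / 6 := by
  obtain ⟨fE, fU, fV⟩ := force_le_of_abs_bet_le (s := s) S (abs_bet_zero_le S hd)
    (abs_bet_one_le S hd Hb) (abs_bet_two_le S hd Hc)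
  have hp := pow_pos S.pos 14
  -- The surplus powers of ε pay for the factor 1/h in front of the forces.
  have p18 : ε ^ 18 ≤ h * (ε ^ 14 / 2 ^ 20) := by
    have h1 : ε ^ 18 ≤ ε ^ 15 := S.pow_le (by norm_num)
    have h2 := S.le_h'
    have h3 : ε ≤ h / 2 ^ 20 := by rw [le_div_iff₀ (by norm_num)]; linarith [S.pos]
    calc _ ≤ ε * ε ^ 14 := by rw [← pow_succ']; exact h1
      _ ≤ h / 2 ^ 20 * ε ^ 14 := by gcongr
      _ = _ := by ring
  have q18 : ε ^ 18 ≤ ε ^ 14 / 2 ^ 20 := p18.trans (by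
    have : h ≤ 1 := S.h_le.trans (by norm_num)
    exact mul_le_of_le_one_left (by positivity) this)
  have hdiv : ∀ x, |x| ≤ 2 * ε ^ 18 → |16 * (x / h)| ≤ ε ^ 14 / 6 := by
    intro x hx
    rw [abs_mul, abs_div, abs_of_pos S.h_pos, abs_of_pos (by norm_num : (0 : ℝ) < 16)]
    have : |x| / h ≤ 2 * (ε ^ 14 / 2 ^ 20) := by
      rw [div_le_iff₀ S.h_pos]; linarith
    linarith
  have hd0 := abs_le_of_norm_le hd 0
  have y0 : yDev h κb Pb κc Pc t d 0 = d 0 / 16 := rfl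
  have small : ε ^ 14 ≤ 1 / 2 := (S.pow_le (m := 1) (by norm_num)).trans (by linarith [S.le])
  have e1 := abs_exp_sub_one_le (x := d 0 / 16) (δ := ε ^ 14 / 16)
    (by rw [abs_div]; norm_num; linarith) (by linarith)
  have e2 := abs_exp_sub_one_le (x := -(d 0 / 16)) (δ := ε ^ 14 / 16)
    (by rw [abs_neg, abs_div]; norm_num; linarith) (by linarith)
  have e3 : |Real.exp (-(d 0 / 16))| ≤ 2 := by
    rw [abs_of_pos (Real.exp_pos _)]; linarith [(abs_le.1 e2).2]
  have hE : |forceE s h z (yDev h κb Pb κc Pc t d) * Real.exp (-(d 0 / 16))| ≤ 2 * ε ^ 18 := by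
    rw [abs_mul, mul_comm 2]; gcongr
  refine (pi_norm_le_iff_of_nonneg (by positivity)).2 fun j => ?_
  rw [Real.norm_eq_abs]
  fin_cases j
  · change |16 * (-(_ * _ * Real.exp (-(d 0 / 16))) / h)| ≤ _
    refine hdiv _ ?_
    rw [abs_neg, mul_assoc, abs_mul]
    calc _ ≤ 1 * (2 * ε ^ 18) := by
          gcongr
          exact (Real.abs_tanh_lt_one _).le
      _ = _ := one_mul _
  · change |Real.exp (d 0 / 16) - _ * Real.exp (-(d 0 / 16)) - 1| ≤ _
    rw [sub_right_comm]
    refine (abs_sub _ _).trans ?_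
    linarith
  · exact hdiv _ (by linarith [pow_pos S.pos 18])
  · change |d 2 / 16| ≤ _
    rw [abs_div]; norm_num; linarith [abs_le_of_norm_le hd 2]
  · exact hdiv _ (by linarith [pow_pos S.pos 18])
  · change |d 4 / 16| ≤ _
    rw [abs_div]; norm_num; linarith [abs_le_of_norm_le hd 4]

end

/-- Existence of a solution near the free bounce, with controlled deviation. -/
theorem exists_dev {s : Fin 3 → ℤˣ} {ε h z κb Pb κc Pc t₀ t₁ : ℝ} (S : IsSmall ε h z)
    (h01 : t₀ ≤ t₁) (hT : t₁ - t₀ ≤ 3)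
    (Hb : ∀ t ∈ Icc t₀ t₁, Real.exp ((-Pb - κb * t + |t|) / h) ≤ ε ^ 32)
    (Hc : ∀ t ∈ Icc t₀ t₁, Real.exp ((-Pc - κc * t + |t|) / h) ≤ ε ^ 32)
    {d₁ : Fin 6 → ℝ} (hd₁ : ‖d₁‖ ≤ ε ^ 14 / 4) :
    ∃ d : ℝ → Fin 6 → ℝ, d t₁ = d₁ ∧ ∀ t ∈ Icc t₀ t₁,
      HasDerivWithinAt d (devField s h z κb Pb κc Pc t (d t)) (Icc t₀ t₁) t ∧
      ‖d t‖ ≤ ε ^ 14 := by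
  have hp := pow_pos S.pos 14
  refine exists_solution_mem_closedBall (r := ε ^ 14 / 4) (L := ε ^ 14 / 6) contDiff_devField h01
    hp.le (by positivity) (by positivity)
    (fun t ht x hx => norm_devField_le S hx (Hb t ht) (Hc t ht)) ?_ hd₁
  -- Initial quarter plus drift of one half stays inside the ball.
  calc _ ≤ ε ^ 14 / 6 * 3 := by gcongr
    _ ≤ _ := by linarith

/-! ### Consequences of K(f) < 1, uniformly in the two cases q ≤ 1 and q > 1 -/

/-- The exponentially small factor of the error bound. -/
noncomputable def eps (f : Param) : ℝ := Real.exp (-(1 / hp f) * (1 / 2 ^ 7) * tauStar f)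

/-- Minus the value of `α_{a',a}` before the bounce. -/
noncomputable def kap (f : Param) : ℝ := if qp f ≤ 1 then 1 + wp f else (1 + wp f)⁻¹

/-- The constant term of `-ξ_{a',a}`. -/
noncomputable def pA (f : Param) : ℝ := if qp f ≤ 1 then (1 + wp f) * qp f else 1

/-- The constant term of `-ξ_{c',a}`. -/
noncomputable def pC (f : Param) : ℝ := if qp f ≤ 1 then 1 else (1 + wp f) * qp f

/-- The quantitative hypotheses on which the analysis of one bounce rests. -/
structure IsTransfer (ε h z κ P P' T : ℝ) : Prop extends IsSmall ε h z where
  κ_pos : 0 < κ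
  P_mul_le : P * ε ≤ 1
  P'_mul_le : P' * ε ≤ 1
  P'_pos : 0 < P'
  T_pos : 0 < T
  T_le_one : T ≤ 1
  h_lt : 2 ^ 7 * h < T
  -- Of this bound and the next, one is an equality in each case: κ²T = P if q ≤ 1, and T = P if q >
  -- 1.
  T_le : T ≤ P
  κT_le : κ ^ 2 * T ≤ P
  -- This is the case distinction itself (q ≤ 1 or 1 ≤ q): going back in time, β_{a'} rather than
  -- β_{c'} meets β_a.
  P_le : P ≤ κ * P'
  κ_mul_le : 2 ^ 30 * (κ * ε) ≤ h
  le_κ_mul : 2 ^ 30 * ε ≤ h * κ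
  eps_eq : ε = Real.exp (-(T / (2 ^ 7 * h)))

theorem log_two_le_one : Real.log 2 ≤ 1 := by linarith [Real.log_two_lt_d9]

theorem tauStar_pos {f : Param} (hw : 0 < wp f) (hq : 0 < qp f) : 0 < tauStar f := by
  unfold tauStar; split_ifs <;> positivity

theorem tauStar_le_one {f : Param} (hw : 0 < wp f) : tauStar f ≤ 1 := by
  unfold tauStar; split_ifs
  · rw [div_le_one (by linarith)]; linarith
  · exact le_rfl

/-- The basic consequence of `K(f) < 1`. -/
theorem eps_mul_lt {f : Param} (hf : f ∈ paramSet) :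
    2 ^ 40 * eps f * (max ((1 / wp f) ^ 2) (wp f ^ 3) * max ((1 / qp f) ^ 2) (qp f)
      * max 1 (zp f) ^ 2) < hp f ^ 2 := by
  obtain ⟨hh, hw, hq, hz, hq1, hK, hT⟩ := hf
  have : errK f = 2 ^ 40 * eps f * (max ((1 / wp f) ^ 2) (wp f ^ 3)
      * max ((1 / qp f) ^ 2) (qp f) * max 1 (zp f) ^ 2) / hp f ^ 2 := by
    rw [errK, eps]; field_simp
  rw [this, div_lt_one (by positivity)] at hK
  exact hK

theorem one_le_max_w {w : ℝ} (hw : 0 < w) : 1 ≤ max ((1 / w) ^ 2) (w ^ 3) := by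
  rcases le_total w 1 with h | h
  · exact le_max_of_le_left (one_le_pow₀ ((one_le_div hw).2 h))
  · exact le_max_of_le_right (one_le_pow₀ h)

theorem one_le_max_q {q : ℝ} (hq : 0 < q) : 1 ≤ max ((1 / q) ^ 2) q := by
  rcases le_total q 1 with h | h
  · exact le_max_of_le_left (one_le_pow₀ ((one_le_div hq).2 h))
  · exact le_max_of_le_right h

theorem eps_pos (f : Param) : 0 < eps f := Real.exp_pos _

/-- Consequences of `K(f) < 1` in terms of `w` and `q` only. -/
theorem eps_bounds {f : Param} (hf : f ∈ paramSet) :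
    2 ^ 40 * eps f ≤ hp f ^ 2 ∧ 2 ^ 39 * (eps f * (1 + wp f)) ≤ hp f ^ 2 ∧
    2 ^ 39 * (eps f * ((1 + wp f) * qp f)) ≤ hp f ^ 2 ∧ 2 ^ 40 * eps f ≤ wp f ^ 2 ∧
    zp f ^ 2 * eps f ≤ 1 ∧ hp f < 1 / 2 ^ 7 := by
  have M := (eps_mul_lt hf).le
  obtain ⟨hh, hw, hq, hz, hq1, hK, hT⟩ := hf
  have he := eps_pos f
  set W := max ((1 / wp f) ^ 2) (wp f ^ 3) with hW
  set Q := max ((1 / qp f) ^ 2) (qp f) with hQ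
  set Z := max 1 (zp f) ^ 2 with hZ
  have W1 : 1 ≤ W := one_le_max_w hw
  have Q1 : 1 ≤ Q := one_le_max_q hq
  have Z1 : 1 ≤ Z := one_le_pow₀ (le_max_left _ _)
  have hh1 : hp f < 1 / 2 ^ 7 := hT.trans_le (by
    have := tauStar_le_one hw; linarith)
  have hh2 : hp f ^ 2 ≤ 1 := by nlinarith
  have key : ∀ x, x ≤ W * Q * Z → 2 ^ 40 * eps f * x ≤ hp f ^ 2 := fun x hx =>
    (mul_le_mul_of_nonneg_left hx (by positivity)).trans M
  have WQ : W * Q ≤ W * Q * Z := le_mul_of_one_le_right (by positivity) Z1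
  have WW : W ≤ W * Q := le_mul_of_one_le_right (by positivity) Q1
  have hwW : 1 + wp f ≤ 2 * W := by
    rcases le_total (wp f) 1 with h | h
    · linarith
    · have h1 : wp f ≤ wp f ^ 3 := le_self_pow₀ h (by norm_num)
      have h2 : wp f ^ 3 ≤ W := le_max_right _ _
      linarith
  refine ⟨?_, ?_, ?_, ?_, ?_, hh1⟩
  · simpa using key 1 (by linarith)
  · have := key ((1 + wp f) / 2) (by linarith)
    linarith
  · have h1 : qp f ≤ Q := le_max_right _ _
    have h2 : (1 + wp f) * qp f ≤ 2 * W * Q := by gcongr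
    have := key ((1 + wp f) * qp f / 2) (by linarith)
    linarith
  · have h1 := key ((1 / wp f) ^ 2) ((le_max_left _ _).trans (WW.trans WQ))
    have h2 : 2 ^ 40 * eps f * (1 / wp f) ^ 2 ≤ 1 := h1.trans hh2
    rw [one_div, inv_pow, ← div_eq_mul_inv, div_le_one (by positivity)] at h2
    exact h2
  · have h1 : zp f ^ 2 ≤ Z := pow_le_pow_left₀ hz.le (le_max_right _ _) 2
    have h2 := key (zp f ^ 2) (h1.trans (le_mul_of_one_le_left (by positivity)
      (W1.trans WW)))
    nlinarith [mul_pos he (pow_pos hz 2)]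

/-- All factors of K besides 2^40 ε are at least 1, so every error estimate may be reduced to a
multiple of ε. -/
theorem eps_le_errK {f : Param} (hf : f ∈ paramSet) : 2 ^ 40 * eps f ≤ errK f := by
  have hh1 := (eps_bounds hf).2.2.2.2.2
  obtain ⟨hh, hw, hq, hz, hq1, hK, hT⟩ := hf
  have he := eps_pos f
  have W1 := one_le_max_w hw
  have Q1 := one_le_max_q hq
  have Z1 : 1 ≤ max 1 (zp f) ^ 2 := one_le_pow₀ (le_max_left _ _)
  have H1 : 1 ≤ (1 / hp f) ^ 2 := one_le_pow₀ ((one_le_div hh).2 (by linarith))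
  have e : errK f = 2 ^ 40 * eps f * ((1 / hp f) ^ 2 * max ((1 / wp f) ^ 2) (wp f ^ 3)
      * max ((1 / qp f) ^ 2) (qp f) * max 1 (zp f) ^ 2) := by rw [errK, eps]; ring
  rw [e]
  refine le_mul_of_one_le_right (by positivity) ?_
  exact one_le_mul_of_one_le_of_one_le (one_le_mul_of_one_le_of_one_le
    (one_le_mul_of_one_le_of_one_le H1 W1) Q1) Z1

/-- The inequalities recorded in `IsTransfer` hold for both values of (κ, P, P', T), which lets most
later estimates avoid the case distinction. -/
theorem isTransfer {f : Param} (hf : f ∈ paramSet) :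
    IsTransfer (eps f) (hp f) (zp f) (kap f) (pA f) (pC f) (tauStar f) := by
  obtain ⟨b1, b2, b3, b4, b5, b6⟩ := eps_bounds hf
  obtain ⟨hh, hw, hq, hz, hq1, hK, hT⟩ := hf
  have he := eps_pos f
  have hT0 := tauStar_pos hw hq
  have hT1 := tauStar_le_one hw
  have hh2 : hp f ^ 2 ≤ hp f := by nlinarith
  have hwe : 2 ^ 30 * (eps f * (1 + wp f)) ≤ hp f := by
    have : 0 < eps f * (1 + wp f) := by positivity
    linarith
  have hqe : (1 + wp f) * qp f * eps f ≤ 1 := by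
    have : 0 < eps f * ((1 + wp f) * qp f) := by positivity
    linarith
  have he1 : 2 ^ 40 * eps f ≤ 1 := by linarith
  have hee : eps f = Real.exp (-(tauStar f / (2 ^ 7 * hp f))) := by
    rw [eps]; congr 1; field_simp
  have common : IsSmall (eps f) (hp f) (zp f) :=
    ⟨he, by linarith, hh, b6.le, b1, hz, b5⟩
  rcases le_or_gt (qp f) 1 with h | h
  · have e1 : kap f = 1 + wp f := if_pos h
    have e2 : pA f = (1 + wp f) * qp f := if_pos h
    have e3 : pC f = 1 := if_pos h
    have e4 : tauStar f = qp f / (1 + wp f) := if_pos h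
    refine ⟨common, ?_, ?_, ?_, ?_, hT0, hT1, by linarith, ?_, ?_, ?_, ?_, ?_, hee⟩
    · rw [e1]; linarith
    · rw [e2]; exact hqe
    · rw [e3]; linarith
    · rw [e3]; norm_num
    · rw [e4, e2, div_le_iff₀ (by linarith)]
      nlinarith [mul_pos hw hq]
    · rw [e4, e2, e1]
      apply le_of_eq; field_simp
    · rw [e1, e2, e3]; nlinarith
    · rw [e1]; linarith
    · rw [e1]; nlinarith
  · have e1 : kap f = (1 + wp f)⁻¹ := if_neg (not_le.2 h)
    have e2 : pA f = 1 := if_neg (not_le.2 h)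
    have e3 : pC f = (1 + wp f) * qp f := if_neg (not_le.2 h)
    have e4 : tauStar f = 1 := if_neg (not_le.2 h)
    have hw1 : (1 + wp f)⁻¹ ≤ 1 := inv_le_one_of_one_le₀ (by linarith)
    have hw0 : 0 < (1 + wp f)⁻¹ := by positivity
    refine ⟨common, ?_, ?_, ?_, ?_, hT0, hT1, by linarith, ?_, ?_, ?_, ?_, ?_, hee⟩
    · rw [e1]; exact hw0
    · rw [e2]; linarith
    · rw [e3]; exact hqe
    · rw [e3]; positivity
    · rw [e4, e2]
    · rw [e4, e2, e1]; nlinarith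
    · rw [e1, e2, e3]; field_simp; exact h.le
    · rw [e1]; nlinarith
    · rw [e1, ← div_eq_mul_inv, le_div_iff₀ (by linarith)]; linarith

namespace IsTransfer
variable {ε h z κ P P' T : ℝ} (S : IsTransfer ε h z κ P P' T)
include S

theorem P_pos : 0 < P := S.T_pos.trans_le S.T_le

theorem h_log_two_le : h * Real.log 2 ≤ T / 2 ^ 7 := by
  have := S.h_lt
  have := S.h_pos
  have := log_two_le_one
  nlinarith

theorem h_log_two_nonneg : 0 ≤ h * Real.log 2 :=
  mul_nonneg S.h_pos.le (Real.log_nonneg (by norm_num))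

/-- From 2κ ≤ 1 + κ² and the bounds T ≤ P, κ²T ≤ P one gets κT ≤ P, hence (2 + κ)T ≤ 3P. -/
theorem T_le_div : T / 3 ≤ P / (2 + κ) := by
  have h0 := S.κ_pos
  rw [div_le_div_iff₀ (by norm_num) (by linarith)]
  nlinarith [S.T_le, S.κT_le, S.T_pos, mul_nonneg S.T_pos.le (sq_nonneg (κ - 1))]

theorem κT_le_div : κ * T / 3 ≤ P / (2 + κ) := by
  have h0 := S.κ_pos
  rw [div_le_div_iff₀ (by norm_num) (by linarith)]
  nlinarith [S.T_le, S.κT_le, S.T_pos, mul_nonneg S.T_pos.le (sq_nonneg (κ - 1))]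

theorem small_le : h * Real.log 2 + (κ + 1) * ε ≤ T / 12 := by
  have h1 := S.h_log_two_le
  have h2 := S.κ_mul_le
  have h3 := S.le_h'
  have h4 := S.h_lt
  have h5 := S.pos
  have h6 := S.T_pos
  have h7 : 0 < κ * ε := mul_pos S.κ_pos S.pos
  linarith

/-- Exponents of `β_{a'}` and `β_{c'}` before the bounce. -/
theorem exponents {t : ℝ} (ht : -t ≤ (P + h * Real.log 2) / (2 + κ) + ε) :
    -P - κ * t - t ≤ -(T / 4) ∧ -P' - κ⁻¹ * t - t ≤ -(T / 4) := by
  have hκ := S.κ_pos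
  have h1 := S.T_le_div
  have h2 := S.κT_le_div
  have h3 := S.small_le
  -- At t = -P / (2 + κ) the exponent of β_{a'} is -P / (2 + κ), at most -T/3. The corrections cost
  -- at most T/12, which leaves -T/4.
  have h4 : (κ + 1) * (-t) ≤ P - P / (2 + κ) + (h * Real.log 2 + (κ + 1) * ε) := by
    have h5 := mul_le_mul_of_nonneg_left ht (by linarith : 0 ≤ κ + 1)
    have h6 : (κ + 1) * ((P + h * Real.log 2) / (2 + κ) + ε)
        = P - P / (2 + κ) + ((κ + 1) / (2 + κ) * (h * Real.log 2) + (κ + 1) * ε) := by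
      field_simp; ring
    have h7 : (κ + 1) / (2 + κ) * (h * Real.log 2) ≤ 1 * (h * Real.log 2) :=
      mul_le_mul_of_nonneg_right ((div_le_one (by linarith)).2 (by linarith)) S.h_log_two_nonneg
    linarith
  constructor
  · linarith
  · have h8 : κ⁻¹ * P ≤ P' := by
      rw [inv_mul_le_iff₀ hκ]; exact S.P_le
    -- With D = P / (2 + κ), three quarters of D ≥ κT/3 give the gain κT/4, and a quarter of D ≥ T/3
    -- covers the corrections T/12.
    have h9 : κ⁻¹ * ((κ + 1) * (-t)) ≤ κ⁻¹ * (P - κ * T / 4) := by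
      refine mul_le_mul_of_nonneg_left ?_ (inv_pos.2 hκ).le
      linarith
    have e1 : κ⁻¹ * ((κ + 1) * (-t)) = -κ⁻¹ * t - t := by field_simp; ring
    have e2 : κ⁻¹ * (P - κ * T / 4) = κ⁻¹ * P - T / 4 := by field_simp
    linarith

/-- Converts exponents into powers of ε: each T / 2^7 is one power, so an exponent -T/4 yields ε^32.
-/
theorem exp_le_pow {x : ℝ} (n : ℕ) (hx : x ≤ -(n * T / 2 ^ 7)) : Real.exp (x / h) ≤ ε ^ n := by
  rw [S.eps_eq, ← Real.exp_nat_mul, Real.exp_le_exp, div_le_iff₀ S.h_pos]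
  have := S.h_pos
  have e : (n : ℝ) * -(T / (2 ^ 7 * h)) * h = -(n * T / 2 ^ 7) := by field_simp
  rw [e]; exact hx

end IsTransfer

/-! ### Reference times and exponents on the whole time interval -/

/-- The right-hand side solves τ = -P - h log 2 - (1 + κ)τ, the equation ξ_a = ξ_{a'} for the
approximate motion before the bounce. -/
theorem tauOneMinus_eq {f : Param} (hw : 0 < wp f) :
    tauOneMinus f = -((pA f + hp f * Real.log 2) / (2 + kap f)) := by
  unfold tauOneMinus pA kap
  split_ifs <;> field_simp <;> ring

theorem tauMinus_eq {f : Param} (hw : 0 < wp f) :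
    tauMinus f = -(pA f / (1 + kap f)) := by
  unfold tauMinus pA kap
  split_ifs with h
  · rw [min_eq_right h]; field_simp; ring
  · rw [min_eq_left (not_le.1 h).le]; field_simp; ring

theorem lambdaL_eq {f : Param} (hw : 0 < wp f) : lambdaL f = 1 + kap f := by
  unfold lambdaL kap
  split_ifs <;> field_simp <;> ring

/-- A time slightly before the crossing time. -/
noncomputable def tLo (f : Param) : ℝ := tauOneMinus f - eps f

theorem half_le_tauOnePlus {f : Param} (hh : 0 < hp f) (hw : 0 < wp f) :
    1 / 2 ≤ tauOnePlus f := by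
  have h0 : 0 ≤ hp f * Real.log 2 := mul_nonneg hh.le (Real.log_nonneg (by norm_num))
  have h1 : 1 / 2 ≤ (1 + wp f) / (1 + 2 * wp f) := by
    rw [div_le_div_iff₀ (by norm_num) (by linarith)]; linarith
  unfold tauOnePlus
  nlinarith

theorem tauOnePlus_le {f : Param} (hf : f ∈ paramSet) : tauOnePlus f ≤ 3 / 2 := by
  have h0 := (isTransfer hf).h_log_two_le
  have h2 := (isTransfer hf).T_le_one
  have h3 := (isTransfer hf).h_log_two_nonneg
  have hw := hf.2.1
  have h1 : (1 + wp f) / (1 + 2 * wp f) ≤ 1 := by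
    rw [div_le_one (by linarith)]; linarith
  have h4 : 0 < (1 + wp f) / (1 + 2 * wp f) := by positivity
  unfold tauOnePlus
  nlinarith

theorem tauOneMinus_neg {f : Param} (hf : f ∈ paramSet) : tauOneMinus f ≤ -(tauStar f / 3) := by
  have S := isTransfer hf
  rw [tauOneMinus_eq hf.2.1, add_div]
  have := S.T_le_div
  have h1 : 0 ≤ hp f * Real.log 2 / (2 + kap f) :=
    div_nonneg S.h_log_two_nonneg (by linarith [S.κ_pos])
  linarith

/-- P / (1 + κ) and P / (2 + κ) differ by P / ((1 + κ)(2 + κ)), which outweighs the corrections h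
log 2 / (2 + κ) and ε. -/
theorem tauMinus_lt_tLo {f : Param} (hf : f ∈ paramSet) : tauMinus f < tLo f := by
  have S := isTransfer hf
  have h0 := S.κ_pos
  rw [tauMinus_eq hf.2.1, tLo, tauOneMinus_eq hf.2.1]
  have h1 : pA f / (1 + kap f) = pA f / (2 + kap f) + pA f / (2 + kap f) / (1 + kap f) := by
    field_simp; ring
  have h2 : (hp f * Real.log 2 + (2 + kap f) * eps f) / (2 + kap f)
      < pA f / (2 + kap f) / (1 + kap f) := by
    rw [div_div, div_lt_div_iff₀ (by positivity) (by positivity)]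
    have h3 := S.T_le
    have h4 := S.κT_le
    have h5 := S.h_log_two_le
    have h6 : (hp f * Real.log 2 + (2 + kap f) * eps f) * (1 + kap f) < pA f := by
      have h7 := S.κ_mul_le
      have h8 := S.le_h'
      have h9 := S.h_lt
      have h10 := S.T_pos
      have h11 : (2 + kap f) * eps f ≤ tauStar f / 2 ^ 7 := by
        have := mul_pos h0 S.pos
        linarith [S.pos]
      have h12 : kap f * tauStar f ≤ pA f := by
        nlinarith [mul_nonneg h10.le (sq_nonneg (kap f - 1))]
      calc _ ≤ (tauStar f / 2 ^ 7 + tauStar f / 2 ^ 7) * (1 + kap f) := by gcongr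
        _ < pA f := by linarith
    calc _ = (hp f * Real.log 2 + (2 + kap f) * eps f) * (1 + kap f) * (2 + kap f) := by ring
      _ < pA f * (2 + kap f) := by gcongr
  have h3 : (pA f + hp f * Real.log 2) / (2 + kap f) + eps f
      = pA f / (2 + kap f) + (hp f * Real.log 2 + (2 + kap f) * eps f) / (2 + kap f) := by
    field_simp; ring
  linarith

theorem neg_one_le_tauMinus {f : Param} (hf : f ∈ paramSet) : -1 ≤ tauMinus f := by
  obtain ⟨-, hw, hq, -⟩ := hf
  unfold tauMinus
  have h1 : min 1 (qp f) ≤ 1 := min_le_left _ _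
  have h2 : 0 < min 1 (qp f) := lt_min one_pos hq
  have h3 : 0 < 1 / (2 + wp f) := by positivity
  have h4 : 1 / (2 + wp f) ≤ 1 := by rw [div_le_one (by linarith)]; linarith
  nlinarith

/-- Exponents of `β_b` and `β_c` on the whole time interval. -/
theorem exponents_le {f : Param} (hf : f ∈ paramSet) {t : ℝ}
    (ht : t ∈ Icc (tLo f) (tauOnePlus f)) :
    -1 - (1 + wp f)⁻¹ * t + |t| ≤ -(tauStar f / 4) ∧
    -((1 + wp f) * qp f) - (1 + wp f) * t + |t| ≤ -(tauStar f / 4) := by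
  have S := isTransfer hf
  have hw := hf.2.1
  have hq := hf.2.2.1
  -- For negative times β_{a'} is largest at the crossing, which `exponents` covers. For positive
  -- times β_b grows: its exponent reaches -1 + (1 + h log 2) w / (1 + 2w) at τ_{1+}, close to -1/2
  -- at worst.
  rcases le_total t 0 with h | h
  · rw [abs_of_nonpos h]
    have ht' : -t ≤ (pA f + hp f * Real.log 2) / (2 + kap f) + eps f := by
      have := ht.1
      rw [tLo, tauOneMinus_eq hw] at this
      linarith
    have E := S.exponents ht'
    unfold pA pC kap at E
    split_ifs at E with hq1
    · exact ⟨by linarith [E.2], by linarith [E.1]⟩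
    · rw [inv_inv] at E
      exact ⟨by linarith [E.1], by linarith [E.2]⟩
  · rw [abs_of_nonneg h]
    have hT := S.T_le_one
    have h2 := S.h_log_two_le
    constructor
    · have h1 := ht.2
      have e : -1 - (1 + wp f)⁻¹ * t + t = -1 + wp f / (1 + wp f) * t := by field_simp; ring
      have h3 : wp f / (1 + wp f) * t ≤ wp f / (1 + wp f) * tauOnePlus f := by gcongr
      have e2 : wp f / (1 + wp f) * tauOnePlus f
          = (1 + hp f * Real.log 2) * (wp f / (1 + 2 * wp f)) := by
        unfold tauOnePlus; field_simp
      have h4 : wp f / (1 + 2 * wp f) ≤ 1 / 2 := by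
        rw [div_le_div_iff₀ (by linarith) (by norm_num)]; linarith
      have h5 : 0 ≤ wp f / (1 + 2 * wp f) := by positivity
      have h6 := S.h_log_two_nonneg
      rw [e]
      nlinarith
    · have h3 : tauStar f ≤ (1 + wp f) * qp f := by
        unfold tauStar
        split_ifs with hq1
        · rw [div_le_iff₀ (by linarith)]; nlinarith [mul_pos hw hq]
        · nlinarith [not_le.1 hq1]
      have := S.T_pos
      nlinarith [mul_nonneg hw.le h]

/-! ### The exact solution through the state vector -/

/-- The state at time `t` whose deviation from the reference field is `d`. -/
noncomputable def devState (π : Equiv.Perm (Fin 3)) (σ : Fin 3 → ℤˣ) (f : Param) (t : ℝ)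
    (d : Fin 6 → ℝ) : State :=
  stateOf π σ (hp f) (zp f) (yDev (hp f) (1 + wp f)⁻¹ 1 (1 + wp f) ((1 + wp f) * qp f) t d)

theorem refField_eq (π : Equiv.Perm (Fin 3)) (σ : Fin 3 → ℤˣ) (f : Param) (t : ℝ) :
    refField π f σ t = devState π σ f t 0 := by
  have e1 : ∀ h κb Pb κc Pc : ℝ, alA h (yDev h κb Pb κc Pc t 0) = -Real.tanh (t / h) := by
    intro h _ _ _ _; simp [alA, yDev]
  have e2 : ∀ h κb Pb κc Pc : ℝ, xiA h (yDev h κb Pb κc Pc t 0)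
      = -h * Real.log (2 * Real.cosh (t / h)) := by
    intro h _ _ _ _; simp [xiA, yDev]
  unfold refField devState stateOf alVec xiVec
  have e3 : -(1 + wp f) * qp f = -((1 + wp f) * qp f) := neg_mul _ _
  simp only [e1, e2, e3]
  simp [yDev]

/-- The deviation of `Φ_*` from the reference field at time `τ_{1+}`. -/
noncomputable def devInit (π : Equiv.Perm (Fin 3)) (σ : Fin 3 → ℤˣ) (f : Param) : Fin 6 → ℝ :=
  -- With α_a = -1 and |β_a| = b = 2 exp(-τ_{1+} / h) one has A_a = √(1 + b²) and φ_a =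
  -- arcsinh(1/b). The sums α_{b,a}, ξ_{b,a}, ξ_{c,a} agree with the reference field exactly; α_c is
  -- off by what the constraint dictates.
  ![16 * Real.log √(1 + (2 * Real.exp (-tauOnePlus f / hp f)) ^ 2),
    hp f * Real.arsinh (2 * Real.exp (-tauOnePlus f / hp f))⁻¹ - tauOnePlus f, 0, 0,
    16 * (al (stateVec π f σ) (π 2) + wp f), 0]

/-- τ_{1+} solves -1 - h log 2 - τ / (1 + w) = -2τ, so the reference value of ξ_{b,a} and ξ_a =
-τ_{1+} give ξ_b = ξ_a. -/
theorem devState_devInit (π : Equiv.Perm (Fin 3)) (σ : Fin 3 → ℤˣ) {f : Param}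
    (hh : 0 < hp f) (hw : 0 < wp f) :
    devState π σ f (tauOnePlus f) (devInit π σ f) = stateVec π f σ := by
  set y := yDev (hp f) (1 + wp f)⁻¹ 1 (1 + wp f) ((1 + wp f) * qp f) (tauOnePlus f)
    (devInit π σ f) with hy
  set b := 2 * Real.exp (-tauOnePlus f / hp f) with hb
  have hb0 : 0 < b := by positivity
  have y0 : y 0 = Real.log √(1 + b ^ 2) := by simp [hy, yDev, devInit, hb]
  have y1 : y 1 / hp f = Real.arsinh b⁻¹ := by
    have : y 1 = hp f * Real.arsinh b⁻¹ := by
      simp only [hy, yDev, devInit, Matrix.cons_val]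
      rw [← hb]
      ring
    rw [this, mul_div_cancel_left₀ _ hh.ne']
  have hr : √(1 + (b⁻¹) ^ 2) = √(1 + b ^ 2) / b := by
    rw [eq_div_iff hb0.ne', ← Real.sqrt_sq hb0.le, ← Real.sqrt_mul (by positivity),
      Real.sqrt_sq hb0.le]
    congr 1
    field_simp
    ring
  have hs0 : 0 < √(1 + b ^ 2) := by positivity
  have eA : alA (hp f) y = -1 := by
    rw [alA, y0, y1, Real.exp_log hs0, Real.tanh_arsinh, hr]
    field_simp
  have eX : xiA (hp f) y = -tauOnePlus f := by
    rw [xiA, y0, y1, Real.cosh_arsinh, hr, ← Real.log_div hs0.ne' (by positivity)]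
    have : √(1 + b ^ 2) / (2 * (√(1 + b ^ 2) / b)) = Real.exp (-tauOnePlus f / hp f) := by
      rw [hb]; field_simp
    rw [this, Real.log_exp]
    field_simp
  have y2 : y 2 = -(1 + wp f)⁻¹ := by simp [hy, yDev, devInit]
  have y3 : y 3 = -1 - hp f * Real.log 2 - (1 + wp f)⁻¹ * tauOnePlus f := by
    simp [hy, yDev, devInit]
  have y4 : y 4 = -(1 + wp f) + (al (stateVec π f σ) (π 2) + wp f) := by
    simp [hy, yDev, devInit]
  have y5 : y 5 = -((1 + wp f) * qp f) - hp f * Real.log 2 - (1 + wp f) * tauOnePlus f := by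
    simp [hy, yDev, devInit]
  have exi : xiVec (hp f) y = ![-((1 + wp f) / (1 + 2 * wp f)) * (1 + hp f * Real.log 2),
      -((1 + wp f) / (1 + 2 * wp f)) * (1 + hp f * Real.log 2),
      -(1 + wp f) * qp f - wp f * (1 + wp f) / (1 + 2 * wp f)
        - (1 + 3 * wp f + wp f ^ 2) / (1 + 2 * wp f) * (hp f * Real.log 2)] := by
    rw [xiVec, eX, y3, y5, tauOnePlus]
    congr 1
    · ring
    · congr 1
      · field_simp; ring
      · congr 1
        field_simp; ring
  have eal : alVec (hp f) y ∘ π.symm = (stateVec π f σ).1 := by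
    funext i
    refine forall_perm π (p := fun i => (alVec (hp f) y ∘ π.symm) i = (stateVec π f σ).1 i)
      ?_ ?_ ?_ i
    · simp [alVec, eA, stateVec]
    · simp only [alVec, eA, stateVec, y2, Function.comp_apply, Equiv.symm_apply_apply,
        Matrix.cons_val]
      field_simp
      ring
    · have : (stateVec π f σ).1 (π 2) = al (stateVec π f σ) (π 2) := rfl
      rw [this]
      simp only [alVec, eA, y4, Function.comp_apply, Equiv.symm_apply_apply, Matrix.cons_val]
      ring
  have ebe : betaOf (hp f) σ (xiVec (hp f) y ∘ π.symm) = (stateVec π f σ).2.1 := by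
    rw [exi]; rfl
  change (alVec (hp f) y ∘ π.symm, betaOf (hp f) σ (xiVec (hp f) y ∘ π.symm),
    gammaOf (betaOf (hp f) σ (xiVec (hp f) y ∘ π.symm)) (zp f)) = _
  rw [eal, ebe]
  rfl

theorem al_stateVec_two (π : Equiv.Perm (Fin 3)) (σ : Fin 3 → ℤˣ) (f : Param) :
    al (stateVec π f σ) (π 2) + wp f = -((1 + wp f) * (4 * ga (stateVec π f σ) ^ 2
      + (be (stateVec π f σ) (π 0) ^ 2 + be (stateVec π f σ) (π 1) ^ 2
        + be (stateVec π f σ) (π 2) ^ 2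
        - 2 * be (stateVec π f σ) (π 1) * be (stateVec π f σ) (π 2)
        - 2 * be (stateVec π f σ) (π 2) * be (stateVec π f σ) (π 0)
        - 2 * be (stateVec π f σ) (π 0) * be (stateVec π f σ) (π 1)))) := by
  have h1 : al (stateVec π f σ) (π 2) = -wp f - 4 * (1 + wp f) * ga (stateVec π f σ) ^ 2
      - (1 + wp f) * (be (stateVec π f σ) 0 ^ 2 + be (stateVec π f σ) 1 ^ 2
        + be (stateVec π f σ) 2 ^ 2
        - 2 * be (stateVec π f σ) 1 * be (stateVec π f σ) 2
        - 2 * be (stateVec π f σ) 2 * be (stateVec π f σ) 0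
        - 2 * be (stateVec π f σ) 0 * be (stateVec π f σ) 1) := by
    simp only [al, stateVec, Function.comp_apply, Equiv.symm_apply_apply, Matrix.cons_val]
    rfl
  -- Writing the quadratic form through power sums makes its invariance under relabelling by π
  -- evident.
  have h2 : ∀ β : Fin 3 → ℝ, β 0 ^ 2 + β 1 ^ 2 + β 2 ^ 2 - 2 * β 1 * β 2 - 2 * β 2 * β 0
      - 2 * β 0 * β 1 = 2 * ∑ i, β i ^ 2 - (∑ i, β i) ^ 2 := by
    intro β; rw [Fin.sum_univ_three, Fin.sum_univ_three]; ring
  have h3 := h2 (be (stateVec π f σ))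
  have h4 := h2 (be (stateVec π f σ) ∘ π)
  simp only [Function.comp_apply] at h4
  rw [h1, h3, h4, Equiv.sum_comp π (fun i => be (stateVec π f σ) i ^ 2),
    Equiv.sum_comp π (be (stateVec π f σ))]
  ring

/-- All nonzero entries are quadratically small: the first two are of order b², and the defect of
α_c is 1 + w times γ² and products of β's. -/
theorem norm_devInit_le (π : Equiv.Perm (Fin 3)) (σ : Fin 3 → ℤˣ) {f : Param}
    (hf : f ∈ paramSet) : ‖devInit π σ f‖ ≤ eps f ^ 14 / 4 := by
  have S := isTransfer hf
  have hh := S.h_pos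
  have hw := hf.2.1
  have hτ := half_le_tauOnePlus hh hw
  have he := S.pos
  set b := 2 * Real.exp (-tauOnePlus f / hp f) with hb
  have hb0 : 0 < b := by positivity
  have hb1 : b ≤ eps f ^ 31 := by
    have h1 := S.exp_le_pow (x := -tauOnePlus f) 32 (by
      have := S.T_le_one
      push_cast
      linarith)
    have h2 := S.pow_succ_le 31
    have := pow_pos he 31
    linarith
  have p1 : eps f ^ 31 ≤ eps f ^ 15 := S.pow_le (by norm_num)
  have p2 := S.pow_succ_le 14
  have p3 := pow_pos he 14
  have p4 : eps f ^ 14 ≤ 1 := pow_le_one₀ he.le S.le_one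
  have hb2 : b ^ 2 ≤ eps f ^ 15 := by
    have : b ≤ 1 := by linarith
    nlinarith
  have hlog : ∀ x : ℝ, 0 ≤ x → Real.log (1 + x) ≤ x := fun x hx => by
    have := Real.log_le_sub_one_of_pos (by linarith : 0 < 1 + x)
    linarith
  have hβ : ∀ j, |be (stateVec π f σ) (π j)| ≤ eps f ^ 31 := by
    have h1 : ∀ x : ℝ, x ≤ -(tauStar f / 4) → 2 * Real.exp (x / hp f) ≤ eps f ^ 31 := by
      intro x hx
      have h1 := S.exp_le_pow (x := x) 32 (by push_cast; linarith)
      have h2 := S.pow_succ_le 31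
      have := pow_pos he 31
      linarith
    have hTau : -((1 + wp f) / (1 + 2 * wp f)) * (1 + hp f * Real.log 2) = -tauOnePlus f := by
      rw [tauOnePlus]; ring
    have hT := S.T_le_one
    intro j
    change |betaOf _ _ _ _| ≤ _
    rw [abs_betaOf]
    apply h1
    simp only [Function.comp_apply, Equiv.symm_apply_apply]
    fin_cases j
    · change -((1 + wp f) / (1 + 2 * wp f)) * (1 + hp f * Real.log 2) ≤ _
      rw [hTau]; linarith
    · change -((1 + wp f) / (1 + 2 * wp f)) * (1 + hp f * Real.log 2) ≤ _
      rw [hTau]; linarith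
    · change -(1 + wp f) * qp f - wp f * (1 + wp f) / (1 + 2 * wp f)
        - (1 + 3 * wp f + wp f ^ 2) / (1 + 2 * wp f) * (hp f * Real.log 2) ≤ _
      have h4 := S.h_log_two_nonneg
      have h5 : 0 ≤ (1 + 3 * wp f + wp f ^ 2) / (1 + 2 * wp f) * (hp f * Real.log 2) := by
        positivity
      have h6 : 0 ≤ wp f * (1 + wp f) / (1 + 2 * wp f) := by positivity
      have h7 := (exponents_le hf (t := 0) ⟨by
        have := tauOneMinus_neg hf
        have := S.T_pos
        rw [tLo]; linarith, by linarith⟩).2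
      simp only [mul_zero, abs_zero] at h7
      linarith
  have hd4 : |al (stateVec π f σ) (π 2) + wp f| ≤ eps f ^ 17 := by
    rw [al_stateVec_two, abs_neg, abs_mul, abs_of_pos (by linarith : 0 < 1 + wp f)]
    have hg : ga (stateVec π f σ) ^ 2 ≤ eps f ^ 19 := by
      rw [← devState_devInit π σ hh hw, devState, ga_stateOf_sq _ _ _ _ _ S.z_pos.le]
      have e : ∀ j, |bet (σ ∘ π) (hp f) (yDev (hp f) (1 + wp f)⁻¹ 1 (1 + wp f)
          ((1 + wp f) * qp f) (tauOnePlus f) (devInit π σ f)) j|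
          = |be (stateVec π f σ) (π j)| := by
        intro j
        rw [← devState_devInit π σ hh hw, devState, be_stateOf]
      refine gaSq_le_of_abs_bet_le (s := σ ∘ π) S.toIsSmall ?_ ?_ ?_
      · rw [e]; exact (hβ 0).trans (by linarith)
      · rw [e]; exact hβ 1
      · rw [e]; exact hβ 2
    generalize ga (stateVec π f σ) = g at *
    have hβ0 := hβ 0
    have hβ1 := hβ 1
    have hβ2 := hβ 2
    generalize be (stateVec π f σ) (π 0) = x at *
    generalize be (stateVec π f σ) (π 1) = y at *
    generalize be (stateVec π f σ) (π 2) = u at *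
    have q1 : eps f ^ 31 ≤ eps f ^ 19 := S.pow_le (by norm_num)
    have q0 := pow_pos he 31
    have q2 : eps f ^ 31 ≤ 1 := pow_le_one₀ he.le S.le_one
    have q3 : ∀ r s : ℝ, |r| ≤ eps f ^ 31 → |s| ≤ eps f ^ 31 → |r * s| ≤ eps f ^ 19 := by
      intro r s hr hs
      rw [abs_mul]
      calc |r| * |s| ≤ eps f ^ 31 * 1 := by gcongr; linarith
        _ ≤ _ := by linarith
    have r1 := abs_le.1 (q3 _ _ hβ0 hβ0)
    have r2 := abs_le.1 (q3 _ _ hβ1 hβ1)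
    have r3 := abs_le.1 (q3 _ _ hβ2 hβ2)
    have r4 := abs_le.1 (q3 _ _ hβ1 hβ2)
    have r5 := abs_le.1 (q3 _ _ hβ2 hβ0)
    have r6 := abs_le.1 (q3 _ _ hβ0 hβ1)
    have h1 : |4 * g ^ 2 + (x ^ 2 + y ^ 2 + u ^ 2 - 2 * y * u - 2 * u * x - 2 * x * y)|
        ≤ 16 * eps f ^ 19 := by
      have := sq_nonneg g
      rw [abs_le]
      constructor <;> nlinarith
    -- One power of ε absorbs the possibly large factor 1 + w.
    have h2 : (1 + wp f) * eps f ≤ 1 / 32 := by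
      have := (eps_bounds hf).2.1
      have := S.h_le
      have := S.h_pos
      nlinarith
    calc _ ≤ (1 + wp f) * (16 * eps f ^ 19) := by gcongr
      _ = (1 + wp f) * eps f * (16 * eps f ^ 18) := by ring
      _ ≤ 1 / 32 * (16 * eps f ^ 18) := by gcongr
      _ ≤ eps f ^ 17 := by linarith [S.pow_succ_le 17, pow_pos he 17]
  refine (pi_norm_le_iff_of_nonneg (by positivity)).2 fun j => ?_
  rw [Real.norm_eq_abs]
  fin_cases j
  · change |16 * Real.log √(1 + b ^ 2)| ≤ _
    rw [Real.log_sqrt (by positivity), abs_of_nonneg (mul_nonneg (by norm_num)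
      (div_nonneg (Real.log_nonneg (by nlinarith)) (by norm_num)))]
    have := hlog (b ^ 2) (by positivity)
    linarith
  · change |hp f * Real.arsinh b⁻¹ - tauOnePlus f| ≤ _
    -- arcsinh(1/b) = log(2/b) + log((1 + √(1 + b²)) / 2), and h log(2/b) is exactly τ_{1+}.
    have e : hp f * Real.arsinh b⁻¹ - tauOnePlus f
        = hp f * Real.log ((1 + √(1 + b ^ 2)) / 2) := by
      have h1 : tauOnePlus f = -(hp f * Real.log (b / 2)) := by
        have : b / 2 = Real.exp (-tauOnePlus f / hp f) := by rw [hb]; ring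
        rw [this, Real.log_exp]; field_simp
      have hr : √(1 + (b⁻¹) ^ 2) = √(1 + b ^ 2) / b := by
        rw [eq_div_iff hb0.ne', ← Real.sqrt_sq hb0.le, ← Real.sqrt_mul (by positivity),
          Real.sqrt_sq hb0.le]
        congr 1
        field_simp
        ring
      rw [h1, Real.arsinh, hr, sub_neg_eq_add, ← mul_add,
        ← Real.log_mul (by positivity) (by positivity)]
      congr 2
      field_simp
    have hs1 : 1 ≤ √(1 + b ^ 2) := Real.one_le_sqrt.2 (by nlinarith)
    have hs2 : √(1 + b ^ 2) ≤ 1 + b ^ 2 := by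
      rw [Real.sqrt_le_left (by positivity)]; nlinarith [sq_nonneg (b ^ 2), sq_nonneg b]
    rw [e, abs_of_nonneg (mul_nonneg hh.le (Real.log_nonneg (by linarith)))]
    have h2 : Real.log ((1 + √(1 + b ^ 2)) / 2) ≤ b ^ 2 := by
      refine (Real.log_le_sub_one_of_pos (by positivity)).trans ?_
      nlinarith
    have h3 := S.h_le
    have h4 : 0 ≤ Real.log ((1 + √(1 + b ^ 2)) / 2) := Real.log_nonneg (by linarith)
    nlinarith
  · change |(0 : ℝ)| ≤ _
    rw [abs_zero]; positivity
  · change |(0 : ℝ)| ≤ _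
    rw [abs_zero]; positivity
  · change |16 * (al (stateVec π f σ) (π 2) + wp f)| ≤ _
    rw [abs_mul, abs_of_pos (by norm_num : (0 : ℝ) < 16)]
    have : eps f ^ 17 ≤ eps f ^ 15 := S.pow_le (by norm_num)
    linarith
  · change |(0 : ℝ)| ≤ _
    rw [abs_zero]; positivity

/-- `d` is the deviation of an exact solution through `Φ_*`. -/
structure IsDeviation (π : Equiv.Perm (Fin 3)) (σ : Fin 3 → ℤˣ) (f : Param)
    (d : ℝ → Fin 6 → ℝ) : Prop where
  norm_le : ∀ t ∈ Icc (tLo f) (tauOnePlus f), ‖d t‖ ≤ eps f ^ 14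
  isTraj : IsTraj (hp f) (tLo f) (tauOnePlus f) (fun t => devState π σ f t (d t))
  eq_stateVec : devState π σ f (tauOnePlus f) (d (tauOnePlus f)) = stateVec π f σ

theorem exists_isDeviation (π : Equiv.Perm (Fin 3)) (σ : Fin 3 → ℤˣ) {f : Param}
    (hf : f ∈ paramSet) : ∃ d, IsDeviation π σ f d := by
  have S := isTransfer hf
  have h1 := tauMinus_lt_tLo hf
  have h2 := neg_one_le_tauMinus hf
  have h3 := tauOnePlus_le hf
  have h4 := half_le_tauOnePlus S.h_pos hf.2.1
  have h5 := tauOneMinus_neg hf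
  have h6 : tLo f ≤ tauOnePlus f := by
    have := S.T_pos
    have := S.pos
    rw [tLo]; linarith
  obtain ⟨d, hd, hd'⟩ := exists_dev (s := σ ∘ π) (κb := (1 + wp f)⁻¹) (Pb := 1) (κc := 1 + wp f)
    (Pc := (1 + wp f) * qp f) S.toIsSmall h6 (by linarith)
    (fun t ht => S.exp_le_pow 32 (by push_cast; linarith [(exponents_le hf ht).1]))
    (fun t ht => S.exp_le_pow 32 (by push_cast; linarith [(exponents_le hf ht).2]))
    (norm_devInit_le π σ hf)
  refine ⟨d, fun t ht => (hd' t ht).2, ?_, ?_⟩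
  · exact isTraj_stateOf S.h_pos.ne' S.z_pos.le fun t ht => hasDerivWithinAt_yDev (hd' t ht).1
  · rw [hd]; exact devState_devInit π σ S.h_pos hf.2.1

/-! ### What the deviation bound says about pair sums and distances -/

section
variable (π : Equiv.Perm (Fin 3)) {f : Param}

theorem permL_of_le (h : qp f ≤ 1) : permL π f 0 = π 2 ∧ permL π f 1 = π 0 ∧ permL π f 2 = π 1 := by
  have e : permL π f = π * (finRotate 3)⁻¹ := if_pos h
  rw [e]
  have h0 : (finRotate 3)⁻¹ 0 = 2 := by decide
  have h1 : (finRotate 3)⁻¹ 1 = 0 := by decide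
  have h2 : (finRotate 3)⁻¹ 2 = 1 := by decide
  simp only [Equiv.Perm.mul_apply, h0, h1, h2, and_self]

theorem permL_of_lt (h : 1 < qp f) : permL π f 0 = π 1 ∧ permL π f 1 = π 0 ∧ permL π f 2 = π 2 := by
  have e : permL π f = π * Equiv.swap 0 1 := if_neg (not_le.2 h)
  rw [e]
  have h0 : Equiv.swap (0 : Fin 3) 1 0 = 1 := by decide
  have h1 : Equiv.swap (0 : Fin 3) 1 1 = 0 := by decide
  have h2 : Equiv.swap (0 : Fin 3) 1 2 = 2 := by decide
  simp only [Equiv.Perm.mul_apply, h0, h1, h2, and_self]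

theorem permL_one : permL π f 1 = π 0 := by
  rcases le_or_gt (qp f) 1 with h | h
  · exact (permL_of_le π h).2.1
  · exact (permL_of_lt π h).2.1

end

section
variable (π : Equiv.Perm (Fin 3)) (σ : Fin 3 → ℤˣ) {f : Param} {t : ℝ} {d : Fin 6 → ℝ}

theorem alPair_devState_one : alPair (devState π σ f t d) (π 1) (π 0)
    = -(1 + wp f)⁻¹ + d 2 / 16 := by
  rw [alPair, devState, al_stateOf, al_stateOf]; simp [alVec, yDev]

theorem alPair_devState_two : alPair (devState π σ f t d) (π 2) (π 0)
    = -(1 + wp f) + d 4 / 16 := by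
  rw [alPair, devState, al_stateOf, al_stateOf]; simp [alVec, yDev]

theorem xiPair_devState_one (hh : hp f ≠ 0) : xiPair (devState π σ f t d) (hp f) (π 1) (π 0)
    = -1 - hp f * Real.log 2 - (1 + wp f)⁻¹ * t + d 3 := by
  rw [xiPair, devState, xi_stateOf _ _ _ _ hh, xi_stateOf _ _ _ _ hh]; simp [xiVec, yDev]

theorem xiPair_devState_two (hh : hp f ≠ 0) : xiPair (devState π σ f t d) (hp f) (π 2) (π 0)
    = -((1 + wp f) * qp f) - hp f * Real.log 2 - (1 + wp f) * t + d 5 := by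
  rw [xiPair, devState, xi_stateOf _ _ _ _ hh, xi_stateOf _ _ _ _ hh]; simp [xiVec, yDev]

theorem abs_div_sixteen_le {x δ : ℝ} (h : |x| ≤ δ) : |x / 16| ≤ δ / 16 := by
  rw [abs_div]; norm_num; linarith

/-- The pair sums for the pairs `(a', a)` and `(c', a)`. -/
theorem pair_devState (hh : hp f ≠ 0) (hd : ‖d‖ ≤ eps f ^ 14) :
    |alPair (devState π σ f t d) (permL π f 0) (π 0) - (-kap f)| ≤ eps f ^ 14 ∧
    |xiPair (devState π σ f t d) (hp f) (permL π f 0) (π 0)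
      - (-pA f - hp f * Real.log 2 - kap f * t)| ≤ eps f ^ 14 ∧
    |xiPair (devState π σ f t d) (hp f) (permL π f 2) (π 0)
      - (-pC f - hp f * Real.log 2 - (kap f)⁻¹ * t)| ≤ eps f ^ 14 := by
  have hp14 := pow_pos (eps_pos f) 14
  have h2 := abs_div_sixteen_le (abs_le_of_norm_le hd 2)
  have h3 := abs_le_of_norm_le hd 3
  have h4 := abs_div_sixteen_le (abs_le_of_norm_le hd 4)
  have h5 := abs_le_of_norm_le hd 5
  rcases le_or_gt (qp f) 1 with h | h
  · obtain ⟨e0, -, e2⟩ := permL_of_le π h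
    have e4 : kap f = 1 + wp f := if_pos h
    have e5 : pA f = (1 + wp f) * qp f := if_pos h
    have e6 : pC f = 1 := if_pos h
    rw [e0, e2, alPair_devState_two, xiPair_devState_one _ _ hh, xiPair_devState_two _ _ hh, e4,
      e5, e6]
    simp only [add_sub_cancel_left]
    exact ⟨by linarith, h5, h3⟩
  · obtain ⟨e0, -, e2⟩ := permL_of_lt π h
    have e4 : kap f = (1 + wp f)⁻¹ := if_neg (not_le.2 h)
    have e5 : pA f = 1 := if_neg (not_le.2 h)
    have e6 : pC f = (1 + wp f) * qp f := if_neg (not_le.2 h)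
    rw [e0, e2, alPair_devState_one, xiPair_devState_one _ _ hh, xiPair_devState_two _ _ hh, e4,
      e5, e6, inv_inv]
    simp only [add_sub_cancel_left]
    exact ⟨by linarith, h3, h5⟩

/-- All quantities but one differ by a coordinate of the deviation or its exponential, or not at
all; for hφ_a / A_a the change of A_a is multiplied by |t|, hence the bound on t. -/
theorem distD_devState_le (hf : f ∈ paramSet) (ht : |t| ≤ 3 / 2) (hd : ‖d‖ ≤ eps f ^ 14) :
    distD π (hp f) (devState π σ f t d) (refField π f σ t) ≤ eps f := by
  have S := isTransfer hf
  have hh := S.h_pos.ne'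
  have hp14 := pow_pos S.pos 14
  have hs : 16 * eps f ^ 14 ≤ eps f := by
    have h1 : eps f ^ 14 ≤ eps f ^ 2 := S.pow_le (by norm_num)
    have h2 := S.pow_succ_le 1
    simp only [pow_one, Nat.reduceAdd] at h2
    linarith
  have hζ : eps f ^ 14 / 16 ≤ 1 / 2 := by linarith [S.le]
  have d0 := abs_div_sixteen_le (abs_le_of_norm_le hd 0)
  have d1 := abs_le_of_norm_le hd 1
  have d2 := abs_div_sixteen_le (abs_le_of_norm_le hd 2)
  have d3 := abs_le_of_norm_le hd 3
  have d4 := abs_div_sixteen_le (abs_le_of_norm_le hd 4)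
  have d5 := abs_le_of_norm_le hd 5
  have e1 := abs_exp_sub_one_le d0 hζ
  have e2 := abs_exp_sub_one_le (x := -(d 0 / 16)) (by rwa [abs_neg]) hζ
  have y0 : ∀ d : Fin 6 → ℝ, yDev (hp f) (1 + wp f)⁻¹ 1 (1 + wp f) ((1 + wp f) * qp f) t d 0
      = d 0 / 16 := fun _ => rfl
  have y1 : ∀ d : Fin 6 → ℝ, yDev (hp f) (1 + wp f)⁻¹ 1 (1 + wp f) ((1 + wp f) * qp f) t d 1
      = t + d 1 := fun _ => rfl
  have ea : ∀ d, amp (devState π σ f t d) (π 0) = Real.exp (d 0 / 16) := fun d => by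
    rw [devState, amp_stateOf _ _ _ _ hh, y0]
  have ep : ∀ d, hp f * (phi (devState π σ f t d) (π 0) / amp (devState π σ f t d) (π 0))
      = (t + d 1) * Real.exp (-(d 0 / 16)) := fun d => by
    rw [ea, devState, phi_stateOf _ _ _ _ hh, y1, Real.exp_neg]
    field_simp
  have er : ∀ d, rho (devState π σ f t d) ^ 2 = zp f := fun d => by
    rw [devState, rho_stateOf_sq _ _ _ _ _ S.z_pos.le]
  rw [refField_eq, distD, ep, ep, ea, ea, alPair_devState_one, alPair_devState_one,
    alPair_devState_two, alPair_devState_two, xiPair_devState_one _ _ hh,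
    xiPair_devState_one _ _ hh, xiPair_devState_two _ _ hh, xiPair_devState_two _ _ hh, er, er]
  simp only [Pi.zero_apply, zero_div, neg_zero, Real.exp_zero, add_zero, mul_one, sub_self,
    abs_zero, add_sub_cancel_left]
  refine max_le (by linarith) (max_le ?_ (max_le (by linarith) (max_le (by linarith)
    (max_le (by linarith) (max_le (by linarith) S.pos.le)))))
  have e3 : (t + d 1) * Real.exp (-(d 0 / 16)) - t
      = t * (Real.exp (-(d 0 / 16)) - 1) + d 1 * Real.exp (-(d 0 / 16)) := by ring
  have e4 : |Real.exp (-(d 0 / 16))| ≤ 2 := by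
    rw [abs_of_pos (Real.exp_pos _)]; linarith [(abs_le.1 e2).2]
  rw [e3]
  refine (abs_add_le _ _).trans ?_
  rw [abs_mul, abs_mul]
  have h1 : |t| * |Real.exp (-(d 0 / 16)) - 1| ≤ 3 / 2 * (2 * (eps f ^ 14 / 16)) := by gcongr
  have h2 : |d 1| * |Real.exp (-(d 0 / 16))| ≤ eps f ^ 14 * 2 := by gcongr
  linarith

theorem pow_fourteen_le (hf : f ∈ paramSet) : 2 ^ 10 * eps f ^ 14 ≤ eps f := by
  have S := isTransfer hf
  have h1 : eps f ^ 14 ≤ eps f ^ 2 := S.pow_le (by norm_num)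
  have h2 := S.pow_succ_le 1
  simp only [pow_one, Nat.reduceAdd] at h2
  linarith [S.pos]

/-- α_b + α_c = α_{b,a} + α_{c,a} - 2α_a, and -2α_a is at most 2A_a, close to 2. The reference value
is thus at most -w² / (1 + w); the other two sums are close to -1 / (1 + w) and -(1 + w). Half of
min(w², 1/w) lies below all these sizes, and half of that remains after the error. -/
theorem alPair_max_le (hf : f ∈ paramSet) (hd : ‖d‖ ≤ eps f ^ 14) :
    max (alPair (devState π σ f t d) (π 1) (π 2)) (max (alPair (devState π σ f t d) (π 2) (π 0))
      (alPair (devState π σ f t d) (π 0) (π 1))) ≤ -(1 / 2 ^ 2) * min (wp f ^ 2) (wp f)⁻¹ := by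
  have S := isTransfer hf
  obtain ⟨-, b2, -, b4, -, b6⟩ := eps_bounds hf
  have hw := hf.2.1
  have hs := pow_fourteen_le hf
  have hp14 := pow_pos S.pos 14
  have d0 := abs_div_sixteen_le (abs_le_of_norm_le hd 0)
  have d2 := (abs_le.1 (abs_div_sixteen_le (abs_le_of_norm_le hd 2))).2
  have d4 := (abs_le.1 (abs_div_sixteen_le (abs_le_of_norm_le hd 4))).2
  have e1 := (abs_le.1 (abs_exp_sub_one_le d0 (by linarith [S.le]))).2
  have hε : eps f ≤ 1 / 8 * (1 + wp f)⁻¹ := by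
    rw [← div_eq_mul_inv, le_div_iff₀ (by linarith)]
    have : 0 < eps f * (1 + wp f) := mul_pos S.pos (by linarith)
    have : hp f ^ 2 ≤ 1 := by nlinarith [S.h_pos]
    linarith
  have hm1 : min (wp f ^ 2) (wp f)⁻¹ ≤ wp f ^ 2 := min_le_left _ _
  have hm2 : min (wp f ^ 2) (wp f)⁻¹ ≤ (wp f)⁻¹ := min_le_right _ _
  have hm3 : 1 / 2 * min (wp f ^ 2) (wp f)⁻¹ ≤ (1 + wp f)⁻¹ := by
    rw [← one_div (1 + wp f), le_div_iff₀ (by linarith)]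
    rcases le_total (wp f) 1 with h | h
    · have : min (wp f ^ 2) (wp f)⁻¹ ≤ 1 := hm1.trans (pow_le_one₀ hw.le h)
      have : 0 < min (wp f ^ 2) (wp f)⁻¹ := lt_min (by positivity) (by positivity)
      nlinarith
    · have h1 : (wp f)⁻¹ * (1 + wp f) ≤ 2 := by
        rw [inv_mul_le_iff₀ hw]; linarith
      have : min (wp f ^ 2) (wp f)⁻¹ * (1 + wp f) ≤ (wp f)⁻¹ * (1 + wp f) := by gcongr
      linarith
  have hm4 : 1 / 2 * min (wp f ^ 2) (wp f)⁻¹ ≤ wp f ^ 2 / (1 + wp f) := by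
    rw [le_div_iff₀ (by linarith)]
    rcases le_total (wp f) 1 with h | h
    · have : min (wp f ^ 2) (wp f)⁻¹ * (1 + wp f) ≤ wp f ^ 2 * (1 + wp f) := by gcongr
      nlinarith [sq_nonneg (wp f)]
    · have h1 : (wp f)⁻¹ * (1 + wp f) ≤ 2 := by
        rw [inv_mul_le_iff₀ hw]; linarith
      have : min (wp f ^ 2) (wp f)⁻¹ * (1 + wp f) ≤ (wp f)⁻¹ * (1 + wp f) := by gcongr
      nlinarith
  have hm5 : eps f ≤ 1 / 4 * min (wp f ^ 2) (wp f)⁻¹ := by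
    have h1 : eps f ≤ 1 / 4 * wp f ^ 2 := by linarith [S.pos]
    have h2 : (1 + wp f)⁻¹ ≤ (wp f)⁻¹ := by gcongr; linarith
    have h3 : eps f ≤ 1 / 4 * (wp f)⁻¹ := by
      have : 0 < (wp f)⁻¹ := by positivity
      linarith
    rcases min_choice (wp f ^ 2) (wp f)⁻¹ with h | h <;> rw [h] <;> assumption
  have hi : (1 + wp f)⁻¹ ≤ 1 + wp f := (inv_le_one_of_one_le₀ (by linarith)).trans (by linarith)
  refine max_le ?_ (max_le ?_ ?_)
  · have e : alPair (devState π σ f t d) (π 1) (π 2) = -(1 + wp f)⁻¹ + d 2 / 16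
        + (-(1 + wp f) + d 4 / 16) + 2 * (Real.exp (d 0 / 16) * Real.tanh ((t + d 1) / hp f)) := by
      rw [alPair, devState, al_stateOf, al_stateOf]
      simp [alVec, yDev, alA]
      ring
    have h1 : Real.exp (d 0 / 16) * Real.tanh ((t + d 1) / hp f) ≤ Real.exp (d 0 / 16) * 1 := by
      gcongr
      exact (Real.tanh_lt_one _).le
    have h2 : (1 + wp f)⁻¹ + (1 + wp f) = 2 + wp f ^ 2 / (1 + wp f) := by field_simp; ring
    rw [e]
    linarith
  · rw [alPair_devState_two]; linarith
  · rw [alPair, add_comm]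
    change alPair _ _ _ ≤ _
    rw [alPair_devState_one]; linarith

end

/-! ### The motion before the bounce and the crossing time -/

/-- Before the bounce `α_a ≈ 1` and `ξ_a ≈ τ`. -/
theorem before_bounce (π : Equiv.Perm (Fin 3)) (σ : Fin 3 → ℤˣ) {f : Param} (hf : f ∈ paramSet)
    {t : ℝ} (ht : t ≤ 1 / 2 * tauOneMinus f) {d : Fin 6 → ℝ} (hd : ‖d‖ ≤ eps f ^ 14) :
    |al (devState π σ f t d) (π 0) - 1| ≤ eps f ^ 14 ∧
    |xi (devState π σ f t d) (hp f) (π 0) - t| ≤ 2 * eps f ^ 14 := by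
  have S := isTransfer hf
  have hh := S.h_pos
  have hs := pow_fourteen_le hf
  have hp14 := pow_pos S.pos 14
  have d0 := abs_div_sixteen_le (abs_le_of_norm_le hd 0)
  have d1 := abs_le_of_norm_le hd 1
  have e1 := abs_exp_sub_one_le d0 (by linarith [S.le])
  set φ := (t + d 1) / hp f with hφ
  set E := Real.exp (2 * φ) with hE
  have hE0 : 0 < E := Real.exp_pos _
  -- Here t ≤ -T/6, so 2t ≤ -T/3, which is more than 42 units of T / 2^7; the excess over 41 covers
  -- the deviation.
  have hE1 : E ≤ eps f ^ 41 := by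
    have : 2 * φ = (2 * (t + d 1)) / hp f := by rw [hφ]; ring
    rw [hE, this]
    apply S.exp_le_pow
    have h1 := tauOneMinus_neg hf
    have h2 := (abs_le.1 d1).2
    have h3 := S.le_h'
    have h4 := S.h_lt
    have := S.pos
    push_cast
    linarith
  have hE2 : E ≤ 1 / 8 * eps f ^ 14 := by
    have h1 : eps f ^ 41 ≤ eps f ^ 15 := S.pow_le (by norm_num)
    have h2 := S.pow_succ_le 14
    linarith
  have htanh : Real.tanh φ = -1 + 2 * E / (1 + E) := by
    have h1 : E = Real.exp φ * Real.exp φ := by rw [hE, ← Real.exp_add]; ring_nf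
    rw [Real.tanh_eq, h1, Real.exp_neg]
    have := Real.exp_pos φ
    field_simp
    ring
  have hcosh : Real.log (2 * Real.cosh φ) = -φ + Real.log (1 + E) := by
    have h1 : 2 * Real.cosh φ = Real.exp (-φ) * (1 + E) := by
      rw [Real.cosh_eq, hE, mul_add, ← Real.exp_add]; ring_nf
    rw [h1, Real.log_mul (Real.exp_pos _).ne' (by positivity), Real.log_exp]
  have hlog0 : 0 ≤ Real.log (1 + E) := Real.log_nonneg (by linarith)
  have hlog1 : Real.log (1 + E) ≤ E := by
    have := Real.log_le_sub_one_of_pos (by linarith : 0 < 1 + E)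
    linarith
  constructor
  · have e : al (devState π σ f t d) (π 0) - 1
        = (Real.exp (d 0 / 16) - 1) - Real.exp (d 0 / 16) * (2 * E / (1 + E)) := by
      rw [devState, al_stateOf]
      change -(Real.exp (d 0 / 16) * Real.tanh φ) - 1 = _
      rw [htanh]; ring
    have h1 : 0 ≤ 2 * E / (1 + E) := by positivity
    have h2 : 2 * E / (1 + E) ≤ 2 * E := div_le_self (by positivity) (by linarith)
    have h3 : Real.exp (d 0 / 16) ≤ 2 := by linarith [(abs_le.1 e1).2, S.le]
    have h4 : |Real.exp (d 0 / 16) * (2 * E / (1 + E))| ≤ 2 * (2 * E) := by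
      rw [abs_of_nonneg (by positivity)]; gcongr
    rw [e]
    refine (abs_sub _ _).trans ?_
    linarith
  · have e : xi (devState π σ f t d) (hp f) (π 0) - t
        = hp f * (d 0 / 16) + d 1 - hp f * Real.log (1 + E) := by
      rw [devState, xi_stateOf _ _ _ _ hh.ne']
      change hp f * (d 0 / 16 - Real.log (2 * Real.cosh φ)) - t = _
      rw [hcosh, hφ]; field_simp; ring
    have h1 : hp f ≤ 1 := S.h_le.trans (by norm_num)
    have h2 : |hp f * (d 0 / 16)| ≤ 1 * (eps f ^ 14 / 16) := by
      rw [abs_mul, abs_of_pos hh]; gcongr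
    have h3 : |hp f * Real.log (1 + E)| ≤ 1 * E := by
      rw [abs_mul, abs_of_pos hh, abs_of_nonneg hlog0]; gcongr
    rw [e]
    refine (abs_sub _ _).trans ?_
    have := abs_add_le (hp f * (d 0 / 16)) (d 1)
    linarith

theorem IsTraj.hasDerivWithinAt_xi {h a b : ℝ} (hh : h ≠ 0) {Φ : ℝ → State}
    (H : IsTraj h a b Φ) {t : ℝ} (ht : t ∈ Icc a b) (i : Fin 3) (hb : be (Φ t) i ≠ 0) :
    HasDerivWithinAt (fun t => xi (Φ t) h i) (al (Φ t) i) (Icc a b) t := by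
  have h1 := (((H.hasDerivWithinAt_be ht i).const_mul (1 / 2)).log
    (by simpa using hb)).const_mul h
  simp only [xi, Real.log_abs]
  refine h1.congr_deriv ?_
  field_simp

theorem xi_sub_xi (Φ : State) (h : ℝ) (i j : Fin 3) :
    xi Φ h i - xi Φ h j = 2 * xi Φ h i - xiPair Φ h j i := by rw [xiPair]; ring

/-- The crossing time `τ_{2-}` of `ξ_a` and `ξ_{a'}`. -/
theorem exists_crossing {π : Equiv.Perm (Fin 3)} {σ : Fin 3 → ℤˣ} {f : Param}
    (hf : f ∈ paramSet) {d : ℝ → Fin 6 → ℝ} (D : IsDeviation π σ f d) :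
    ∃ t₂, tLo f < t₂ ∧ t₂ < 1 / 2 * tauOneMinus f ∧ |t₂ - tauOneMinus f| ≤ 5 * eps f ^ 14 ∧
      xi (devState π σ f t₂ (d t₂)) (hp f) (π 0)
        = xi (devState π σ f t₂ (d t₂)) (hp f) (permL π f 0) ∧
      ∀ t ∈ Icc (tLo f) (1 / 2 * tauOneMinus f),
        (t < t₂ → xi (devState π σ f t (d t)) (hp f) (π 0)
          < xi (devState π σ f t (d t)) (hp f) (permL π f 0)) ∧
        (t₂ < t → xi (devState π σ f t (d t)) (hp f) (permL π f 0)
          < xi (devState π σ f t (d t)) (hp f) (π 0)) := by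
  have S := isTransfer hf
  have hh := S.h_pos
  have hw := hf.2.1
  have hκ := S.κ_pos
  have hs := pow_fourteen_le hf
  have hp14 := pow_pos S.pos 14
  have hT := tauOneMinus_neg hf
  have hT0 := S.T_pos
  have hτ := half_le_tauOnePlus hh hw
  have hlo : tLo f = tauOneMinus f - eps f := rfl
  have hεT : 2 ^ 40 * eps f ≤ tauStar f := by linarith [S.le_h', S.h_lt]
  set Φ : ℝ → State := fun t => devState π σ f t (d t) with hΦ
  set I := Icc (tLo f) (1 / 2 * tauOneMinus f) with hI
  set G : ℝ → ℝ := fun t => xi (Φ t) (hp f) (π 0) - xi (Φ t) (hp f) (permL π f 0) with hG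
  have hsub : I ⊆ Icc (tLo f) (tauOnePlus f) := Icc_subset_Icc_right (by linarith)
  -- G = 2ξ_a - ξ_{a',a}, where ξ_a is close to t and ξ_{a',a} is close to an affine function of
  -- slope -κ.
  have hG1 : ∀ t ∈ I, |G t - (2 + kap f) * (t - tauOneMinus f)| ≤ 5 * eps f ^ 14 := by
    intro t ht
    have hd := D.norm_le t (hsub ht)
    have h1 := abs_le.1 (before_bounce π σ hf ht.2 hd).2
    have h2 := abs_le.1 (pair_devState π σ (t := t) hh.ne' hd).2.1
    have h3 : (2 + kap f) * (t - tauOneMinus f)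
        = 2 * t + (pA f + hp f * Real.log 2 + kap f * t) := by
      rw [tauOneMinus_eq hw]; field_simp; ring
    have h4 : G t = 2 * xi (Φ t) (hp f) (π 0) - xiPair (Φ t) (hp f) (permL π f 0) (π 0) :=
      xi_sub_xi _ _ _ _
    rw [h4, h3, abs_le]
    constructor <;> linarith
  have hder : ∀ t ∈ I, HasDerivWithinAt G (al (Φ t) (π 0) - al (Φ t) (permL π f 0)) I t := by
    intro t ht
    have h1 := D.isTraj.hasDerivWithinAt_xi hh.ne' (hsub ht) (π 0) (be_stateOf_ne_zero _ _ _ _ _ _)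
    have h2 := D.isTraj.hasDerivWithinAt_xi hh.ne' (hsub ht) (permL π f 0)
      (be_stateOf_ne_zero _ _ _ _ _ _)
    exact (h1.sub h2).mono hsub
  -- The derivative of G is 2α_a - α_{a',a}, close to 2 + κ, so the zero found below is the only
  -- one.
  have hpos : ∀ t ∈ I, 0 < al (Φ t) (π 0) - al (Φ t) (permL π f 0) := by
    intro t ht
    have hd := D.norm_le t (hsub ht)
    have h1 := abs_le.1 (before_bounce π σ hf ht.2 hd).1
    have h2 := abs_le.1 (pair_devState π σ (t := t) hh.ne' hd).1
    have h3 : alPair (Φ t) (permL π f 0) (π 0) = al (Φ t) (permL π f 0) + al (Φ t) (π 0) := rfl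
    have h4 := S.le
    linarith
  have hcont : ContinuousOn G I := fun t ht => (hder t ht).continuousWithinAt
  have hmono : StrictMonoOn G I := by
    refine strictMonoOn_of_hasDerivWithinAt_pos (convex_Icc _ _) hcont
      (f' := fun t => al (Φ t) (π 0) - al (Φ t) (permL π f 0))
      (fun t ht => (hder t (interior_subset ht)).mono interior_subset)
      (fun t ht => hpos t (interior_subset ht))
  have hle : tLo f ≤ 1 / 2 * tauOneMinus f := by linarith [S.pos]
  have hl : tLo f ∈ I := ⟨le_rfl, hle⟩
  have hr : 1 / 2 * tauOneMinus f ∈ I := ⟨hle, le_rfl⟩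
  -- The margin ε built into `tLo` beats the error of order ε^14.
  have hGl : G (tLo f) < 0 := by
    have := (abs_le.1 (hG1 _ hl)).2
    rw [hlo] at this ⊢
    nlinarith [S.pos]
  have hGr : 0 < G (1 / 2 * tauOneMinus f) := by
    have := (abs_le.1 (hG1 _ hr)).1
    nlinarith [S.pos]
  obtain ⟨t₂, ht₂, h0⟩ := intermediate_value_Icc hle hcont ⟨hGl.le, hGr.le⟩
  refine ⟨t₂, ?_, ?_, ?_, sub_eq_zero.1 h0, fun t ht => ⟨fun h => ?_, fun h => ?_⟩⟩
  · rcases eq_or_lt_of_le ht₂.1 with h | h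
    · rw [h, h0] at hGl; exact absurd hGl (lt_irrefl _)
    · exact h
  · rcases eq_or_lt_of_le ht₂.2 with h | h
    · rw [← h, h0] at hGr; exact absurd hGr (lt_irrefl _)
    · exact h
  · have := hG1 t₂ ht₂
    rw [h0, zero_sub, abs_neg, abs_mul, abs_of_pos (by linarith : 0 < 2 + kap f)] at this
    nlinarith [abs_nonneg (t₂ - tauOneMinus f)]
  · have := hmono ht ht₂ h
    rw [h0] at this
    exact sub_neg.1 this
  · have := hmono ht₂ ht h
    rw [h0] at this
    exact sub_pos.1 this

/-! ### States on the section and their parameters -/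

theorem eqC_perm (Φ : State) (π : Equiv.Perm (Fin 3)) :
    eqC Φ (fun _ => 1) 1 = -4 * ga Φ ^ 2 + (al Φ (π 0) * al Φ (π 1)
      + al Φ (π 2) * (al Φ (π 0) + al Φ (π 1))) - (be Φ (π 0) ^ 2 + be Φ (π 1) ^ 2
        + be Φ (π 2) ^ 2 - 2 * be Φ (π 1) * be Φ (π 2) - 2 * be Φ (π 2) * be Φ (π 0)
        - 2 * be Φ (π 0) * be Φ (π 1)) := by
  have h2 : ∀ β : Fin 3 → ℝ, β 0 ^ 2 + β 1 ^ 2 + β 2 ^ 2 - 2 * β 1 * β 2 - 2 * β 2 * β 0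
      - 2 * β 0 * β 1 = 2 * ∑ i, β i ^ 2 - (∑ i, β i) ^ 2 := by
    intro β; rw [Fin.sum_univ_three, Fin.sum_univ_three]; ring
  have h3 : ∀ β : Fin 3 → ℝ, β 0 * β 1 + β 2 * (β 0 + β 1)
      = ((∑ i, β i) ^ 2 - ∑ i, β i ^ 2) / 2 := by
    intro β; rw [Fin.sum_univ_three, Fin.sum_univ_three]; ring
  have b1 := h2 (be Φ ∘ π)
  have a1 := h3 (al Φ ∘ π)
  simp only [Function.comp_apply] at a1 b1
  rw [a1, b1, Equiv.sum_comp π (fun i => be Φ i ^ 2), Equiv.sum_comp π (be Φ),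
    Equiv.sum_comp π (fun i => al Φ i ^ 2), Equiv.sum_comp π (al Φ), ← h2 (be Φ), ← h3 (al Φ), eqC,
    Fin.sum_univ_three]
  have e1 : (1 : Fin 3) + 1 = 2 := rfl
  have e2 : (1 : Fin 3) + 2 = 0 := rfl
  have e3 : (2 : Fin 3) + 1 = 0 := rfl
  have e4 : (2 : Fin 3) + 2 = 1 := rfl
  simp only [zero_add, e1, e2, e3, e4]
  ring

theorem sign_mul_of_pos {c : ℝ} (hc : 0 < c) (x : ℝ) : Real.sign (c * x) = Real.sign x := by
  rcases lt_trichotomy x 0 with h | h | h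
  · rw [Real.sign_of_neg h, Real.sign_of_neg (mul_neg_of_pos_of_neg hc h)]
  · rw [h, mul_zero]
  · rw [Real.sign_of_pos h, Real.sign_of_pos (mul_pos hc h)]

theorem al_smul (c : ℝ) (Φ : State) (i : Fin 3) : al (c • Φ) i = c * al Φ i := rfl
theorem be_smul (c : ℝ) (Φ : State) (i : Fin 3) : be (c • Φ) i = c * be Φ i := rfl
theorem ga_smul (c : ℝ) (Φ : State) : ga (c • Φ) = c * ga Φ := rfl

section
variable (π : Equiv.Perm (Fin 3)) (f : Param) (σ : Fin 3 → ℤˣ)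

theorem al_stateVec_zero : al (stateVec π f σ) (π 0) = -1 := by
  simp [al, stateVec]

theorem al_stateVec_one : al (stateVec π f σ) (π 1) = wp f / (1 + wp f) := by
  simp [al, stateVec]

theorem be_stateVec_zero : be (stateVec π f σ) (π 0) = ((σ (π 0) : ℤ) : ℝ) *
    (2 * Real.exp (-((1 + wp f) / (1 + 2 * wp f)) * (1 + hp f * Real.log 2) / hp f)) := by
  simp [be, stateVec, betaOf]

theorem be_stateVec_one : be (stateVec π f σ) (π 1) = ((σ (π 1) : ℤ) : ℝ) *
    (2 * Real.exp (-((1 + wp f) / (1 + 2 * wp f)) * (1 + hp f * Real.log 2) / hp f)) := by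
  simp [be, stateVec, betaOf]

theorem be_stateVec_two : be (stateVec π f σ) (π 2) = ((σ (π 2) : ℤ) : ℝ) *
    (2 * Real.exp ((-(1 + wp f) * qp f - wp f * (1 + wp f) / (1 + 2 * wp f)
    - (1 + 3 * wp f + wp f ^ 2) / (1 + 2 * wp f) * (hp f * Real.log 2)) / hp f)) := by
  simp only [be, stateVec, betaOf, Function.comp_apply, Equiv.symm_apply_apply, Matrix.cons_val]

theorem eqC_stateVec (hw : 0 < wp f) : eqC (stateVec π f σ) (fun _ => 1) 1 = 0 := by
  rw [eqC_perm _ π]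
  have h := al_stateVec_two π σ f
  rw [al_stateVec_zero, al_stateVec_one]
  generalize be (stateVec π f σ) (π 0) ^ 2 + be (stateVec π f σ) (π 1) ^ 2
        + be (stateVec π f σ) (π 2) ^ 2
        - 2 * be (stateVec π f σ) (π 1) * be (stateVec π f σ) (π 2)
        - 2 * be (stateVec π f σ) (π 2) * be (stateVec π f σ) (π 0)
        - 2 * be (stateVec π f σ) (π 0) * be (stateVec π f σ) (π 1) = Q at *
  have h' : al (stateVec π f σ) (π 2)
      = -wp f - (1 + wp f) * (4 * ga (stateVec π f σ) ^ 2 + Q) := by linarith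
  rw [h']
  field_simp
  ring

theorem smul_stateVec_mem_sectionSet {c : ℝ} (hc : 0 < c) (hh : 0 < hp f) (hw : 0 < wp f) :
    c • stateVec π f σ ∈ sectionSet π σ := by
  refine ⟨fun i => ?_, ?_, ?_, ?_, ?_, ?_⟩
  · rw [be_smul, sign_mul_of_pos hc]
    exact sign_betaOf _ _ _ _
  · rw [be_smul, be_smul, be_stateVec_zero, be_stateVec_one, abs_mul, abs_mul c, abs_mul,
      abs_mul ((σ (π 1) : ℤ) : ℝ), abs_unit_cast, abs_unit_cast]
  · have h := eqC_stateVec π f σ hw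
    rw [eqC_perm _ π] at h ⊢
    simp only [al_smul, be_smul, ga_smul]
    linear_combination c ^ 2 * h
  · rw [al_smul, al_stateVec_one]; positivity
  · rw [al_smul, al_smul, al_stateVec_one, al_stateVec_zero]
    have : wp f / (1 + wp f) < 1 := by rw [div_lt_one (by linarith)]; linarith
    nlinarith
  · have eb : |be (stateVec π f σ) (π 0) / -1| = 2 * Real.exp
        (-((1 + wp f) / (1 + 2 * wp f)) * (1 + hp f * Real.log 2) / hp f) := by
      rw [be_stateVec_zero, div_neg, div_one, abs_neg, abs_mul, abs_unit_cast, one_mul,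
        abs_of_pos (by positivity)]
    rw [al_smul, al_smul, be_smul, mul_div_mul_left _ _ hc.ne', al_stateVec_one,
      al_stateVec_zero, eb, mul_neg_one, abs_neg, abs_of_pos hc,
      Real.log_mul (by norm_num) (Real.exp_pos _).ne', Real.log_exp]
    -- In the last inequality defining the section, the two sides differ by exactly c / h.
    have e : (c * (wp f / (1 + wp f)) + c) * (Real.log 2
        + -((1 + wp f) / (1 + 2 * wp f)) * (1 + hp f * Real.log 2) / hp f)
        = c * (wp f / (1 + wp f)) * Real.log 2 - c / hp f := by
      field_simp; ring
    rw [e]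
    have : 0 < c / hp f := by positivity
    linarith

end

theorem be_eq_of_mem_signSet {Φ : State} {σ : Fin 3 → ℤˣ} (hΦ : Φ ∈ signSet σ) {h : ℝ}
    (hh : h ≠ 0) (i : Fin 3) :
    be Φ i = ((σ i : ℤ) : ℝ) * (2 * Real.exp (xi Φ h i / h)) := by
  have h1 := hΦ i
  have h0 : be Φ i ≠ 0 := by
    intro h0
    rw [h0, Real.sign_zero] at h1
    have := abs_unit_cast (σ i)
    rw [← h1] at this
    simp at this
  have h2 : 2 * Real.exp (xi Φ h i / h) = |be Φ i| := by
    rw [xi, mul_div_cancel_left₀ _ hh, Real.exp_log (by positivity), abs_mul,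
      abs_of_pos (by norm_num : (0 : ℝ) < 1 / 2)]
    ring
  rw [h2, ← h1]
  rcases lt_or_gt_of_ne h0 with h | h
  · rw [Real.sign_of_neg h, abs_of_neg h]; ring
  · rw [Real.sign_of_pos h, abs_of_pos h]; ring

/-- γ = √z |β₁β₂β₃|^(1/6) has degree 1/2 in β. A field scaled by c therefore needs z divided by c,
which is the origin of z_L = z / λ_L. -/
theorem gammaOf_smul {c : ℝ} (hc : 0 < c) (β : Fin 3 → ℝ) {z : ℝ} (hz : 0 ≤ z) :
    gammaOf (c • β) z = c * gammaOf β (z / c) := by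
  unfold gammaOf
  have e : |(c • β) 0 * (c • β) 1 * (c • β) 2| = c ^ (3 : ℝ) * |β 0 * β 1 * β 2| := by
    simp only [Pi.smul_apply, smul_eq_mul]
    have : c * β 0 * (c * β 1) * (c * β 2) = c ^ 3 * (β 0 * β 1 * β 2) := by ring
    rw [this, abs_mul, abs_of_pos (by positivity)]
    norm_cast
  rw [e, Real.mul_rpow (by positivity) (abs_nonneg _), ← Real.rpow_mul hc.le, Real.sqrt_div hz]
  have e2 : (3 : ℝ) * (1 / 6) = 1 / 2 := by norm_num
  rw [e2, ← Real.sqrt_eq_rpow]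
  have h1 : c = √c * √c := (Real.mul_self_sqrt hc.le).symm
  have h2 : 0 < √c := by positivity
  calc √z * (√c * |β 0 * β 1 * β 2| ^ (1 / 6 : ℝ))
      = (√c * √c) * (√z / √c * |β 0 * β 1 * β 2| ^ (1 / 6 : ℝ)) := by field_simp
    _ = _ := by rw [← h1]

/-- Denominator in the parameters of a state on the section. -/
noncomputable def denOf (h lam α x : ℝ) : ℝ :=
  -(lam + α) * (x - h * Real.log lam) - lam * h * Real.log 2

/-- Numerator in the parameters of a state on the section. -/
noncomputable def numOf (h lam α x X : ℝ) : ℝ :=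
  -((lam - α) * X - lam * x + h * (2 * α - lam) * Real.log lam + (lam - α) * h * Real.log 2)

/-- The parameters of a state on the section, in terms of `λ = -α_a`, `α = α_b`, `x = ξ_a`,
`X = ξ_{c,b}`. -/
noncomputable def paramOf (h z lam α x X : ℝ) : Param :=
  !₂[h * lam / denOf h lam α x, α / (lam - α), numOf h lam α x X / denOf h lam α x, z / lam]

/-- Dividing by λ normalises α_a to -1. Then α_b determines w, the common size of β_a and β_b
determines h, β_c determines q, and ρ determines z. The remaining α_c is forced by the constraint,
which is linear in it with coefficient α_a + α_b < 0. -/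
theorem eq_smul_stateVec {π : Equiv.Perm (Fin 3)} {σ : Fin 3 → ℤˣ} {h z lam : ℝ} {Ψ : State}
    (hh : 0 < h) (hz : 0 < z) (hs : Ψ ∈ signSet σ)
    (hb : xi Ψ h (π 1) = xi Ψ h (π 0)) (hc : eqC Ψ (fun _ => 1) 1 = 0)
    (hg : ga Ψ = gammaOf Ψ.2.1 z) (hlam : lam = -al Ψ (π 0)) (h0 : 0 < al Ψ (π 1))
    (h1 : al Ψ (π 1) < lam) (hden : 0 < denOf h lam (al Ψ (π 1)) (xi Ψ h (π 0))) :
    Ψ = lam • stateVec π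
      (paramOf h z lam (al Ψ (π 1)) (xi Ψ h (π 0)) (xiPair Ψ h (π 2) (π 1))) σ := by
  set α := al Ψ (π 1) with hα
  set x := xi Ψ h (π 0) with hx
  set f' := paramOf h z lam α x (xiPair Ψ h (π 2) (π 1)) with hf'
  have hl : 0 < lam := h0.trans h1
  obtain ⟨s, hsd⟩ : ∃ s, s = lam - α := ⟨_, rfl⟩
  have hs0 : 0 < s := by linarith
  have hls : lam = s + α := by linarith
  have f0 : hp f' = h * lam / denOf h lam α x := rfl
  have f1 : wp f' = α / s := by rw [hsd]; rfl
  have f2 : qp f' = numOf h lam α x (xiPair Ψ h (π 2) (π 1)) / denOf h lam α x := rfl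
  have f3 : zp f' = z / lam := rfl
  have hw1 : (1 + wp f') / (1 + 2 * wp f') = lam / (lam + α) := by
    rw [f1, hls]; field_simp; ring
  have expo : ∀ y : ℝ, lam * (2 * Real.exp (y / h - Real.log lam)) = 2 * Real.exp (y / h) := by
    intro y
    rw [Real.exp_sub, Real.exp_log hl]; field_simp
  -- Dividing β by λ subtracts log λ from ξ / h. This equation determines the new h and produces
  -- `denOf`; the analogous one for β_c below produces `numOf`.
  have ex0 : -((1 + wp f') / (1 + 2 * wp f')) * (1 + hp f' * Real.log 2) / hp f'
      = x / h - Real.log lam := by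
    rw [hw1, f0]
    have e : -(lam / (lam + α)) * (1 + h * lam / denOf h lam α x * Real.log 2)
        / (h * lam / denOf h lam α x)
        = -(denOf h lam α x + lam * h * Real.log 2) / (h * (lam + α)) := by
      field_simp
    rw [e, denOf]
    field_simp
    ring
  have ex2 : (-(1 + wp f') * qp f' - wp f' * (1 + wp f') / (1 + 2 * wp f')
    - (1 + 3 * wp f' + wp f' ^ 2) / (1 + 2 * wp f') * (hp f' * Real.log 2)) / hp f'
      = xi Ψ h (π 2) / h - Real.log lam := by
    have hX : xiPair Ψ h (π 2) (π 1) = xi Ψ h (π 2) + x := by rw [xiPair, hb]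
    rw [f0, f1, f2]
    have e : (-(1 + α / s) * (numOf h lam α x (xiPair Ψ h (π 2) (π 1)) / denOf h lam α x)
        - α / s * (1 + α / s) / (1 + 2 * (α / s))
        - (1 + 3 * (α / s) + (α / s) ^ 2) / (1 + 2 * (α / s))
          * (h * lam / denOf h lam α x * Real.log 2)) / (h * lam / denOf h lam α x)
        = -(numOf h lam α x (xiPair Ψ h (π 2) (π 1))) / (h * s)
          - α * denOf h lam α x / (h * s * (s + 2 * α))
          - (s ^ 2 + 3 * α * s + α ^ 2) / (s * (s + 2 * α)) * Real.log 2 := by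
      have h2 : 0 < s + 2 * α := by linarith
      have h3 : (1 + 2 * (α / s)) = (s + 2 * α) / s := by field_simp
      have h4 : 1 + α / s = lam / s := by rw [hls]; field_simp
      rw [h3, h4]
      field_simp
    rw [e, numOf, denOf, hX, hls]
    have h2 : 0 < s + 2 * α := by linarith
    have h3 : s + α + α = s + 2 * α := by ring
    rw [h3]
    field_simp
    ring
  have hbe : ∀ i, be Ψ i = lam * be (stateVec π f' σ) i := by
    refine forall_perm π ?_ ?_ ?_
    · rw [be_eq_of_mem_signSet hs hh.ne', be_stateVec_zero, ex0, mul_left_comm lam, expo]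
    · rw [be_eq_of_mem_signSet hs hh.ne', be_stateVec_one, ex0, mul_left_comm lam, expo, hb]
    · rw [be_eq_of_mem_signSet hs hh.ne', be_stateVec_two, ex2, mul_left_comm lam, expo]
  have hga : ga Ψ = lam * ga (stateVec π f' σ) := by
    have e : Ψ.2.1 = lam • (stateVec π f' σ).2.1 := funext hbe
    rw [hg, e, gammaOf_smul hl _ hz.le]
    rfl
  have ha0 : al Ψ (π 0) = lam * al (stateVec π f' σ) (π 0) := by
    rw [al_stateVec_zero]; linarith
  have ha1 : al Ψ (π 1) = lam * al (stateVec π f' σ) (π 1) := by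
    rw [al_stateVec_one, ← hα, f1, hls]; field_simp
  have ha2 : al Ψ (π 2) = lam * al (stateVec π f' σ) (π 2) := by
    have c1 := eqC_stateVec π f' σ (by rw [f1]; positivity)
    rw [eqC_perm _ π] at hc c1
    rw [hbe, hbe, hbe, hga, ha0, ha1] at hc
    have hne : lam * (al (stateVec π f' σ) (π 0) + al (stateVec π f' σ) (π 1)) ≠ 0 := by
      have : lam * (al (stateVec π f' σ) (π 0) + al (stateVec π f' σ) (π 1)) = -s := by
        rw [mul_add, ← ha0, ← ha1, ← hα]; linarith
      rw [this]; linarith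
    have : (al Ψ (π 2) - lam * al (stateVec π f' σ) (π 2))
        * (lam * (al (stateVec π f' σ) (π 0) + al (stateVec π f' σ) (π 1))) = 0 := by
      linear_combination hc - lam ^ 2 * c1
    rcases mul_eq_zero.1 this with h | h
    · linarith
    · exact absurd h hne
  have hal : ∀ i, al Ψ i = lam * al (stateVec π f' σ) i := forall_perm π ha0 ha1 ha2
  exact Prod.ext (funext hal) (Prod.ext (funext hbe) hga)

/-! ### Comparison with the approximate transfer map -/

/-- The reference values of `denOf` and `numOf`. -/
noncomputable def denRef (f : Param) : ℝ :=
  pA f - kap f * (hp f * Real.log 2) + hp f * (2 + kap f) * Real.log (1 + kap f)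

/-- The reference value of `numOf`. -/
noncomputable def numRef (f : Param) : ℝ :=
  kap f * pC f - pA f - hp f * Real.log 2 + hp f * (kap f - 1) * Real.log (1 + kap f)

/-- For q > 1 the uniform numerator and denominator both carry a factor 1 / (1 + w), which cancels
in the quotients. -/
theorem mapQL_eq {f : Param} (hw : 0 < wp f) :
    mapQL f = !₂[hp f * (1 + kap f) / denRef f, 1 / kap f, numRef f / denRef f,
      zp f / (1 + kap f)] := by
  rcases le_or_gt (qp f) 1 with h | h
  · have e1 : kap f = 1 + wp f := if_pos h
    have e2 : pA f = (1 + wp f) * qp f := if_pos h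
    have e3 : pC f = 1 := if_pos h
    have hd : denRef f = denL f := by
      rw [denRef, denL, if_pos h, e1, e2]
      ring_nf
    have hn : numRef f = numOneL f := by
      rw [numRef, numOneL, if_pos h, e1, e2, e3]
      ring_nf
    rw [hd, hn, mapQL, if_pos h, if_pos h, numTwoL, e1]
    ring_nf
  · have e1 : kap f = (1 + wp f)⁻¹ := if_neg (not_le.2 h)
    have e2 : pA f = 1 := if_neg (not_le.2 h)
    have e3 : pC f = (1 + wp f) * qp f := if_neg (not_le.2 h)
    have e4 : 1 + (1 + wp f)⁻¹ = (2 + wp f) / (1 + wp f) := by field_simp; ring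
    have hd : denRef f = denL f / (1 + wp f) := by
      rw [denRef, denL, if_neg (not_le.2 h), e1, e2, e4]
      field_simp
      ring
    have hn : numRef f = numOneL f / (1 + wp f) := by
      rw [numRef, numOneL, if_neg (not_le.2 h), e1, e2, e3, e4]
      field_simp
      ring
    have c0 : hp f * (1 + (1 + wp f)⁻¹) / (denL f / (1 + wp f)) = numTwoL f / denL f := by
      rw [e4, numTwoL]; field_simp
    have c1 : 1 / (1 + wp f)⁻¹ = 1 + wp f := by field_simp
    have c2 : numOneL f / (1 + wp f) / (denL f / (1 + wp f)) = numOneL f / denL f := by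
      field_simp
    have c3 : zp f / (1 + (1 + wp f)⁻¹) = (1 + wp f) / (2 + wp f) * zp f := by
      rw [e4]; field_simp
    rw [hd, hn, mapQL, if_neg (not_le.2 h), if_neg (not_le.2 h), e1, c0, c1, c2, c3]

theorem abs_mul_sub_mul_le {a a₀ b b₀ A B δ η : ℝ} (ha : |a - a₀| ≤ δ) (hb : |b - b₀| ≤ η)
    (hB : |b| ≤ B) (hA : |a₀| ≤ A) : |a * b - a₀ * b₀| ≤ δ * B + A * η := by
  have e : a * b - a₀ * b₀ = (a - a₀) * b + a₀ * (b - b₀) := by ring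
  rw [e]
  refine (abs_add_le _ _).trans ?_
  rw [abs_mul, abs_mul]
  have := (abs_nonneg _).trans ha
  have := (abs_nonneg _).trans hA
  gcongr

theorem abs_log_sub_log_le {x y : ℝ} (hx : 1 ≤ x) (hy : 1 ≤ y) :
    |Real.log x - Real.log y| ≤ |x - y| := by
  have key : ∀ {x y : ℝ}, 1 ≤ x → 1 ≤ y → Real.log x - Real.log y ≤ |x - y| := by
    intro x y hx hy
    have hy0 : 0 < y := by linarith
    rw [← Real.log_div (by linarith) hy0.ne']
    refine (Real.log_le_sub_one_of_pos (by positivity)).trans ?_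
    have e : x / y - 1 = (x - y) / y := by field_simp
    rw [e]
    refine (div_le_div_of_nonneg_right (le_abs_self _) hy0.le).trans ?_
    exact div_le_self (abs_nonneg _) hy
  rw [abs_le]
  constructor
  · have := key hy hx
    rw [abs_sub_comm] at this
    linarith
  · exact key hx hy

/-- From ε^11 two powers go to the size of numerator and denominator, and two to the product of the
denominators. -/
theorem abs_div_sub_div_le {ε a a₀ b b₀ : ℝ} (hε : 0 < ε) (ha : |a - a₀| ≤ ε ^ 11)
    (hb : |b - b₀| ≤ ε ^ 11) (hb1 : ε ≤ b) (hb0 : ε ≤ b₀) (hA : |a₀| ≤ 8 * ε⁻¹ ^ 2)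
    (hB : b₀ ≤ 8 * ε⁻¹ ^ 2) : |a / b - a₀ / b₀| ≤ 16 * ε ^ 7 := by
  have h0 : 0 < b := hε.trans_le hb1
  have h00 : 0 < b₀ := hε.trans_le hb0
  have e : a / b - a₀ / b₀ = ((a - a₀) * b₀ - a₀ * (b - b₀)) / (b * b₀) := by
    field_simp; ring
  rw [e, abs_div, abs_of_pos (mul_pos h0 h00), div_le_iff₀ (mul_pos h0 h00)]
  have h1 : |(a - a₀) * b₀ - a₀ * (b - b₀)| ≤ ε ^ 11 * (8 * ε⁻¹ ^ 2) + 8 * ε⁻¹ ^ 2 * ε ^ 11 := by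
    refine (abs_sub _ _).trans ?_
    rw [abs_mul, abs_mul, abs_of_pos h00]
    gcongr
  have h2 : ε * ε ≤ b * b₀ := by gcongr
  calc _ ≤ _ := h1
    _ = 16 * ε ^ 7 * (ε * ε) := by field_simp; ring
    _ ≤ _ := by gcongr

/-- The factor 2 is √4, for four coordinates. -/
theorem norm_param_sub_le {a b : Param} {δ : ℝ} (hδ : 0 ≤ δ) (h : ∀ i, |a i - b i| ≤ δ) :
    ‖a - b‖ ≤ 2 * δ := by
  rw [EuclideanSpace.norm_eq, Real.sqrt_le_left (by positivity), Fin.sum_univ_four]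
  have key : ∀ i, ‖(a - b) i‖ ^ 2 ≤ δ ^ 2 := by
    intro i
    rw [PiLp.sub_apply, Real.norm_eq_abs]
    gcongr
    exact h i
  linarith [key 0, key 1, key 2, key 3]

namespace IsTransfer
variable {ε h z κ P P' T : ℝ} (S : IsTransfer ε h z κ P P' T)
include S

theorem inv_large : 2 ^ 40 ≤ ε⁻¹ := by
  rw [le_inv_comm₀ (by norm_num) S.pos]
  simpa using S.le

theorem le_inv_of_mul {x : ℝ} (hx : x * ε ≤ 1) : x ≤ ε⁻¹ := by
  rw [← one_div, le_div_iff₀ S.pos]; exact hx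

theorem κ_le : κ ≤ ε⁻¹ := S.le_inv_of_mul (by
  have := S.κ_mul_le
  have := S.h_le
  have := mul_pos S.κ_pos S.pos
  linarith)

theorem inv_κ_le : κ⁻¹ ≤ ε⁻¹ := by
  have h1 := S.le_κ_mul
  have h2 : h * κ ≤ κ := mul_le_of_le_one_left S.κ_pos.le (S.h_le.trans (by norm_num))
  have := S.pos
  gcongr
  linarith

/-- `ε` dominates the deviation with a large margin, also relative to `κ`. -/
theorem pow_le_κ : 2 ^ 20 * ε ^ 14 ≤ κ := by
  have h1 := S.le_κ_mul
  have h2 : h * κ ≤ κ := mul_le_of_le_one_left S.κ_pos.le (S.h_le.trans (by norm_num))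
  have h3 : ε ^ 14 ≤ ε ^ 1 := S.pow_le (by norm_num)
  rw [pow_one] at h3
  linarith [S.pos]

theorem log_nonneg : 0 ≤ Real.log (1 + κ) := Real.log_nonneg (by linarith [S.κ_pos])

theorem log_le : Real.log (1 + κ) ≤ κ := by
  have := Real.log_le_sub_one_of_pos (by linarith [S.κ_pos] : 0 < 1 + κ)
  linarith

/-- The only negative term is κ h log 2, at most κT / 2^7, and κT ≤ P. -/
theorem P_half_le_den :
    P / 2 ≤ P - κ * (h * Real.log 2) + h * (2 + κ) * Real.log (1 + κ) := by
  have h1 : κ * T ≤ P := by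
    nlinarith [S.T_le, S.κT_le, S.T_pos, mul_nonneg S.T_pos.le (sq_nonneg (κ - 1))]
  have h2 : κ * (h * Real.log 2) ≤ κ * (T / 2 ^ 7) :=
    mul_le_mul_of_nonneg_left S.h_log_two_le S.κ_pos.le
  have h3 : 0 ≤ h * (2 + κ) * Real.log (1 + κ) :=
    mul_nonneg (mul_nonneg S.h_pos.le (by linarith [S.κ_pos])) S.log_nonneg
  have := S.P_pos
  linarith

theorem eps_le_P : 2 ^ 40 * ε ≤ P := by
  have h1 := S.le_h'
  have h2 := S.h_lt
  have h3 := S.T_le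
  have := S.h_pos
  linarith

theorem abs_tau_le : |-((P + h * Real.log 2) / (2 + κ))| ≤ 2 * ε⁻¹ := by
  have h1 := S.h_log_two_nonneg
  have h2 := S.h_log_two_le
  have h3 := S.T_le_one
  have h4 := S.κ_pos
  have h5 := S.P_pos
  have h6 := S.le_inv_of_mul S.P_mul_le
  have h7 := S.inv_large
  rw [abs_neg, abs_of_nonneg (by positivity)]
  refine (div_le_self (by positivity) (by linarith)).trans ?_
  linarith

end IsTransfer

set_option maxHeartbeats 2000000 in
/-- The transferred parameters are close to the approximate ones. -/
theorem paramOf_near {f : Param} (hf : f ∈ paramSet) {α lam x X : ℝ}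
    (hα : |α - 1| ≤ eps f ^ 14) (hs : |(lam - α) - kap f| ≤ eps f ^ 14)
    (hx : |x - tauOneMinus f| ≤ 7 * eps f ^ 14) {t : ℝ}
    (ht : |t - tauOneMinus f| ≤ 5 * eps f ^ 14)
    (hX : |X - (-pC f - hp f * Real.log 2 - (kap f)⁻¹ * t)| ≤ eps f ^ 14) :
    0 < α ∧ α < lam ∧ 1 ≤ lam ∧ 0 < denOf (hp f) lam α x ∧
    ‖paramOf (hp f) (zp f) lam α x X - mapQL f‖ ≤ errK f ∧ |lam - lambdaL f| ≤ errK f := by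
  have S := isTransfer hf
  have hw := hf.2.1
  have hK := eps_le_errK hf
  have hε := S.pos
  have hh := S.h_pos
  have hκ := S.κ_pos
  have hκ1 := S.pow_le_κ
  have hζ := pow_pos hε 14
  have hζ1 := pow_fourteen_le hf
  have hM := S.inv_large
  have hκM := S.κ_le
  have hiκ := S.inv_κ_le
  have hPM := S.le_inv_of_mul S.P_mul_le
  have hP'M := S.le_inv_of_mul S.P'_mul_le
  have hP'0 := S.P'_pos
  have hP0 := S.P_pos
  have hL1 := S.h_log_two_le
  have hL0 := S.h_log_two_nonneg
  have hT1 := S.T_le_one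
  have hh1 : hp f ≤ 1 := S.h_le.trans (by norm_num)
  have hl0 := S.log_nonneg
  have hl1 := S.log_le
  have hτ := S.abs_tau_le
  rw [← tauOneMinus_eq hw] at hτ
  have hε1 := S.le
  have hmul : eps f ^ 14 * (eps f)⁻¹ = eps f ^ 13 := by field_simp
  have h13 : 1000 * eps f ^ 13 ≤ eps f ^ 12 := by
    have := S.pow_succ_le 12
    have := pow_pos hε 12
    linarith
  have h13a := pow_pos hε 13
  have h12 : 1000 * eps f ^ 12 ≤ eps f ^ 11 := by
    have := S.pow_succ_le 11
    have := pow_pos hε 11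
    linarith
  have h14 : 1000 * eps f ^ 14 ≤ eps f ^ 13 := by
    have := S.pow_succ_le 13
    linarith
  have h7 : 100 * eps f ^ 7 ≤ eps f := by
    have h1 : eps f ^ 7 ≤ eps f ^ 2 := S.pow_le (by norm_num)
    have h2 := S.pow_succ_le 1
    simp only [pow_one, Nat.reduceAdd] at h2
    linarith
  have h11 : eps f ^ 11 ≤ eps f := by
    have := S.pow_le (m := 1) (n := 11) (by norm_num)
    simpa using this
  set ζ := eps f ^ 14 with hζdef
  -- κ, 1/κ, P, P' and z are all at most M. Each product with such a quantity costs a power of ε: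
  -- from ε^14 the denominator keeps ε^12 and the numerator ε^11.
  set M := (eps f)⁻¹ with hMdef
  set κ := kap f with hκdef
  set τ := tauOneMinus f with hτdef
  have hαl := abs_le.1 hα
  have hsl := abs_le.1 hs
  have hα0 : 0 < α := by linarith
  have hlam1 : 1 ≤ lam := by linarith
  have hlamd : |lam - (1 + κ)| ≤ 2 * ζ := by rw [abs_le]; constructor <;> linarith
  have hlog : |Real.log lam - Real.log (1 + κ)| ≤ 2 * ζ :=
    (abs_log_sub_log_le hlam1 (by linarith)).trans hlamd
  have hlogl := abs_le.1 hlog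
  have hlogM : |Real.log lam| ≤ 2 * M := by
    rw [abs_of_nonneg (Real.log_nonneg hlam1)]; linarith
  have hxM : |x| ≤ 3 * M := by
    have := abs_sub_abs_le_abs_sub x τ
    linarith
  have hL : |hp f * Real.log 2| ≤ 1 := by rw [abs_of_nonneg hL0]; linarith
  -- denominators
  have hhl : |hp f * Real.log lam - hp f * Real.log (1 + κ)| ≤ 2 * ζ := by
    rw [← mul_sub, abs_mul, abs_of_pos hh]
    calc _ ≤ 1 * (2 * ζ) := by gcongr
      _ = _ := one_mul _
  have hhlM : |hp f * Real.log lam| ≤ 2 * M := by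
    rw [abs_mul, abs_of_pos hh]
    calc _ ≤ 1 * (2 * M) := by gcongr
      _ = _ := one_mul _
  have d1 : |(lam + α) * (x - hp f * Real.log lam)
      - (2 + κ) * (τ - hp f * Real.log (1 + κ))| ≤ 3 * ζ * (5 * M) + 2 * M * (9 * ζ) := by
    refine abs_mul_sub_mul_le ?_ ?_ ?_ ?_
    · rw [abs_le] at hlamd ⊢
      constructor <;> linarith
    · have e : x - hp f * Real.log lam - (τ - hp f * Real.log (1 + κ))
          = (x - τ) - (hp f * Real.log lam - hp f * Real.log (1 + κ)) := by ring
      rw [e]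
      exact (abs_sub _ _).trans (by linarith)
    · exact (abs_sub _ _).trans (by linarith)
    · rw [abs_of_pos (by linarith)]; linarith
  have d2 : |lam * (hp f * Real.log 2) - (1 + κ) * (hp f * Real.log 2)| ≤ 2 * ζ := by
    rw [← sub_mul, abs_mul]
    calc _ ≤ 2 * ζ * 1 := by gcongr
      _ = _ := mul_one _
  -- The defining equation of τ_{1-} identifies the reference numerator and denominator with `numOf`
  -- and `denOf` at α = 1, λ = 1 + κ, x = τ_{1-}.
  have hτeq : (2 + κ) * τ = -(pA f + hp f * Real.log 2) := by
    rw [hτdef, tauOneMinus_eq hw, ← hκdef]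
    field_simp
  have hdenref : denRef f
      = -((2 + κ) * (τ - hp f * Real.log (1 + κ))) - (1 + κ) * (hp f * Real.log 2) := by
    rw [denRef, ← hκdef]
    linear_combination hτeq
  have hden : |denOf (hp f) lam α x - denRef f| ≤ eps f ^ 12 := by
    have e : denOf (hp f) lam α x - denRef f = -((lam + α) * (x - hp f * Real.log lam)
        - (2 + κ) * (τ - hp f * Real.log (1 + κ)))
        - (lam * (hp f * Real.log 2) - (1 + κ) * (hp f * Real.log 2)) := by
      rw [hdenref, denOf]; ring
    rw [e]
    refine (abs_sub _ _).trans ?_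
    rw [abs_neg]
    have e2 : 3 * ζ * (5 * M) + 2 * M * (9 * ζ) = 33 * eps f ^ 13 := by rw [← hmul]; ring
    linarith
  have hden1 : 2 * eps f ≤ denRef f := by
    have h1 : pA f / 2 ≤ denRef f := S.P_half_le_den
    have := S.eps_le_P
    linarith
  have hdenl := abs_le.1 hden
  have hden2 : eps f ≤ denOf (hp f) lam α x := by linarith
  have hM2 : M ≤ M ^ 2 := le_self_pow₀ (by linarith only [hM]) two_ne_zero
  have hκl : κ * Real.log (1 + κ) ≤ M ^ 2 := by
    calc _ ≤ M * M := by gcongr; exact hl1.trans hκM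
      _ = _ := by ring
  have hκl0 : 0 ≤ κ * Real.log (1 + κ) := mul_nonneg hκ.le hl0
  have hhκl : hp f * (κ * Real.log (1 + κ)) ≤ M ^ 2 :=
    (mul_le_of_le_one_left hκl0 hh1).trans hκl
  have hhl1 : hp f * Real.log (1 + κ) ≤ M :=
    (mul_le_of_le_one_left hl0 hh1).trans (hl1.trans hκM)
  have hhl0 : 0 ≤ hp f * Real.log (1 + κ) := mul_nonneg hh.le hl0
  have hhκl0 : 0 ≤ hp f * (κ * Real.log (1 + κ)) := mul_nonneg hh.le hκl0
  have hκL0 : 0 ≤ κ * (hp f * Real.log 2) := mul_nonneg hκ.le hL0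
  have hdenB : denRef f ≤ 8 * M ^ 2 := by
    have e : denRef f = pA f - κ * (hp f * Real.log 2)
        + (2 * (hp f * Real.log (1 + κ)) + hp f * (κ * Real.log (1 + κ))) := by
      rw [denRef, ← hκdef]; ring
    rw [e]
    linarith
  have hκP' : κ * pC f ≤ M ^ 2 := by
    calc _ ≤ M * M := by gcongr
      _ = _ := by ring
  have hκP'0 : 0 ≤ κ * pC f := by positivity
  have hnumB : |numRef f| ≤ 8 * M ^ 2 := by
    have e : numRef f = κ * pC f - pA f - hp f * Real.log 2
        + (hp f * (κ * Real.log (1 + κ)) - hp f * Real.log (1 + κ)) := by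
      rw [numRef, ← hκdef]; ring
    rw [e, abs_le]
    constructor <;> linarith
  -- numerators
  have hmul2 : ζ * M ^ 2 = eps f ^ 12 := by rw [hζdef, hMdef]; field_simp
  have hiκ0 : 0 < κ⁻¹ := inv_pos.2 hκ
  -- The crossing time t is replaced by τ_{1-}, at the price of the slope 1/κ.
  have hXd : |X - (-pC f - hp f * Real.log 2 - κ⁻¹ * τ)| ≤ ζ + M * (5 * ζ) := by
    have e : X - (-pC f - hp f * Real.log 2 - κ⁻¹ * τ)
        = (X - (-pC f - hp f * Real.log 2 - κ⁻¹ * t)) - κ⁻¹ * (t - τ) := by ring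
    rw [e]
    refine (abs_sub _ _).trans ?_
    rw [abs_mul, abs_of_pos hiκ0]
    gcongr
  have hX0 : |(-pC f - hp f * Real.log 2 - κ⁻¹ * τ)| ≤ 4 * M ^ 2 := by
    have h1 : |κ⁻¹ * τ| ≤ M * (2 * M) := by
      rw [abs_mul, abs_of_pos hiκ0]; gcongr
    have h2 := abs_le.1 h1
    have e : M * (2 * M) = 2 * M ^ 2 := by ring
    rw [abs_le]
    constructor <;> linarith
  have hXM : |X| ≤ 5 * M ^ 2 := by
    have h1 := abs_sub_abs_le_abs_sub X (-pC f - hp f * Real.log 2 - κ⁻¹ * τ)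
    have h2 : ζ + M * (5 * ζ) ≤ M ^ 2 := by
      have e : M * (5 * ζ) = 5 * eps f ^ 13 := by rw [← hmul]; ring
      have := S.pow_le (m := 0) (n := 12) (by norm_num)
      rw [pow_zero] at this
      linarith
    linarith
  have n1 : |(lam - α) * X - κ * (-pC f - hp f * Real.log 2 - κ⁻¹ * τ)|
      ≤ ζ * (5 * M ^ 2) + M * (ζ + M * (5 * ζ)) :=
    abs_mul_sub_mul_le hs hXd hXM (by rw [abs_of_pos hκ]; exact hκM)
  have n2 : |lam * x - (1 + κ) * τ| ≤ 2 * ζ * (3 * M) + 2 * M * (7 * ζ) :=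
    abs_mul_sub_mul_le hlamd hx hxM (by rw [abs_of_pos (by linarith)]; linarith)
  have n3 : |(2 * α - lam) * (hp f * Real.log lam) - (1 - κ) * (hp f * Real.log (1 + κ))|
      ≤ 2 * ζ * (2 * M) + 2 * M * (2 * ζ) := by
    refine abs_mul_sub_mul_le ?_ hhl hhlM ?_
    · rw [abs_le]; constructor <;> linarith
    · rw [abs_le]; constructor <;> linarith
  have n4 : |(lam - α) * (hp f * Real.log 2) - κ * (hp f * Real.log 2)| ≤ ζ := by
    rw [← sub_mul, abs_mul]
    calc _ ≤ ζ * 1 := by gcongr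
      _ = _ := mul_one _
  have hnumref : numRef f = -(κ * (-pC f - hp f * Real.log 2 - κ⁻¹ * τ) - (1 + κ) * τ
      + (1 - κ) * (hp f * Real.log (1 + κ)) + κ * (hp f * Real.log 2)) := by
    rw [numRef, ← hκdef]
    have e : κ * (κ⁻¹ * τ) = τ := by field_simp
    linear_combination -hτeq - e
  have hnum : |numOf (hp f) lam α x X - numRef f| ≤ eps f ^ 11 := by
    have e : numOf (hp f) lam α x X - numRef f
        = -(((lam - α) * X - κ * (-pC f - hp f * Real.log 2 - κ⁻¹ * τ))
          - (lam * x - (1 + κ) * τ)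
          + ((2 * α - lam) * (hp f * Real.log lam) - (1 - κ) * (hp f * Real.log (1 + κ)))
          + ((lam - α) * (hp f * Real.log 2) - κ * (hp f * Real.log 2))) := by
      rw [hnumref, numOf]; ring
    have e1 : ζ * (5 * M ^ 2) + M * (ζ + M * (5 * ζ)) = 10 * eps f ^ 12 + eps f ^ 13 := by
      rw [← hmul, ← hmul2]; ring
    have e2 : 2 * ζ * (3 * M) + 2 * M * (7 * ζ) = 20 * eps f ^ 13 := by rw [← hmul]; ring
    have e3 : 2 * ζ * (2 * M) + 2 * M * (2 * ζ) = 8 * eps f ^ 13 := by rw [← hmul]; ring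
    rw [e1, abs_le] at n1
    rw [e2, abs_le] at n2
    rw [e3, abs_le] at n3
    rw [abs_le] at n4
    rw [e, abs_le]
    constructor <;> linarith
  have hεκ : 2 * eps f ≤ κ := by
    have h1 := S.le_κ_mul
    have h2 : hp f * κ ≤ κ := mul_le_of_le_one_left hκ.le hh1
    linarith
  have hz : zp f ≤ M := S.le_inv_of_mul (S.z_mul_le.trans (by norm_num))
  have hz0 := S.z_pos
  have hfin : ∀ r : ℝ, r ≤ 16 * eps f ^ 7 → r ≤ eps f := fun r hr => by
    have := pow_pos hε 7
    linarith
  refine ⟨hα0, by linarith, hlam1, by linarith, ?_, ?_⟩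
  · refine (norm_param_sub_le hε.le fun i => hfin _ ?_).trans (by linarith)
    rw [mapQL_eq hw, paramOf]
    fin_cases i
    · refine abs_div_sub_div_le hε ?_ (by linarith) hden2 (by linarith) ?_ hdenB
      · rw [← hκdef, ← mul_sub, abs_mul, abs_of_pos hh]
        calc _ ≤ 1 * (2 * ζ) := by gcongr
          _ ≤ _ := by linarith
      · rw [← hκdef, abs_of_pos (by positivity)]
        calc _ ≤ 1 * (2 * M) := by gcongr; linarith
          _ ≤ _ := by linarith
    · refine abs_div_sub_div_le hε (by linarith) (hs.trans (by linarith)) (by linarith)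
        (by linarith) ?_ (by linarith)
      rw [abs_one]; linarith
    · exact abs_div_sub_div_le hε hnum (by linarith) hden2 (by linarith) hnumB hdenB
    · refine abs_div_sub_div_le hε ?_ (hlamd.trans (by linarith)) (by linarith)
        (by linarith) ?_ (by linarith)
      · rw [sub_self, abs_zero]; positivity
      · rw [abs_of_pos hz0]; linarith
  · rw [lambdaL_eq hw]
    exact hlamd.trans (by linarith)

/-! ### The transfer at a fixed parameter -/

/-- The field `Φ` connects the section `𝓗(π', σ)` at time `t₂` to `Φ_*(π, f, σ)`. -/
structure IsBounceField (π : Equiv.Perm (Fin 3)) (σ : Fin 3 → ℤˣ) (f f' : Param) (lam t₂ : ℝ)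
    (Φ : ℝ → State) : Prop where
  mem_fieldSet : Φ ∈ fieldSet σ t₂ (tauOnePlus f)
  contDiffOn : ContDiffOn ℝ ∞ Φ (Icc t₂ (tauOnePlus f))
  isSolutionOn : IsSolutionOn (Icc t₂ (tauOnePlus f)) Φ (hp f)
  right : Φ (tauOnePlus f) = stateVec π f σ
  left : Φ t₂ = lam • stateVec (permL π f) f' σ
  right_mem : Φ (tauOnePlus f) ∈ sectionSet π σ
  left_mem : Φ t₂ ∈ sectionSet (permL π f) σ
  compare : ∀ τ ∈ Icc t₂ (1 / 2 * tauOneMinus f),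
    |be (Φ τ) (permL π f 0)| ≤ |be (Φ τ) (π 0)| ∧
      (|be (Φ τ) (π 0)| = |be (Φ τ) (permL π f 0)| ↔ τ = t₂)
  distE_le : distE π (hp f) t₂ (tauOnePlus f) Φ (refField π f σ) ≤ ENNReal.ofReal (errK f)
  alPair_le : ∀ τ ∈ Icc t₂ (tauOnePlus f),
    max (alPair (Φ τ) (π 1) (π 2)) (max (alPair (Φ τ) (π 2) (π 0)) (alPair (Φ τ) (π 0) (π 1)))
      ≤ -(1 / 2 ^ 2) * min (wp f ^ 2) (wp f)⁻¹

/-- `f'`, `lam` and `t₂` are values of the transfer maps at `f`. -/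
structure IsBounce (π : Equiv.Perm (Fin 3)) (σ : Fin 3 → ℤˣ) (f f' : Param) (lam t₂ : ℝ) :
    Prop where
  param_near : ‖f' - mapQL f‖ ≤ errK f
  scale_near : |lam - lambdaL f| ≤ errK f
  tauMinus_lt : tauMinus f < t₂
  lt_half : t₂ < 1 / 2 * tauOneMinus f
  time_near : |t₂ - tauOneMinus f| ≤ errK f
  half_le : 1 / 2 ≤ tauOnePlus f - t₂
  le_three : tauOnePlus f - t₂ ≤ 3
  exists_field : ∃ Φ, IsBounceField π σ f f' lam t₂ Φ

/-- The deviation `d` solves the system, and `t₂` is its crossing time. -/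
structure IsCrossing (π : Equiv.Perm (Fin 3)) (σ : Fin 3 → ℤˣ) (f : Param)
    (d : ℝ → Fin 6 → ℝ) (t₂ : ℝ) : Prop extends IsDeviation π σ f d where
  tLo_lt : tLo f < t₂
  lt_half : t₂ < 1 / 2 * tauOneMinus f
  near : |t₂ - tauOneMinus f| ≤ 5 * eps f ^ 14
  xi_eq : xi (devState π σ f t₂ (d t₂)) (hp f) (π 0)
    = xi (devState π σ f t₂ (d t₂)) (hp f) (permL π f 0)
  xi_lt : ∀ t ∈ Icc (tLo f) (1 / 2 * tauOneMinus f),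
    (t < t₂ → xi (devState π σ f t (d t)) (hp f) (π 0)
      < xi (devState π σ f t (d t)) (hp f) (permL π f 0)) ∧
    (t₂ < t → xi (devState π σ f t (d t)) (hp f) (permL π f 0)
      < xi (devState π σ f t (d t)) (hp f) (π 0))

theorem exists_isCrossing (π : Equiv.Perm (Fin 3)) (σ : Fin 3 → ℤˣ) {f : Param}
    (hf : f ∈ paramSet) : ∃ p : (ℝ → Fin 6 → ℝ) × ℝ, IsCrossing π σ f p.1 p.2 := by
  obtain ⟨d, D⟩ := exists_isDeviation π σ hf
  obtain ⟨t₂, h1, h2, h3, h4, h5⟩ := exists_crossing hf D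
  exact ⟨(d, t₂), ⟨D, h1, h2, h3, h4, h5⟩⟩

/-- The scaling factor read off from a state on the section. -/
noncomputable def scaleAt (π' : Equiv.Perm (Fin 3)) (Ψ : State) : ℝ := -al Ψ (π' 0)

/-- The parameters read off from a state on the section. -/
noncomputable def paramAt (π' : Equiv.Perm (Fin 3)) (h z : ℝ) (Ψ : State) : Param :=
  paramOf h z (scaleAt π' Ψ) (al Ψ (π' 1)) (xi Ψ h (π' 0)) (xiPair Ψ h (π' 2) (π' 1))

theorem abs_be_eq {Φ : State} {σ : Fin 3 → ℤˣ} (hΦ : Φ ∈ signSet σ) {h : ℝ} (hh : h ≠ 0)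
    (i : Fin 3) : |be Φ i| = 2 * Real.exp (xi Φ h i / h) := by
  rw [be_eq_of_mem_signSet hΦ hh, abs_mul, abs_unit_cast, one_mul, abs_of_pos (by positivity)]

theorem abs_be_lt_abs_be {Φ : State} {σ : Fin 3 → ℤˣ} (hΦ : Φ ∈ signSet σ) {h : ℝ} (hh : 0 < h)
    {i j : Fin 3} (hij : xi Φ h i < xi Φ h j) : |be Φ i| < |be Φ j| := by
  rw [abs_be_eq hΦ hh.ne', abs_be_eq hΦ hh.ne']
  gcongr

theorem devState_mem_signSet (π : Equiv.Perm (Fin 3)) (σ : Fin 3 → ℤˣ) (f : Param) (t : ℝ)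
    (d : Fin 6 → ℝ) : devState π σ f t d ∈ signSet σ := stateOf_mem_signSet _ _ _ _ _

namespace IsCrossing
variable {π : Equiv.Perm (Fin 3)} {σ : Fin 3 → ℤˣ} {f : Param} {d : ℝ → Fin 6 → ℝ} {t₂ : ℝ}

theorem neg (hf : f ∈ paramSet) (C : IsCrossing π σ f d t₂) : t₂ < 0 := by
  have h1 := C.lt_half
  have h2 := tauOneMinus_neg hf
  have h3 := (isTransfer hf).T_pos
  linarith

theorem lt_tauOnePlus (hf : f ∈ paramSet) (C : IsCrossing π σ f d t₂) : t₂ < tauOnePlus f := by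
  have h1 := C.neg hf
  have h2 := half_le_tauOnePlus hf.1 hf.2.1
  linarith

theorem eqC_eq_zero (hf : f ∈ paramSet) (C : IsCrossing π σ f d t₂) {t : ℝ}
    (ht : t ∈ Icc (tLo f) (tauOnePlus f)) :
    eqC (devState π σ f t (d t)) (fun _ => 1) 1 = 0 := by
  have := C.isTraj.eqC_eq ht ⟨ht.1.trans ht.2, le_rfl⟩
  simp only [C.eq_stateVec] at this
  rw [this, eqC_stateVec _ _ _ hf.2.1]

/-- What the approximate formulas say about the state at the crossing time. -/
theorem near_approx (hf : f ∈ paramSet) (C : IsCrossing π σ f d t₂) :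
    let Ψ := devState π σ f t₂ (d t₂)
    let π' := permL π f
    0 < al Ψ (π' 1) ∧ al Ψ (π' 1) < scaleAt π' Ψ ∧ 1 ≤ scaleAt π' Ψ ∧
    0 < denOf (hp f) (scaleAt π' Ψ) (al Ψ (π' 1)) (xi Ψ (hp f) (π' 0)) ∧
    ‖paramAt π' (hp f) (zp f) Ψ - mapQL f‖ ≤ errK f ∧ |scaleAt π' Ψ - lambdaL f| ≤ errK f := by
  intro Ψ π'
  have hd := C.norm_le t₂ ⟨C.tLo_lt.le, (C.lt_tauOnePlus hf).le⟩
  obtain ⟨p1, -, p3⟩ := pair_devState π σ (t := t₂) hf.1.ne' hd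
  obtain ⟨b1, b2⟩ := before_bounce π σ hf C.lt_half.le hd
  have e1 : π' 1 = π 0 := permL_one π
  unfold paramAt
  refine paramOf_near hf (t := t₂) ?_ ?_ ?_ C.near ?_
  · rw [e1]; exact b1
  · rw [e1, scaleAt]
    rw [abs_sub_comm] at p1
    convert p1 using 2
    rw [alPair]; ring
  · have h1 : xi Ψ (hp f) (π' 0) = xi Ψ (hp f) (π 0) := C.xi_eq.symm
    rw [h1]
    have h2 := C.near
    have := abs_sub_le (xi Ψ (hp f) (π 0)) t₂ (tauOneMinus f)
    linarith
  · rw [e1]; exact p3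

theorem paramAt_mem_targetSet (hf : f ∈ paramSet) (C : IsCrossing π σ f d t₂) :
    paramAt (permL π f) (hp f) (zp f) (devState π σ f t₂ (d t₂)) ∈ targetSet := by
  obtain ⟨h1, h2, h3, h4, -, -⟩ := C.near_approx hf
  have hh := hf.1
  have hz := hf.2.2.2.1
  have hl := zero_lt_one.trans_le h3
  exact ⟨div_pos (mul_pos hh hl) h4, div_pos h1 (by linarith), div_pos hz hl⟩

theorem eq_smul (hf : f ∈ paramSet) (C : IsCrossing π σ f d t₂) :
    devState π σ f t₂ (d t₂) = scaleAt (permL π f) (devState π σ f t₂ (d t₂)) •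
      stateVec (permL π f)
        (paramAt (permL π f) (hp f) (zp f) (devState π σ f t₂ (d t₂))) σ := by
  obtain ⟨h1, h2, h3, h4, -, -⟩ := C.near_approx hf
  refine eq_smul_stateVec hf.1 hf.2.2.2.1 (devState_mem_signSet _ _ _ _ _) ?_ ?_ rfl rfl h1 h2 h4
  · rw [permL_one]; exact C.xi_eq
  · exact C.eqC_eq_zero hf ⟨C.tLo_lt.le, (C.lt_tauOnePlus hf).le⟩

theorem isBounceField (hf : f ∈ paramSet) (C : IsCrossing π σ f d t₂) :
    IsBounceField π σ f (paramAt (permL π f) (hp f) (zp f) (devState π σ f t₂ (d t₂)))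
      (scaleAt (permL π f) (devState π σ f t₂ (d t₂))) t₂ (fun t => devState π σ f t (d t)) := by
  have hlt := C.lt_tauOnePlus hf
  have htraj := C.isTraj.mono C.tLo_lt.le le_rfl
  have hT := C.paramAt_mem_targetSet hf
  have hlam := (C.near_approx hf).2.2.1
  have h1p := tauOnePlus_le hf
  have hm : -1 < t₂ := (neg_one_le_tauMinus hf).trans_lt ((tauMinus_lt_tLo hf).trans C.tLo_lt)
  have hnorm : ∀ t ∈ Icc t₂ (tauOnePlus f), ‖d t‖ ≤ eps f ^ 14 := fun t ht =>
    C.norm_le t ⟨C.tLo_lt.le.trans ht.1, ht.2⟩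
  refine ⟨⟨htraj.continuousOn, fun t _ => devState_mem_signSet _ _ _ _ _⟩, htraj.contDiffOn,
    htraj.isSolutionOn hf.1.ne' hlt ?_, C.eq_stateVec, C.eq_smul hf, ?_, ?_, ?_, ?_, ?_⟩
  · simp only [C.eq_stateVec]; exact eqC_stateVec _ _ _ hf.2.1
  · simp only [C.eq_stateVec]
    simpa using smul_stateVec_mem_sectionSet π f σ one_pos hf.1 hf.2.1
  · have := smul_stateVec_mem_sectionSet (permL π f)
      (paramAt (permL π f) (hp f) (zp f) (devState π σ f t₂ (d t₂))) σ
      (zero_lt_one.trans_le hlam) hT.1 hT.2.1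
    rwa [← C.eq_smul hf] at this
  · intro t ht
    rcases ht.1.eq_or_lt with rfl | h
    · have e : |be (devState π σ f t₂ (d t₂)) (π 0)|
          = |be (devState π σ f t₂ (d t₂)) (permL π f 0)| := by
        rw [abs_be_eq (devState_mem_signSet _ _ _ _ _) hf.1.ne', C.xi_eq,
          ← abs_be_eq (devState_mem_signSet _ _ _ _ _) hf.1.ne']
      exact ⟨e.ge, iff_of_true e rfl⟩
    · have := abs_be_lt_abs_be (devState_mem_signSet _ _ _ _ _) hf.1
        ((C.xi_lt t ⟨C.tLo_lt.le.trans ht.1, ht.2⟩).2 h)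
      exact ⟨this.le, iff_of_false this.ne' h.ne'⟩
  · refine iSup₂_le fun t ht => ENNReal.ofReal_le_ofReal ?_
    refine (distD_devState_le π σ hf ?_ (hnorm t ht)).trans ?_
    · rw [abs_le]; constructor <;> linarith [ht.1, ht.2]
    · linarith [eps_le_errK hf, eps_pos f]
  · exact fun t ht => alPair_max_le π σ hf (hnorm t ht)

theorem isBounce (hf : f ∈ paramSet) (C : IsCrossing π σ f d t₂) :
    IsBounce π σ f (paramAt (permL π f) (hp f) (zp f) (devState π σ f t₂ (d t₂)))
      (scaleAt (permL π f) (devState π σ f t₂ (d t₂))) t₂ := by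
  obtain ⟨-, -, -, -, h5, h6⟩ := C.near_approx hf
  have h1p := tauOnePlus_le hf
  have h2p := half_le_tauOnePlus hf.1 hf.2.1
  have hneg := C.neg hf
  have hlt := (tauMinus_lt_tLo hf).trans C.tLo_lt
  have hm := neg_one_le_tauMinus hf
  refine ⟨h5, h6, hlt, C.lt_half, C.near.trans ?_, by linarith, by linarith,
    ⟨_, C.isBounceField hf⟩⟩
  linarith [eps_le_errK hf, eps_pos f, pow_fourteen_le hf, pow_pos (eps_pos f) 14]

end IsCrossing

/-! ### Uniqueness -/

/-- Both fields start from Φ_* backwards in time, so they agree on the shorter interval. At its left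
end |β_a| = |β_{a'}|, and for the longer field this happens only at its own left end. -/
theorem IsBounceField.time_le {π : Equiv.Perm (Fin 3)} {σ : Fin 3 → ℤˣ} {f f₁ f₂ : Param}
    {l₁ l₂ s t : ℝ} {Φ Ψ : ℝ → State} (hh : 0 < hp f) (hw : 0 < wp f)
    (hs : s < 1 / 2 * tauOneMinus f) (h0 : tauOneMinus f < 0)
    (h1 : IsBounceField π σ f f₁ l₁ s Φ) (h2 : IsBounceField π σ f f₂ l₂ t Ψ) (hst : t ≤ s) :
    s = t ∧ Φ s = Ψ s := by
  have hp := half_le_tauOnePlus hh hw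
  have T1 := h1.isSolutionOn.isTraj hh.ne' h1.contDiffOn
  have T2 := (h2.isSolutionOn.isTraj hh.ne' h2.contDiffOn).mono hst le_rfl
  have heq := T1.eqOn hh T2 (h1.right.trans h2.right.symm)
  have hs' : Φ s = Ψ s := heq ⟨le_rfl, by linarith⟩
  have e := ((h1.compare s ⟨le_rfl, hs.le⟩).2).2 rfl
  rw [hs'] at e
  exact ⟨((h2.compare s ⟨hst, hs.le⟩).2).1 e, hs'⟩

/-- The parameters are recovered one by one: λ from α_a, w from α_b, h from β_a, q from β_c, and z
from γ. -/
theorem smul_stateVec_injective {π : Equiv.Perm (Fin 3)} {σ : Fin 3 → ℤˣ} {f₁ f₂ : Param}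
    {l₁ l₂ : ℝ} (hf₁ : f₁ ∈ targetSet) (hf₂ : f₂ ∈ targetSet) (hl : 0 < l₁)
    (h : l₁ • stateVec π f₁ σ = l₂ • stateVec π f₂ σ) : f₁ = f₂ ∧ l₁ = l₂ := by
  obtain ⟨hh₁, hw₁, hz₁⟩ := hf₁
  obtain ⟨hh₂, hw₂, hz₂⟩ := hf₂
  have e : l₁ = l₂ := by
    have := congrArg (fun Φ => al Φ (π 0)) h
    simp only [al_smul, al_stateVec_zero] at this
    linarith
  subst e
  have h' : stateVec π f₁ σ = stateVec π f₂ σ := smul_right_injective _ hl.ne' h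
  have hu : ∀ i, ((σ i : ℤ) : ℝ) ≠ 0 := fun i h0 => by
    have := abs_unit_cast (σ i)
    rw [h0] at this
    simp at this
  have ew : wp f₁ = wp f₂ := by
    have := congrArg (fun Φ => al Φ (π 1)) h'
    simp only [al_stateVec_one] at this
    rw [div_eq_div_iff (by positivity) (by positivity)] at this
    linarith
  have eh : hp f₁ = hp f₂ := by
    have := congrArg (fun Φ => be Φ (π 0)) h'
    simp only [be_stateVec_zero, ew] at this
    have := Real.exp_injective (mul_left_cancel₀ two_ne_zero (mul_left_cancel₀ (hu _) this))
    rw [div_eq_div_iff hh₁.ne' hh₂.ne'] at this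
    have h3 : (1 + wp f₂) / (1 + 2 * wp f₂) ≠ 0 := by positivity
    have h4 : -((1 + wp f₂) / (1 + 2 * wp f₂)) * hp f₂
        = -((1 + wp f₂) / (1 + 2 * wp f₂)) * hp f₁ := by linear_combination this
    exact (mul_left_cancel₀ (neg_ne_zero.2 h3) h4).symm
  have eq : qp f₁ = qp f₂ := by
    have := congrArg (fun Φ => be Φ (π 2)) h'
    simp only [be_stateVec_two, ew, eh] at this
    have := Real.exp_injective (mul_left_cancel₀ two_ne_zero (mul_left_cancel₀ (hu _) this))
    rw [div_left_inj' hh₂.ne'] at this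
    have h3 : 1 + wp f₂ ≠ 0 := by positivity
    exact mul_left_cancel₀ h3 (by linear_combination -this)
  have ez : zp f₁ = zp f₂ := by
    have h3 : ga (stateVec π f₁ σ) = ga (stateVec π f₂ σ) := by rw [h']
    have h4 : (stateVec π f₁ σ).2.1 = (stateVec π f₂ σ).2.1 := by rw [h']
    have g : ∀ f, ga (stateVec π f σ) = gammaOf (stateVec π f σ).2.1 (zp f) := fun _ => rfl
    rw [g, g, h4, gammaOf, gammaOf] at h3
    have hb : ∀ i, (stateVec π f₂ σ).2.1 i ≠ 0 := fun i =>
      mul_ne_zero (hu i) (by positivity)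
    have h5 := mul_right_cancel₀ (Real.rpow_pos_of_pos (abs_pos.2
      (mul_ne_zero (mul_ne_zero (hb 0) (hb 1)) (hb 2))) _).ne' h3
    exact (Real.sqrt_inj hz₁.le hz₂.le).1 h5
  refine ⟨?_, rfl⟩
  ext i
  fin_cases i
  exacts [eh, ew, eq, ez]

theorem IsBounce.unique {π : Equiv.Perm (Fin 3)} {σ : Fin 3 → ℤˣ} {f f₁ f₂ : Param}
    {l₁ l₂ s t : ℝ} (hf : f ∈ paramSet) (h1 : IsBounce π σ f f₁ l₁ s)
    (h2 : IsBounce π σ f f₂ l₂ t) (hf₁ : f₁ ∈ targetSet) (hf₂ : f₂ ∈ targetSet) (hl₁ : 1 ≤ l₁) :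
    f₁ = f₂ ∧ l₁ = l₂ ∧ s = t := by
  obtain ⟨Φ, F1⟩ := h1.exists_field
  obtain ⟨Ψ, F2⟩ := h2.exists_field
  have h0 : tauOneMinus f < 0 := by
    have h2 := tauOneMinus_neg hf
    have h3 := (isTransfer hf).T_pos
    linarith
  obtain ⟨rfl, e⟩ : s = t ∧ Φ s = Ψ s := by
    rcases le_total t s with h | h
    · exact F1.time_le hf.1 hf.2.1 h1.lt_half h0 F2 h
    · obtain ⟨rfl, e⟩ := F2.time_le hf.1 hf.2.1 h2.lt_half h0 F1 h
      exact ⟨rfl, e.symm⟩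
  rw [F1.left, F2.left] at e
  obtain ⟨e1, e2⟩ := smul_stateVec_injective hf₁ hf₂ (zero_lt_one.trans_le hl₁) e
  exact ⟨e1, e2, rfl⟩

open Filter Topology

/-! ### Continuous dependence on the parameters -/

section
variable {X : Type*} [TopologicalSpace X]

theorem continuous_vec_comp (π : Equiv.Perm (Fin 3)) {a b c : X → ℝ} (ha : Continuous a)
    (hb : Continuous b) (hc : Continuous c) :
    Continuous fun x => ![a x, b x, c x] ∘ π.symm := by
  refine continuous_pi fun i => ?_
  change Continuous fun x => ![a x, b x, c x] (π.symm i)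
  generalize π.symm i = j
  fin_cases j
  exacts [ha, hb, hc]

theorem continuous_betaOf (σ : Fin 3 → ℤˣ) {h : X → ℝ} (hh : Continuous h) (h0 : ∀ x, h x ≠ 0)
    {ξ : X → Fin 3 → ℝ} (hξ : Continuous ξ) : Continuous fun x => betaOf (h x) σ (ξ x) := by
  refine continuous_pi fun i => ?_
  have : Continuous fun x => ξ x i / h x := ((continuous_apply i).comp hξ).div hh h0
  unfold betaOf
  fun_prop

theorem continuous_gammaOf {β : X → Fin 3 → ℝ} (hβ : Continuous β) {z : X → ℝ}
    (hz : Continuous z) : Continuous fun x => gammaOf (β x) (z x) := by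
  unfold gammaOf
  refine hz.sqrt.mul (Continuous.rpow_const ?_ fun x => Or.inr (by norm_num))
  fun_prop

end

theorem continuous_hp : Continuous fun f : paramSet => hp f :=
  (EuclideanSpace.proj (𝕜 := ℝ) (0 : Fin 4)).continuous.comp continuous_subtype_val
theorem continuous_wp : Continuous fun f : paramSet => wp f :=
  (EuclideanSpace.proj (𝕜 := ℝ) (1 : Fin 4)).continuous.comp continuous_subtype_val
theorem continuous_qp : Continuous fun f : paramSet => qp f :=
  (EuclideanSpace.proj (𝕜 := ℝ) (2 : Fin 4)).continuous.comp continuous_subtype_val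
theorem continuous_zp : Continuous fun f : paramSet => zp f :=
  (EuclideanSpace.proj (𝕜 := ℝ) (3 : Fin 4)).continuous.comp continuous_subtype_val

/-- The value q = 1 is excluded from 𝓕, so the two branches never have to match. -/
theorem continuous_ite_qp {g₁ g₂ : paramSet → ℝ} (h₁ : Continuous g₁) (h₂ : Continuous g₂) :
    Continuous fun f : paramSet => if qp f ≤ 1 then g₁ f else g₂ f :=
  h₁.if_le h₂ continuous_qp continuous_const fun f h => absurd h f.2.2.2.2.2.1

theorem eventually_permL_eq (π : Equiv.Perm (Fin 3)) (f₀ : paramSet) :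
    ∀ᶠ f : paramSet in 𝓝 f₀, permL π f = permL π f₀ := by
  have hq := continuous_qp.tendsto f₀
  rcases lt_or_gt_of_ne f₀.2.2.2.2.2.1 with h | h
  · filter_upwards [hq.eventually_lt_const h] with f hf
    rw [permL, permL, if_pos hf.le, if_pos h.le]
  · filter_upwards [hq.eventually_const_lt h] with f hf
    rw [permL, permL, if_neg (not_le.2 hf), if_neg (not_le.2 h)]

theorem continuous_tauOnePlus : Continuous fun f : paramSet => tauOnePlus f := by
  have hh := continuous_hp
  have hw := continuous_wp
  unfold tauOnePlus
  refine (by fun_prop : Continuous fun f : paramSet => 1 + hp f * Real.log 2).mul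
    (Continuous.div (by fun_prop) (by fun_prop) fun f => ?_)
  have := f.2.2.1
  positivity

theorem continuous_tauOneMinus : Continuous fun f : paramSet => tauOneMinus f := by
  have hh := continuous_hp
  have hw := continuous_wp
  have hq := continuous_qp
  have h1 : Continuous fun f : paramSet => (3 + wp f)⁻¹ :=
    Continuous.inv₀ (by fun_prop) fun f => by have := f.2.2.1; positivity
  have h2 : Continuous fun f : paramSet => (3 + 2 * wp f)⁻¹ :=
    Continuous.inv₀ (by fun_prop) fun f => by have := f.2.2.1; positivity
  unfold tauOneMinus
  simp only [div_eq_mul_inv]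
  exact continuous_ite_qp (by fun_prop) (by fun_prop)

theorem continuous_tLo : Continuous fun f : paramSet => tLo f := by
  have hh := continuous_hp
  have hw := continuous_wp
  have hq := continuous_qp
  have h1 : Continuous fun f : paramSet => (1 + wp f)⁻¹ :=
    Continuous.inv₀ (by fun_prop) fun f => by have := f.2.2.1; positivity
  have h2 : Continuous fun f : paramSet => (hp f)⁻¹ :=
    Continuous.inv₀ (by fun_prop) fun f => f.2.1.ne'
  have h3 : Continuous fun f : paramSet => tauStar f := by
    unfold tauStar
    simp only [div_eq_mul_inv]
    exact continuous_ite_qp (by fun_prop) (by fun_prop)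
  have h4 := continuous_tauOneMinus
  unfold tLo eps
  simp only [one_div]
  fun_prop

theorem continuous_stateVec (π : Equiv.Perm (Fin 3)) (σ : Fin 3 → ℤˣ) :
    Continuous fun f : paramSet => stateVec π f σ := by
  have hh := continuous_hp
  have hw := continuous_wp
  have hq := continuous_qp
  have hz := continuous_zp
  have h1 : Continuous fun f : paramSet => (1 + wp f)⁻¹ :=
    Continuous.inv₀ (by fun_prop) fun f => by have := f.2.2.1; positivity
  have h2 : Continuous fun f : paramSet => (1 + 2 * wp f)⁻¹ :=
    Continuous.inv₀ (by fun_prop) fun f => by have := f.2.2.1; positivity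
  unfold stateVec
  simp only [div_eq_mul_inv]
  have hβ := continuous_betaOf σ hh (fun f => f.2.1.ne') (continuous_vec_comp π
    (a := fun f : paramSet => -((1 + wp f) * (1 + 2 * wp f)⁻¹) * (1 + hp f * Real.log 2))
    (b := fun f : paramSet => -((1 + wp f) * (1 + 2 * wp f)⁻¹) * (1 + hp f * Real.log 2))
    (c := fun f : paramSet => -(1 + wp f) * qp f - wp f * (1 + wp f) * (1 + 2 * wp f)⁻¹
      - (1 + 3 * wp f + wp f ^ 2) * (1 + 2 * wp f)⁻¹ * (hp f * Real.log 2))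
    (by fun_prop) (by fun_prop) (by fun_prop))
  have hγ := continuous_gammaOf hβ hz
  refine (continuous_vec_comp π ?_ ?_ ?_).prodMk (hβ.prodMk hγ)
  · fun_prop
  · fun_prop
  · have b := fun i => (continuous_apply i).comp hβ
    have b0 := b 0
    have b1 := b 1
    have b2 := b 2
    simp only [Function.comp_def] at b0 b1 b2
    fun_prop

theorem continuous_devState (π : Equiv.Perm (Fin 3)) (σ : Fin 3 → ℤˣ) :
    Continuous fun p : paramSet × ℝ × (Fin 6 → ℝ) => devState π σ p.1 p.2.1 p.2.2 := by
  have hh : Continuous fun p : paramSet × ℝ × (Fin 6 → ℝ) => hp p.1 :=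
    continuous_hp.comp continuous_fst
  have hw : Continuous fun p : paramSet × ℝ × (Fin 6 → ℝ) => wp p.1 :=
    continuous_wp.comp continuous_fst
  have hq : Continuous fun p : paramSet × ℝ × (Fin 6 → ℝ) => qp p.1 :=
    continuous_qp.comp continuous_fst
  have hz : Continuous fun p : paramSet × ℝ × (Fin 6 → ℝ) => zp p.1 :=
    continuous_zp.comp continuous_fst
  have h1 : Continuous fun p : paramSet × ℝ × (Fin 6 → ℝ) => (1 + wp p.1)⁻¹ :=
    Continuous.inv₀ (by fun_prop) fun p => by have := p.1.2.2.1; positivity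
  have hy : Continuous fun p : paramSet × ℝ × (Fin 6 → ℝ) =>
      yDev (hp p.1) (1 + wp p.1)⁻¹ 1 (1 + wp p.1) ((1 + wp p.1) * qp p.1) p.2.1 p.2.2 := by
    refine continuous_pi fun j => ?_
    unfold yDev
    fin_cases j
    · change Continuous fun p : paramSet × ℝ × (Fin 6 → ℝ) => p.2.2 0 / 16
      fun_prop
    · change Continuous fun p : paramSet × ℝ × (Fin 6 → ℝ) => p.2.1 + p.2.2 1
      fun_prop
    · change Continuous fun p : paramSet × ℝ × (Fin 6 → ℝ) => -(1 + wp p.1)⁻¹ + p.2.2 2 / 16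
      fun_prop
    · change Continuous fun p : paramSet × ℝ × (Fin 6 → ℝ) =>
        -1 - hp p.1 * Real.log 2 - (1 + wp p.1)⁻¹ * p.2.1 + p.2.2 3
      fun_prop
    · change Continuous fun p : paramSet × ℝ × (Fin 6 → ℝ) => -(1 + wp p.1) + p.2.2 4 / 16
      fun_prop
    · change Continuous fun p : paramSet × ℝ × (Fin 6 → ℝ) =>
        -((1 + wp p.1) * qp p.1) - hp p.1 * Real.log 2 - (1 + wp p.1) * p.2.1 + p.2.2 5
      fun_prop
  have hyj := fun j => (continuous_apply j).comp hy
  have hy1 := (hyj 1).div hh fun p => p.1.2.1.ne'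
  have ha : Continuous fun p : paramSet × ℝ × (Fin 6 → ℝ) => alA (hp p.1)
      (yDev (hp p.1) (1 + wp p.1)⁻¹ 1 (1 + wp p.1) ((1 + wp p.1) * qp p.1) p.2.1 p.2.2) :=
    ((Real.continuous_exp.comp (hyj 0)).mul
      ((contDiff_tanh (n := 0)).continuous.comp hy1)).neg
  have hx : Continuous fun p : paramSet × ℝ × (Fin 6 → ℝ) => xiA (hp p.1)
      (yDev (hp p.1) (1 + wp p.1)⁻¹ 1 (1 + wp p.1) ((1 + wp p.1) * qp p.1) p.2.1 p.2.2) :=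
    hh.mul ((hyj 0).sub (((Real.continuous_cosh.comp hy1).const_mul 2).log fun p =>
      (mul_pos two_pos (Real.cosh_pos _)).ne'))
  have hβ := continuous_betaOf σ hh (fun p => p.1.2.1.ne')
    (continuous_vec_comp π hx ((hyj 3).sub hx) ((hyj 5).sub hx))
  exact (continuous_vec_comp π ha ((hyj 2).sub ha) ((hyj 4).sub ha)).prodMk
    (hβ.prodMk (continuous_gammaOf hβ hz))

/-- The states within the deviation bound are bounded, locally uniformly in the parameter. -/
theorem exists_norm_devState_le (π : Equiv.Perm (Fin 3)) (σ : Fin 3 → ℤˣ) (f₀ : paramSet) :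
    ∃ R, ∀ᶠ f : paramSet in 𝓝 f₀, ∀ t ∈ Icc (-1 : ℝ) (3 / 2), ∀ d : Fin 6 → ℝ, ‖d‖ ≤ 1 →
      ‖devState π σ f t d‖ ≤ R := by
  have hK : IsCompact (Icc (-1 : ℝ) (3 / 2) ×ˢ closedBall (0 : Fin 6 → ℝ) 1) :=
    isCompact_Icc.prod (isCompact_closedBall _ _)
  have hc := continuous_devState π σ
  have hc0 : Continuous fun p : ℝ × (Fin 6 → ℝ) => devState π σ f₀ p.1 p.2 :=
    hc.comp (continuous_const.prodMk continuous_id)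
  obtain ⟨R, hR⟩ := hK.exists_bound_of_continuousOn hc0.continuousOn
  refine ⟨R + 1, ?_⟩
  -- Tube lemma: a strict bound on a compact set of (t, d) persists for nearby parameters.
  have := hK.eventually_forall_of_forall_eventually (x₀ := f₀)
    (P := fun (f : paramSet) p => ‖devState π σ f p.1 p.2‖ ≤ R + 1) fun p hp => by
      have h1 := (hc.norm.tendsto (f₀, p)).eventually_lt_const
        ((hR p hp).trans_lt (lt_add_one R))
      exact h1.mono fun q hq => hq.le
  filter_upwards [this] with f hf t ht d hd
  exact hf (t, d) ⟨ht, by simpa using hd⟩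

section
variable {π : Equiv.Perm (Fin 3)} {σ : Fin 3 → ℤˣ} {D : paramSet → ℝ → Fin 6 → ℝ}

/-- The trajectory with end point `Φ_*(π, f, σ)` at time `0`, in the time `(τ - τ₁₊) / h`. -/
noncomputable def scaledTraj (π : Equiv.Perm (Fin 3)) (σ : Fin 3 → ℤˣ)
    (D : paramSet → ℝ → Fin 6 → ℝ) (f : paramSet) (s : ℝ) : State :=
  devState π σ f (tauOnePlus f + hp f * s) (D f (tauOnePlus f + hp f * s))

/-- In rescaled time all parameters solve the same equation, and f enters through the data at time
0. A common ball supplies the Lipschitz constant for Grönwall. -/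
theorem exists_dist_scaledTraj_le (hD : ∀ f : paramSet, IsDeviation π σ f (D f)) (f₀ : paramSet)
    {S : ℝ} (hS : S < (tauOnePlus f₀ - tLo f₀) / hp f₀) :
    ∃ C, ∀ᶠ f : paramSet in 𝓝 f₀, ∀ s ∈ Icc (-S) 0,
      dist (scaledTraj π σ D f s) (scaledTraj π σ D f₀ s)
        ≤ dist (stateVec π f σ) (stateVec π f₀ σ) * C := by
  obtain ⟨R, hR⟩ := exists_norm_devState_le π σ f₀
  obtain ⟨K, hK⟩ := exists_lipschitzOnWith_vectorField R
  refine ⟨Real.exp (K * S), ?_⟩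
  have hS' : ∀ᶠ f : paramSet in 𝓝 f₀, S < (tauOnePlus f - tLo f) / hp f :=
    (((continuous_tauOnePlus.sub continuous_tLo).div continuous_hp fun f =>
      f.2.1.ne').tendsto f₀).eventually_const_lt hS
  have key : ∀ f : paramSet, (∀ t ∈ Icc (-1 : ℝ) (3 / 2), ∀ d : Fin 6 → ℝ, ‖d‖ ≤ 1 →
      ‖devState π σ f t d‖ ≤ R) → S < (tauOnePlus f - tLo f) / hp f →
      IsTraj 1 (-S) 0 (scaledTraj π σ D f) ∧ ∀ s ∈ Icc (-S) 0, ‖scaledTraj π σ D f s‖ ≤ R := by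
    intro f hf hSf
    refine ⟨((hD f).isTraj.rescale f.2.1).mono (neg_le_neg hSf.le) le_rfl, fun s hs => ?_⟩
    rw [lt_div_iff₀ f.2.1] at hSf
    have hh := f.2.1
    have hs1 : hp (f : Param) * s ≤ 0 := mul_nonpos_of_nonneg_of_nonpos hh.le hs.2
    have hs2 : -(S * hp (f : Param)) ≤ hp (f : Param) * s := by
      have := mul_le_mul_of_nonneg_left hs.1 hh.le
      linarith
    have hm := (neg_one_le_tauMinus f.2).trans (tauMinus_lt_tLo f.2).le
    have hp' := tauOnePlus_le f.2
    refine hf _ ⟨by linarith, by linarith⟩ _ (((hD f).norm_le _ ⟨by linarith, by linarith⟩).trans ?_)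
    have := pow_fourteen_le f.2
    have := (isTransfer f.2).le
    linarith [pow_pos (eps_pos f) 14]
  obtain ⟨T0, B0⟩ := key f₀ hR.self_of_nhds hS
  filter_upwards [hR, hS'] with f h1 h2 s hs
  obtain ⟨T1, B1⟩ := key f h1 h2
  refine (dist_le_of_isTraj hK T1 T0 B1 B0 hs).trans_eq ?_
  simp only [scaledTraj, mul_zero, add_zero, (hD _).eq_stateVec]

/-- Joint continuity of the trajectories in the parameter and the time. -/
theorem tendsto_scaledTraj (hD : ∀ f : paramSet, IsDeviation π σ f (D f)) (f₀ : paramSet)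
    {s : paramSet → ℝ} {s₀ : ℝ} (hs : Tendsto s (𝓝 f₀) (𝓝 s₀)) (h0 : s₀ < 0)
    (h1 : -((tauOnePlus f₀ - tLo f₀) / hp f₀) < s₀) :
    Tendsto (fun f => scaledTraj π σ D f (s f)) (𝓝 f₀) (𝓝 (scaledTraj π σ D f₀ s₀)) := by
  -- The interval [-S, 0] contains s₀ in its interior and is shorter than the domain at f₀, so it
  -- lies in the domains for all nearby f.
  obtain ⟨S, hS1, hS2⟩ := exists_between (neg_lt.1 h1)
  obtain ⟨C, hC⟩ := exists_dist_scaledTraj_le hD f₀ hS2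
  have hin : ∀ᶠ f in 𝓝 f₀, s f ∈ Icc (-S) 0 :=
    hs.eventually (Icc_mem_nhds (neg_lt.1 hS1) h0)
  have hcont : ContinuousAt (scaledTraj π σ D f₀) s₀ :=
    ((hD f₀).isTraj.rescale f₀.2.1).continuousOn.continuousAt (Icc_mem_nhds h1 h0)
  have hz : Tendsto (fun f : paramSet => dist (stateVec π f σ) (stateVec π f₀ σ) * C
      + dist (scaledTraj π σ D f₀ (s f)) (scaledTraj π σ D f₀ s₀)) (𝓝 f₀) (𝓝 0) := by
    have a := ((continuous_stateVec π σ).tendsto f₀).dist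
      (tendsto_const_nhds (x := stateVec π f₀ σ))
    have b := (hcont.tendsto.comp hs).dist (tendsto_const_nhds (x := scaledTraj π σ D f₀ s₀))
    simpa using (a.mul_const C).add b
  rw [tendsto_iff_dist_tendsto_zero]
  refine squeeze_zero' (Eventually.of_forall fun _ => dist_nonneg) ?_ hz
  filter_upwards [hC, hin] with f hf hfs
  exact (dist_triangle _ (scaledTraj π σ D f₀ (s f)) _).trans
    (add_le_add_left (hf _ hfs) _)

variable {t₂ : paramSet → ℝ}

/-- The crossing time in the scaled time. -/
noncomputable def scaledTime (t₂ : paramSet → ℝ) (f : paramSet) : ℝ :=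
  (t₂ f - tauOnePlus f) / hp f

theorem add_mul_scaledTime (t₂ : paramSet → ℝ) (f : paramSet) :
    tauOnePlus f + hp f * scaledTime t₂ f = t₂ f := by
  have := f.2.1
  unfold scaledTime; field_simp; ring

theorem scaledTraj_scaledTime (t₂ : paramSet → ℝ) (f : paramSet) :
    scaledTraj π σ D f (scaledTime t₂ f) = devState π σ f (t₂ f) (D f (t₂ f)) := by
  rw [scaledTraj, add_mul_scaledTime]

/-- At a fixed time s just before or after the crossing, |β_a| and |β_{a'}| compare strictly. The
comparison persists for f near f₀, so the crossing time stays on the same side of s. -/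
theorem continuous_scaledTime (hC : ∀ f : paramSet, IsCrossing π σ f (D f) (t₂ f)) :
    Continuous (scaledTime t₂) := by
  have hD : ∀ f : paramSet, IsDeviation π σ f (D f) := fun f => (hC f).toIsDeviation
  rw [continuous_iff_continuousAt]
  intro f₀
  have hh := f₀.2.1
  have hlo : -((tauOnePlus f₀ - tLo f₀) / hp (f₀ : Param)) < scaledTime t₂ f₀ := by
    rw [scaledTime, ← neg_div]
    gcongr
    linarith [(hC f₀).tLo_lt]
  have hhi : scaledTime t₂ f₀
      < (1 / 2 * tauOneMinus f₀ - tauOnePlus f₀) / hp (f₀ : Param) := by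
    rw [scaledTime]
    gcongr
    exact (hC f₀).lt_half
  have hhi0 : ∀ f : paramSet, (1 / 2 * tauOneMinus f - tauOnePlus f) / hp (f : Param) < 0 := by
    intro f
    have h2 := tauOneMinus_neg f.2
    have h3 := (isTransfer f.2).T_pos
    have h4 := half_le_tauOnePlus f.2.1 f.2.2.1
    exact div_neg_of_neg_of_pos (by linarith) f.2.1
  have clo : ∀ s, -((tauOnePlus f₀ - tLo f₀) / hp (f₀ : Param)) < s →
      ∀ᶠ f : paramSet in 𝓝 f₀, -((tauOnePlus f - tLo f) / hp (f : Param)) < s := fun s hs =>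
    (((continuous_tauOnePlus.sub continuous_tLo).div continuous_hp fun f =>
      f.2.1.ne').neg.tendsto f₀).eventually_lt_const hs
  have chi : ∀ s, s < (1 / 2 * tauOneMinus f₀ - tauOnePlus f₀) / hp (f₀ : Param) →
      ∀ᶠ f : paramSet in 𝓝 f₀, s < (1 / 2 * tauOneMinus f - tauOnePlus f) / hp (f : Param) :=
    fun s hs => ((((continuous_tauOneMinus.const_mul (1 / 2)).sub continuous_tauOnePlus).div
      continuous_hp fun f => f.2.1.ne').tendsto f₀).eventually_const_lt hs
  have hcmp : ∀ f : paramSet, ∀ s, -((tauOnePlus f - tLo f) / hp (f : Param)) < s →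
      s < (1 / 2 * tauOneMinus f - tauOnePlus f) / hp (f : Param) →
      (s < scaledTime t₂ f → |be (scaledTraj π σ D f s) (π 0)|
        < |be (scaledTraj π σ D f s) (permL π f 0)|) ∧
      (scaledTime t₂ f < s → |be (scaledTraj π σ D f s) (permL π f 0)|
        < |be (scaledTraj π σ D f s) (π 0)|) := by
    intro f s h1 h2
    have hf := f.2.1
    rw [← neg_div, div_lt_iff₀ hf] at h1
    rw [lt_div_iff₀ hf] at h2
    have := (hC f).xi_lt (tauOnePlus f + hp f * s) ⟨by linarith, by linarith⟩
    refine ⟨fun h => ?_, fun h => ?_⟩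
    · rw [scaledTime, lt_div_iff₀ hf] at h
      exact abs_be_lt_abs_be (devState_mem_signSet _ _ _ _ _) hf (this.1 (by linarith))
    · rw [scaledTime, div_lt_iff₀ hf] at h
      exact abs_be_lt_abs_be (devState_mem_signSet _ _ _ _ _) hf (this.2 (by linarith))
  have cabs : ∀ i s, -((tauOnePlus f₀ - tLo f₀) / hp (f₀ : Param)) < s → s < 0 →
      Tendsto (fun f => |be (scaledTraj π σ D f s) i|) (𝓝 f₀)
        (𝓝 |be (scaledTraj π σ D f₀ s) i|) := by
    intro i s h1 h2
    have hbe : Continuous fun Φ : State => |be Φ i| := by unfold be; fun_prop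
    exact (hbe.tendsto _).comp (tendsto_scaledTraj hD f₀ tendsto_const_nhds h2 h1)
  rw [ContinuousAt, tendsto_order]
  constructor
  · intro a ha
    -- The maximum keeps s inside the interval on which the sign of ξ_a - ξ_{a'} is known.
    obtain ⟨s, hs1, hs2⟩ := exists_between (max_lt ha hlo)
    have hs3 := (le_max_right _ _).trans_lt hs1
    have hs4 := hs2.trans hhi
    have h0 := (hcmp f₀ s hs3 hs4).1 hs2
    filter_upwards [eventually_permL_eq π f₀, clo s hs3, chi s hs4,
      (cabs (π 0) s hs3 (hs4.trans (hhi0 f₀))).eventually_lt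
        (cabs (permL π f₀ 0) s hs3 (hs4.trans (hhi0 f₀))) h0] with f e1 e2 e3 e4
    refine ((le_max_left _ _).trans_lt hs1).trans_le (not_lt.1 fun h => ?_)
    have := (hcmp f s e2 e3).2 h
    rw [e1] at this
    exact lt_asymm e4 this
  · intro a ha
    obtain ⟨s, hs1, hs2⟩ := exists_between (lt_min ha hhi)
    have hs3 := hlo.trans hs1
    have hs4 := hs2.trans_le (min_le_right _ _)
    have h0 := (hcmp f₀ s hs3 hs4).2 hs1
    filter_upwards [eventually_permL_eq π f₀, clo s hs3, chi s hs4,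
      (cabs (permL π f₀ 0) s hs3 (hs4.trans (hhi0 f₀))).eventually_lt
        (cabs (π 0) s hs3 (hs4.trans (hhi0 f₀))) h0] with f e1 e2 e3 e4
    refine (not_lt.1 fun h => ?_ : scaledTime t₂ f ≤ s).trans_lt (hs2.trans_le (min_le_left _ _))
    have := (hcmp f s e2 e3).1 h
    rw [e1] at this
    exact lt_asymm e4 this

theorem continuous_crossingTime (hC : ∀ f : paramSet, IsCrossing π σ f (D f) (t₂ f)) :
    Continuous t₂ := by
  have : Continuous fun f : paramSet => tauOnePlus f + hp f * scaledTime t₂ f :=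
    continuous_tauOnePlus.add (continuous_hp.mul (continuous_scaledTime hC))
  simpa only [add_mul_scaledTime] using this

theorem continuous_crossingState (hC : ∀ f : paramSet, IsCrossing π σ f (D f) (t₂ f)) :
    Continuous fun f : paramSet => devState π σ f (t₂ f) (D f (t₂ f)) := by
  rw [continuous_iff_continuousAt]
  intro f₀
  have hh := f₀.2.1
  have h0 : scaledTime t₂ f₀ < 0 :=
    div_neg_of_neg_of_pos (by linarith [(hC f₀).lt_tauOnePlus f₀.2]) hh
  have h1 : -((tauOnePlus f₀ - tLo f₀) / hp (f₀ : Param)) < scaledTime t₂ f₀ := by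
    rw [scaledTime, ← neg_div]
    gcongr
    linarith [(hC f₀).tLo_lt]
  have := tendsto_scaledTraj (fun f => (hC f).toIsDeviation) f₀
    ((continuous_scaledTime hC).tendsto f₀) h0 h1
  simp only [scaledTraj_scaledTime] at this
  exact this

theorem continuous_scaleAt (hC : ∀ f : paramSet, IsCrossing π σ f (D f) (t₂ f)) :
    Continuous fun f : paramSet => scaleAt (permL π f) (devState π σ f (t₂ f) (D f (t₂ f))) := by
  rw [continuous_iff_continuousAt]
  intro f₀
  have h1 : Continuous fun f : paramSet =>
      scaleAt (permL π f₀) (devState π σ f (t₂ f) (D f (t₂ f))) := by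
    have hal : Continuous fun Φ : State => -Φ.1 (permL π f₀ 0) := by fun_prop
    exact hal.comp (continuous_crossingState hC)
  refine h1.continuousAt.congr ?_
  filter_upwards [eventually_permL_eq π f₀] with f hf
  rw [hf]

theorem continuous_paramAt (hC : ∀ f : paramSet, IsCrossing π σ f (D f) (t₂ f)) :
    Continuous fun f : paramSet =>
      paramAt (permL π f) (hp f) (zp f) (devState π σ f (t₂ f) (D f (t₂ f))) := by
  rw [continuous_iff_continuousAt]
  intro f₀
  have hΨ := continuous_crossingState hC
  have hh := continuous_hp
  have hz := continuous_zp
  set Ψ := fun f : paramSet => devState π σ f (t₂ f) (D f (t₂ f)) with hΨd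
  set π' := permL π f₀ with hπ'
  have hal : ∀ i, Continuous fun f => al (Ψ f) i := fun i => by unfold al; fun_prop
  have hxi : ∀ i, Continuous fun f : paramSet => xi (Ψ f) (hp f) i := fun i => by
    have hb : ∀ f, |1 / 2 * be (Ψ f) i| ≠ 0 := fun f =>
      abs_ne_zero.2 (mul_ne_zero (by norm_num) (be_stateOf_ne_zero _ _ _ _ _ _))
    have hc : Continuous fun f => |1 / 2 * be (Ψ f) i| := by unfold be; fun_prop
    exact hh.mul (hc.log hb)
  have a0 := (hal (π' 0)).continuousAt (x := f₀)
  have a1 := (hal (π' 1)).continuousAt (x := f₀)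
  have x0 := (hxi (π' 0)).continuousAt (x := f₀)
  have x1 := (hxi (π' 1)).continuousAt (x := f₀)
  have x2 := (hxi (π' 2)).continuousAt (x := f₀)
  have hh' := hh.continuousAt (x := f₀)
  have hz' := hz.continuousAt (x := f₀)
  obtain ⟨p1, p2, p3, p4, -, -⟩ := (hC f₀).near_approx f₀.2
  have hl : ContinuousAt (fun f => scaleAt π' (Ψ f)) f₀ := a0.neg
  have hl0 : scaleAt π' (Ψ f₀) ≠ 0 := (zero_lt_one.trans_le p3).ne'
  have hlog := hl.log hl0
  have hden : ContinuousAt (fun f : paramSet =>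
      denOf (hp f) (scaleAt π' (Ψ f)) (al (Ψ f) (π' 1)) (xi (Ψ f) (hp f) (π' 0))) f₀ := by
    unfold denOf; fun_prop
  have hnum : ContinuousAt (fun f : paramSet =>
      numOf (hp f) (scaleAt π' (Ψ f)) (al (Ψ f) (π' 1)) (xi (Ψ f) (hp f) (π' 0))
        (xiPair (Ψ f) (hp f) (π' 2) (π' 1))) f₀ := by
    unfold numOf xiPair; fun_prop
  have key : ContinuousAt (fun f : paramSet => paramAt π' (hp f) (zp f) (Ψ f)) f₀ := by
    unfold paramAt paramOf
    refine (PiLp.continuous_toLp 2 _).continuousAt.comp (continuousAt_pi.2 fun i => ?_)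
    fin_cases i
    · exact (hh'.mul hl).div hden p4.ne'
    · exact a1.div (hl.sub a1) (sub_pos.2 p2).ne'
    · exact hnum.div hden p4.ne'
    · exact hz'.div hl hl0
  refine key.congr ?_
  filter_upwards [eventually_permL_eq π f₀] with f hf
  rw [hf]

end

end BianchiFluid

/-! ### The transfer maps -/

theorem proposition3p3 (π : Equiv.Perm (Fin 3)) (σ : Fin 3 → ℤˣ) :
    ∃! T : (paramSet → targetSet) × (paramSet → Set.Ici (1 : ℝ)) × (paramSet → Set.Iio (0 : ℝ)),
      (Continuous T.1 ∧ Continuous T.2.1 ∧ Continuous T.2.2) ∧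
      ∀ f : paramSet, ∀ (f' : Param) (lam τ₂m τ₂p : ℝ) (π' : Equiv.Perm (Fin 3)),
        f' = (T.1 f : Param) → lam = (T.2.1 f : ℝ) → τ₂m = (T.2.2 f : ℝ) →
        τ₂p = tauOnePlus f → π' = permL π f →
        ‖f' - mapQL f‖ ≤ errK f ∧
        |lam - lambdaL f| ≤ errK f ∧
        tauMinus f < τ₂m ∧ τ₂m < 1 / 2 * tauOneMinus f ∧ |τ₂m - tauOneMinus f| ≤ errK f ∧
        1 / 2 ≤ τ₂p - τ₂m ∧ τ₂p - τ₂m ≤ 3 ∧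
        ∃ Φ : ℝ → State,
          Φ ∈ fieldSet σ τ₂m τ₂p ∧
          ContDiffOn ℝ ∞ Φ (Set.Icc τ₂m τ₂p) ∧
          IsSolutionOn (Set.Icc τ₂m τ₂p) Φ (hp f) ∧
          Φ τ₂p = stateVec π f σ ∧
          Φ τ₂m = lam • stateVec π' f' σ ∧
          Φ τ₂p ∈ sectionSet π σ ∧
          Φ τ₂m ∈ sectionSet π' σ ∧
          (∀ τ ∈ Set.Icc τ₂m (1 / 2 * tauOneMinus f),
            |be (Φ τ) (π' 0)| ≤ |be (Φ τ) (π 0)| ∧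
            (|be (Φ τ) (π 0)| = |be (Φ τ) (π' 0)| ↔ τ = τ₂m)) ∧
          distE π (hp f) τ₂m τ₂p Φ (refField π f σ) ≤ ENNReal.ofReal (errK f) ∧
          ∀ τ ∈ Set.Icc τ₂m τ₂p,
            max (alPair (Φ τ) (π 1) (π 2))
              (max (alPair (Φ τ) (π 2) (π 0)) (alPair (Φ τ) (π 0) (π 1)))
              ≤ -(1 / 2 ^ 2) * min (wp f ^ 2) (wp f)⁻¹ := by
  -- An arbitrary choice of deviation and crossing time for each f is harmless: the continuity
  -- statements hold for any such family.
  choose p hC using fun f : paramSet => exists_isCrossing π σ f.2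
  have hB := fun f => (hC f).isBounce f.2
  refine ⟨(fun f => ⟨_, (hC f).paramAt_mem_targetSet f.2⟩,
    fun f => ⟨_, ((hC f).near_approx f.2).2.2.1⟩, fun f => ⟨_, (hC f).neg f.2⟩),
    ⟨⟨?_, ?_, ?_⟩, ?_⟩, ?_⟩
  · exact (continuous_paramAt hC).subtype_mk _
  · exact (continuous_scaleAt hC).subtype_mk _
  · exact (continuous_crossingTime hC).subtype_mk _
  · rintro f _ _ _ _ _ rfl rfl rfl rfl rfl
    have B := hB f
    have F := (hC f).isBounceField f.2
    exact ⟨B.param_near, B.scale_near, B.tauMinus_lt, B.lt_half, B.time_near, B.half_le,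
      B.le_three, _, F.mem_fieldSet, F.contDiffOn, F.isSolutionOn, F.right, F.left, F.right_mem,
      F.left_mem, F.compare, F.distE_le, F.alPair_le⟩
  -- Uniqueness is pointwise in f: each value of a competing triple comes with a field that can be
  -- compared with the constructed one.
  · rintro T ⟨-, hT⟩
    have hT' : ∀ f : paramSet, IsBounce π σ f (T.1 f) (T.2.1 f) (T.2.2 f) := fun f => by
      obtain ⟨h1, h2, h3, h4, h5, h6, h7, Φ, g1, g2, g3, g4, g5, g6, g7, g8, g9, g10⟩ :=
        hT f _ _ _ _ _ rfl rfl rfl rfl rfl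
      exact ⟨h1, h2, h3, h4, h5, h6, h7, Φ, g1, g2, g3, g4, g5, g6, g7, g8, g9, g10⟩
    have hu := fun f => (hT' f).unique f.2 (hB f) (T.1 f).2
      ((hC f).paramAt_mem_targetSet f.2) (T.2.1 f).2
    exact Prod.ext (funext fun f => Subtype.ext (hu f).1) (Prod.ext (funext fun f =>
      Subtype.ext (hu f).2.1) (funext fun f => Subtype.ext (hu f).2.2))
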